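/- **Setting.** Let $\mathcal O\subset\mathbb R^d$ be a bounded domain (non-empty, open, connected). For $x\in\mathbb R^d$ let $\nu(x)$ be the set of unit vectors $\nu\in\mathbb R^d$ for which there is $C>0$ with $(x'-x)\cdot\nu+C|x-x'|^2\ge 0$ for all $x'\in\bar{\mathcal O}$. Assume that $\mathcal O$ is *admissible* in the sense of Lions and Sznitman: 1. $\nu(x)\neq\emptyset$ for every $x\in\partial\mathcal O$, and there is $C_0\ge0$ with $(x'-x)\cdot\nu+C_0|x-x'|^2\ge0$ for all $x'\in\mathcal O$, $x\in\partial\mathcal O$, $\nu\in\nu(x)$; 2. there are $\phi\in C^2(\mathbb R^d;\mathbb R)$ and $\alpha>0$ with $\nabla\phi(x)\cdot\nu\ge\alpha$ for all $x\in\partial\mathcal O$, $\nu\in\nu(x)$; 3. there are $k\ge1$, $\lambda>0$, $\rho>0$, unit vectors $a_1,\dots,a_k$ and points $x_1,\dots,x_k\in\partial\mathcal O$ such that $\partial\mathcal O\subseteq\bigcup_iB(x_i,\rho)$, and $\nu\cdot a_i\ge\lambda$ for all $i$, all $x\in\partial\mathcal O\cap B(x_i,2\rho)$ and all $\nu\in\nu(x)$.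 Let $\sigma:\bar{\mathcal O}\to\mathrm{Hom}(\mathbb R^r;\mathbb R^d)$ and $b:\bar{\mathcal O}\to\mathbb R^d$ be Lipschitz continuous and let $x_0\in\bar{\mathcal O}$. Let $\mathbb W$ be the standard Wiener measure on $C([0,\infty);\mathbb R^r)$. For a path $W$ and $N\in\mathbb N=\{0,1,2,\dots\}$ let $W^N$ be its $N$-dyadic linear polygonalization: $W^N_{m2^{-N}}=W_{m2^{-N}}$, and $W^N$ is linear on $[m2^{-N},(m+1)2^{-N}]$, for all $m\in\mathbb N$. Let $(X^N,L^N)$ be the solution of the reflected equation driven by $W^N$; that is, $X^N:[0,\infty)\to\bar{\mathcal O}$ is continuous, $L^N:[0,\infty)\to\mathbb R^d$ is continuous and of locally bounded variation, and, for all $t\ge0$, $$X^N_t=x_0+\int_0^t\sigma(X^N_s)\,dW^N_s+\int_0^tb(X^N_s)\,ds+L^N_t,$$ $$|L^N|_t=\int_0^t\mathbf 1_{\partial\mathcal O}(X^N_s)\,d|L^N|_s,\qquad \frac{dL^N_s}{d|L^N|_s}\in\nu(X^N_s)\quad d|L^N|\text{-a.e.},$$ where $|L^N|_t$ is the total variation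 of $L^N$ on $[0,t]$. For $\psi:[0,\infty)\to\mathbb R^n$ put $$\|\psi\|_{\beta,[0,T]}=\sup_{0\le u_1<u_2\le T}\frac{|\psi(u_2)-\psi(u_1)|}{(u_2-u_1)^\beta}\in[0,\infty].$$ **Theorem.** For every $N$ and every $W\in C([0,\infty);\mathbb R^r)$ there is exactly one such pair $(X^N,L^N)$. For all $\beta\in(0,\frac12)$, $p\in(1,\infty)$ and $T>0$ there is a constant $K=K_{\beta,p}(T)<\infty$, independent of $N$, such that for all $N$ and all $R>0$ $$\mathbb W\bigl(\|W^N\|_{\beta,[0,T]}\vee\|X^N\|_{\beta,[0,T]}\vee\|L^N\|_{\beta,[0,T]}\ge R\bigr)\le K R^{-p}.$$ Moreover, $(X^N,L^N,W^N)$ is for each $N$ a Borel measurable function of $W$ with values in $C([0,\infty);\bar{\mathcal O})\times C([0,\infty);\mathbb R^d)\times C([0,\infty);\mathbb R^r)$ (with the topology of locally uniform convergence), and the family of its laws $\mathbb P^N$, $N\ge0$, under $\mathbb W$ is tight. -/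

import Mathlib

open MeasureTheory ProbabilityTheory Set
open scoped NNReal ENNReal

noncomputable section

namespace ReflectedSDE

/-- The Euclidean space `ℝⁿ`. -/
abbrev E (n : ℕ) : Type := EuclideanSpace ℝ (Fin n)

/-- The space of continuous paths `[0, ∞) → Y`, with the topology of locally uniform convergence
(the compact-open topology). -/
abbrev Path (Y : Type) [TopologicalSpace Y] : Type := C(ℝ≥0, Y)

/-- Path space carries its Borel `σ`-algebra. -/
instance pathMeasurableSpace (Y : Type) [TopologicalSpace Y] : MeasurableSpace C(ℝ≥0, Y) :=
  borel _

instance pathBorelSpace (Y : Type) [TopologicalSpace Y] : BorelSpace C(ℝ≥0, Y) := ⟨rfl⟩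

/-! ### Admissible domains -/

/-- The set `ν(x)` of inward pointing unit proximal normal vectors to `O` at `x`. -/
def inwardNormals {d : ℕ} (O : Set (E d)) (x : E d) : Set (E d) :=
  {n | ‖n‖ = 1 ∧ ∃ C : ℝ, 0 < C ∧
    ∀ x' ∈ closure O, 0 ≤ inner ℝ (x' - x) n + C * ‖x - x'‖ ^ 2}

/-- Admissibility of a set `O`, in the sense of Lions and Sznitman. -/
structure IsAdmissible {d : ℕ} (O : Set (E d)) : Prop where
  nonempty_normals : ∀ x ∈ frontier O, (inwardNormals O x).Nonempty
  uniform_exterior_ball : ∃ C₀ : ℝ, 0 ≤ C₀ ∧ ∀ x' ∈ O, ∀ x ∈ frontier O,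
    ∀ n ∈ inwardNormals O x, 0 ≤ inner ℝ (x' - x) n + C₀ * ‖x - x'‖ ^ 2
  exists_potential : ∃ φ : E d → ℝ, ContDiff ℝ 2 φ ∧ ∃ α : ℝ, 0 < α ∧
    ∀ x ∈ frontier O, ∀ n ∈ inwardNormals O x, α ≤ inner ℝ (gradient φ x) n
  exists_cover : ∃ k : ℕ, 1 ≤ k ∧ ∃ lam : ℝ, 0 < lam ∧ ∃ R : ℝ, 0 < R ∧
    ∃ a c : Fin k → E d, (∀ i, ‖a i‖ = 1) ∧ (∀ i, c i ∈ frontier O) ∧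
      frontier O ⊆ ⋃ i, Metric.ball (c i) R ∧
      ∀ i, ∀ x ∈ frontier O ∩ Metric.ball (c i) (2 * R),
        ∀ n ∈ inwardNormals O x, lam ≤ inner ℝ n (a i)

/-! ### Reflected ordinary differential equations -/

/-- `μ` is the total variation measure `d|ℓ|` of the path `ℓ`: it gives `[0, t]` the total
variation `|ℓ|_t` of `ℓ` on `[0, t]`. (When all these are finite, this determines `μ`.) -/
def IsTotalVariationMeasure {d : ℕ} (ℓ : Path (E d)) (μ : Measure ℝ≥0) : Prop :=
  ∀ t : ℝ≥0, μ (Icc 0 t) = eVariationOn ℓ (Icc 0 t)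

/-- `(x, ℓ)` solves, for the piecewise smooth input `w` and the starting point `x₀`, the reflected
equation `dx = σ(x) dw + b(x) dt + dℓ`: the path `x` stays in `closure O`, `ℓ` is continuous with
locally bounded variation,
`x_t = x₀ + ∫₀ᵗ σ(x_s) dw_s + ∫₀ᵗ b(x_s) ds + ℓ_t`, the measure `d|ℓ|` is carried by the times at
which `x` is on the boundary, and `dℓ/d|ℓ| ∈ ν(x)` holds `d|ℓ|`-almost everywhere.
As `w` is piecewise smooth, `dw_s` is `w'(s) ds`. -/
structure IsReflectedSolution {d r : ℕ} (O : Set (E d)) (σ : closure O → E r →L[ℝ] E d)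
    (b : closure O → E d) (x₀ : closure O) (w : Path (E r))
    (x : Path (closure O)) (ℓ : Path (E d)) : Prop where
  locallyBoundedVariation : LocallyBoundedVariationOn ℓ univ
  equation : ∀ t : ℝ≥0, (x t : E d) = x₀
    + (∫ s in (0 : ℝ)..t, σ (x s.toNNReal) (deriv (fun u : ℝ => w u.toNNReal) s))
    + (∫ s in (0 : ℝ)..t, b (x s.toNNReal)) + ℓ t
  reflection : ∃ μ : Measure ℝ≥0, IsTotalVariationMeasure ℓ μ ∧
    (∀ᵐ s ∂μ, (x s : E d) ∈ frontier O) ∧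
    ∃ n : ℝ≥0 → E d, Measurable n ∧ (∀ᵐ s ∂μ, n s ∈ inwardNormals O (x s)) ∧
      ∀ t : ℝ≥0, ℓ t = ∫ s in Icc 0 t, n s ∂μ

/-! ### Wiener measure and dyadic polygonal interpolation -/

/-- `𝕎` is the standard `r`-dimensional Wiener measure: under `𝕎` the coordinates of the canonical
path are independent standard real Brownian motions (starting at `0`). -/
structure IsWienerMeasure {r : ℕ} (𝕎 : Measure (Path (E r))) : Prop where
  isProbabilityMeasure : IsProbabilityMeasure 𝕎
  isBrownian : ∀ i : Fin r, IsBrownianReal (fun (t : ℝ≥0) (w : Path (E r)) => w t i) 𝕎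
  indep : iIndepFun (fun (i : Fin r) (w : Path (E r)) (t : ℝ≥0) => w t i) 𝕎

/-- The value at `u ≥ 0` of the piecewise linear function which equals `a m` at each `m : ℕ`. -/
def polygonal {n : ℕ} (a : ℕ → E n) (u : ℝ≥0) : E n :=
  a ⌊u⌋₊ + ((u : ℝ) - ⌊u⌋₊) • (a (⌊u⌋₊ + 1) - a ⌊u⌋₊)

theorem polygonal_eq {n : ℕ} (a : ℕ → E n) (m : ℕ) (u : ℝ≥0) (h₁ : (m : ℝ≥0) ≤ u)
    (h₂ : u ≤ (m + 1 : ℕ)) : polygonal a u = a m + ((u : ℝ) - m) • (a (m + 1) - a m) := by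
  rcases h₂.lt_or_eq with h | h
  · have hf : ⌊u⌋₊ = m := (Nat.floor_eq_iff (zero_le)).2 ⟨h₁, by simpa using h⟩
    simp [polygonal, hf]
  · subst h
    rw [polygonal, Nat.floor_natCast]
    simp

theorem continuous_polygonal {n : ℕ} (a : ℕ → E n) : Continuous (polygonal a) := by
  have hlf : LocallyFinite fun m : ℕ => Icc (m : ℝ≥0) ((m + 1 : ℕ) : ℝ≥0) := by
    intro u
    refine ⟨Iio (u + 1), Iio_mem_nhds (by simp), ?_⟩
    refine (Set.finite_le_nat ⌈u + 1⌉₊).subset ?_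
    rintro m ⟨v, hv, hv'⟩
    have h : (m : ℝ≥0) ≤ ⌈u + 1⌉₊ := hv.1.trans (hv'.le.trans (Nat.le_ceil _))
    exact_mod_cast h
  refine hlf.continuous ?_ (fun m => isClosed_Icc) fun m => ?_
  · refine eq_univ_of_forall fun u => mem_iUnion.2 ⟨⌊u⌋₊, Nat.floor_le (zero_le), ?_⟩
    exact_mod_cast (Nat.lt_floor_add_one u).le
  · have hc : Continuous fun u : ℝ≥0 => a m + ((u : ℝ) - m) • (a (m + 1) - a m) := by fun_prop
    exact hc.continuousOn.congr fun u hu => polygonal_eq a m u hu.1 hu.2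

/-- The `N`-dyadic linear polygonalization `w^N` of a path `w`: it agrees with `w` at the times
`m 2⁻ᴺ` and is linear on each interval `[m 2⁻ᴺ, (m + 1) 2⁻ᴺ]`. -/
def dyadicInterp {r : ℕ} (N : ℕ) (w : Path (E r)) : Path (E r) where
  toFun t := polygonal (fun m => w ((m : ℝ≥0) / 2 ^ N)) (2 ^ N * t)
  continuous_toFun := (continuous_polygonal _).comp (by fun_prop)

/-! ### Hölder norms and the laws on path space -/

/-- The `β`-Hölder norm of `ψ` on `[s, t]`,
`sup_{s ≤ u₁ < u₂ ≤ t} |ψ(u₂) - ψ(u₁)| / (u₂ - u₁)^β`, with values in `[0, ∞]`. -/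
def holderNorm {n : ℕ} (β : ℝ) (s t : ℝ≥0) (ψ : ℝ≥0 → E n) : ℝ≥0∞ :=
  ⨆ (u₁ : ℝ≥0) (u₂ : ℝ≥0) (_ : s ≤ u₁ ∧ u₁ < u₂ ∧ u₂ ≤ t),
    ENNReal.ofReal (‖ψ u₂ - ψ u₁‖ / ((u₂ : ℝ) - u₁) ^ β)

/-- The map sending a Wiener path `w` to the point `(X^N(w), L^N(w), w^N)` of the
`(X, L, W)`-pathspace. -/
def pathTriple {d r : ℕ} {O : Set (E d)} (X : ℕ → Path (E r) → Path (closure O))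
    (L : ℕ → Path (E r) → Path (E d)) (N : ℕ) (w : Path (E r)) :
    Path (closure O) × Path (E d) × Path (E r) :=
  (X N w, L N w, dyadicInterp N w)

/-- The law `ℙ^N` of `(X^N, L^N, W^N)` under `𝕎`. -/
def approxLaw {d r : ℕ} {O : Set (E d)} (𝕎 : Measure (Path (E r)))
    (X : ℕ → Path (E r) → Path (closure O)) (L : ℕ → Path (E r) → Path (E d)) (N : ℕ) :
    Measure (Path (closure O) × Path (E d) × Path (E r)) :=
  𝕎.map (pathTriple X L N)

end ReflectedSDE

end

/-!
On a cell of the dyadic partition the polygonal path has a constant velocity `v`, so that the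
reflected equation there is `dX = F(X) dt + dL` with a Lipschitz field `F`. As the closure of the
domain is uniformly prox-regular, this equation has an evolution variational formulation: as a
function of `t`, `‖X - z‖²` grows at most at the rate `2 ⟪X - z, F(X)⟫ + c ‖X - z‖²`, for every `z`
in the closure. It is solved by the catching-up algorithm (an Euler step followed by a projection),
and comparing two solutions by polarization and Gronwall's lemma shows that the solution depends
continuously on `v` and the initial point. The solution driven by the whole polygonal path is glued
from these flows. It is unique since, by the exterior ball inequality, the distance of two solutions
is controlled on short intervals by the difference of their drivers `Y = X - L`.

By the uniform cone condition, the variation of `L` over an interval on which `X` moves little is at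
most a multiple of the increment of `L`. Together with the exterior ball inequality this bounds the
oscillation of `X` by a constant times that of `Y`, for all levels `N` at once. Consequently, the
increments of `Y` over the dyadic cells are, up to errors of second order, those of a martingale
transform of the Gaussian walk of the increments of `W`, and so the increments of `Y` over dyadic
intervals of length `h` are `O(√h)` in every `L^q`, uniformly in `N`. Kolmogorov's chaining turns
this into tail bounds for Hölder norms, first of `Y` and then of `X` and `L`, and sets of paths with
bounded Hölder norms are relatively compact by the theorem of Arzelà and Ascoli.
-/

namespace ReflectedSDE

open Filter Topology

theorem norm_sub_le_of_lipschitzWith {H H' : Type*} [SeminormedAddCommGroup H]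
    [SeminormedAddCommGroup H'] {S : Set H} {F : S → H'} {κ : ℝ≥0} (hF : LipschitzWith κ F)
    (x y : S) : ‖F x - F y‖ ≤ κ * ‖(x : H) - y‖ := by
  simpa only [Subtype.dist_eq, dist_eq_norm] using hF.dist_le_mul x y

/-! ### Flow lines in prox-regular sets -/

section FlowLines

variable {H : Type*} [NormedAddCommGroup H] [InnerProductSpace ℝ H] {S : Set H}

/-- Uniform proximal regularity: every point `y` has a nearest point `p` in `S`, and the proximal
normal `p - y` satisfies the exterior ball inequality with the constant `C₀`. -/
def IsProxRegular (S : Set H) (C₀ : ℝ) : Prop :=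
  ∀ y : H, ∃ p ∈ S, (∀ x ∈ S, ‖p - y‖ ≤ ‖x - y‖) ∧
    ∀ z ∈ S, 0 ≤ inner ℝ (z - p) (p - y) + C₀ * ‖p - y‖ * ‖z - p‖ ^ 2

/-- The upper bound for the rate of growth of `‖X - z‖²` along a flow line `X` of the reflected
equation `dX = F(X) dt + dL` which is at the point `x`. -/
def growthRate (F : S → H) (c : ℝ) (z : H) (x : S) : ℝ :=
  2 * inner ℝ ((x : H) - z) (F x) + c * ‖(x : H) - z‖ ^ 2

/-- Solutions of `dX = F(X) dt + dL` in `S`, described by an evolution variational inequality: as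
`dL` is an inward normal, it contributes at most `c ‖X - z‖² dt` to `d‖X - z‖²` for `z ∈ S`. -/
structure IsFlowLine (F : S → H) (M c : ℝ) (X : ℝ≥0 → S) : Prop where
  norm_sub_le : ∀ s t : ℝ≥0, s ≤ t → ‖(X t : H) - X s‖ ≤ 2 * M * ((t : ℝ) - s)
  evi : ∃ K : ℝ, ∀ z ∈ S, ∀ s t : ℝ≥0, s ≤ t → ‖(X t : H) - z‖ ^ 2 - ‖(X s : H) - z‖ ^ 2
    ≤ ((t : ℝ) - s) * (growthRate F c z (X s) + K * ((t : ℝ) - s))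

/-- The discrete counterpart of `IsFlowLine` with time step `h`, as produced by the catching-up
algorithm: follow `F` for the time `h`, then project to `S`. -/
structure IsCatchingUp (F : S → H) (M c h : ℝ) (u : ℕ → S) : Prop where
  norm_succ_sub_le : ∀ n, ‖(u (n + 1) : H) - u n‖ ≤ 2 * M * h
  evi : ∀ z ∈ S, ∀ n, ‖(u (n + 1) : H) - z‖ ^ 2 - ‖(u n : H) - z‖ ^ 2
    ≤ h * (2 * inner ℝ ((u (n + 1) : H) - z) (F (u n)) + c * ‖(u (n + 1) : H) - z‖ ^ 2)

theorem IsProxRegular.exists_step {C₀ : ℝ} (hC₀ : 0 ≤ C₀) (hS : IsProxRegular S C₀) {M h : ℝ}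
    (hh : 0 ≤ h) {x f : H} (hx : x ∈ S) (hf : ‖f‖ ≤ M) :
    ∃ p ∈ S, ‖p - x‖ ≤ 2 * M * h ∧ ∀ z ∈ S, ‖p - z‖ ^ 2 - ‖x - z‖ ^ 2
      ≤ h * (2 * inner ℝ (p - z) f + 2 * C₀ * M * ‖p - z‖ ^ 2) := by
  obtain ⟨p, hp, hmin, hnormal⟩ := hS (x + h • f)
  have hmove : ‖h • f‖ ≤ h * M := by
    rw [norm_smul, Real.norm_of_nonneg hh]
    gcongr
  have hproj : ‖p - (x + h • f)‖ ≤ h * M := by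
    simpa only [sub_add_cancel_left, norm_neg] using (hmin x hx).trans (by simpa using hmove)
  refine ⟨p, hp, ?_, fun z hz => ?_⟩
  · calc ‖p - x‖ = ‖(p - (x + h • f)) + h • f‖ := by congr 1; abel
      _ ≤ 2 * M * h := by linarith [norm_add_le (p - (x + h • f)) (h • f)]
  · have hexpand : ‖x - z‖ ^ 2 = ‖p - z‖ ^ 2 - 2 * inner ℝ (p - z) (p - x) + ‖p - x‖ ^ 2 := by
      rw [← norm_sub_sq_real]
      congr 2
      abel
    have hsplit : inner ℝ (p - z) (p - x)
        = h * inner ℝ (p - z) f - inner ℝ (z - p) (p - (x + h • f)) := by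
      rw [← real_inner_smul_right, ← neg_sub p z, inner_neg_left, sub_neg_eq_add, ← inner_add_right]
      congr 1
      abel
    have hcurv : C₀ * ‖p - (x + h • f)‖ * ‖z - p‖ ^ 2 ≤ C₀ * (h * M) * ‖p - z‖ ^ 2 := by
      rw [norm_sub_rev z p]
      gcongr
    nlinarith [hnormal z hz, sq_nonneg ‖p - x‖]

theorem IsProxRegular.exists_isCatchingUp {C₀ : ℝ} (hC₀ : 0 ≤ C₀) (hS : IsProxRegular S C₀)
    {F : S → H} {M h : ℝ} (hM : ∀ x, ‖F x‖ ≤ M) (hh : 0 ≤ h) (x₀ : S) :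
    ∃ u : ℕ → S, u 0 = x₀ ∧ IsCatchingUp F M (2 * C₀ * M) h u := by
  choose p hpS hp_norm hp_evi using fun x : S => hS.exists_step hC₀ hh x.2 (hM x)
  exact ⟨fun n => n.rec x₀ fun _ x => ⟨p x, hpS x⟩, rfl, fun n => hp_norm _,
    fun z hz n => hp_evi _ z hz⟩

theorem growthRate_le {F : S → H} {M c D : ℝ} {κ : ℝ≥0} (hc : 0 ≤ c) (hM : ∀ x, ‖F x‖ ≤ M)
    (hF : LipschitzWith κ F) (hD : ∀ x ∈ S, ∀ y ∈ S, ‖x - y‖ ≤ D) {r : ℝ} {x y y' : S}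
    (hy : ‖(y : H) - x‖ ≤ r) (hy' : ‖(y' : H) - x‖ ≤ r) {z : H} (hz : z ∈ S) :
    2 * inner ℝ ((y : H) - z) (F y') + c * ‖(y : H) - z‖ ^ 2
      ≤ growthRate F c z x + (2 * M + 2 * D * κ + 2 * c * D) * r := by
  have hr : 0 ≤ r := (norm_nonneg _).trans hy
  have hD₀ : 0 ≤ D := (norm_nonneg _).trans (hD z hz z hz)
  have hsplit : inner ℝ ((y : H) - z) (F y') - inner ℝ ((x : H) - z) (F x)
      = inner ℝ ((y : H) - x) (F y') + inner ℝ ((x : H) - z) (F y' - F x) := by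
    rw [inner_sub_right, ← sub_add_sub_cancel (y : H) x z, inner_add_left]
    ring
  have hmove : inner ℝ ((y : H) - x) (F y') ≤ r * M :=
    (real_inner_le_norm _ _).trans (mul_le_mul hy (hM _) (norm_nonneg _) hr)
  have hlip : inner ℝ ((x : H) - z) (F y' - F x) ≤ D * (κ * r) :=
    (real_inner_le_norm _ _).trans (mul_le_mul (hD _ x.2 _ hz)
      ((norm_sub_le_of_lipschitzWith hF y' x).trans (by gcongr)) (norm_nonneg _) hD₀)
  have hsq : ‖(y : H) - z‖ ^ 2 ≤ ‖(x : H) - z‖ ^ 2 + 2 * D * r := by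
    have htri : ‖(y : H) - z‖ ≤ r + ‖(x : H) - z‖ :=
      (norm_sub_le_norm_sub_add_norm_sub _ (x : H) _).trans (by gcongr)
    have hprod : (‖(y : H) - z‖ - ‖(x : H) - z‖) * (‖(y : H) - z‖ + ‖(x : H) - z‖)
        ≤ r * (2 * D) :=
      mul_le_mul (by linarith) (by linarith [hD _ x.2 _ hz, hD _ y.2 _ hz]) (by positivity) hr
    nlinarith
  unfold growthRate
  nlinarith [mul_le_mul_of_nonneg_left hsq hc]

namespace IsCatchingUp

variable {F : S → H} {M c h : ℝ} {u : ℕ → S}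

theorem norm_add_sub_le (hu : IsCatchingUp F M c h u) (k m : ℕ) :
    ‖(u (k + m) : H) - u k‖ ≤ 2 * M * (h * m) := by
  induction m with
  | zero => simp
  | succ m ih =>
    calc ‖(u (k + (m + 1)) : H) - u k‖
        ≤ ‖(u (k + m + 1) : H) - u (k + m)‖ + ‖(u (k + m) : H) - u k‖ :=
          norm_sub_le_norm_sub_add_norm_sub _ _ _
      _ ≤ 2 * M * h + 2 * M * (h * m) := add_le_add (hu.norm_succ_sub_le _) ih
      _ = 2 * M * (h * (m + 1 : ℕ)) := by push_cast; ring

theorem evi_add (hu : IsCatchingUp F M c h u) {D : ℝ} {κ : ℝ≥0} (hh : 0 ≤ h) (hc : 0 ≤ c)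
    (hM : ∀ x, ‖F x‖ ≤ M) (hF : LipschitzWith κ F) (hD : ∀ x ∈ S, ∀ y ∈ S, ‖x - y‖ ≤ D)
    {z : H} (hz : z ∈ S) (k m : ℕ) :
    ‖(u (k + m) : H) - z‖ ^ 2 - ‖(u k : H) - z‖ ^ 2 ≤ (h * m) *
      (growthRate F c z (u k) + (2 * M + 2 * D * κ + 2 * c * D) * (2 * M) * (h * m)) := by
  have hM₀ : 0 ≤ M := (norm_nonneg _).trans (hM (u k))
  have hD₀ : 0 ≤ D := (norm_nonneg _).trans (hD z hz z hz)
  set K := (2 * M + 2 * D * κ + 2 * c * D) * (2 * M) with hK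
  induction m with
  | zero => simp
  | succ m ih =>
    have hrate := growthRate_le (x := u k) (y := u (k + m + 1)) (y' := u (k + m)) hc hM hF hD
      (hu.norm_add_sub_le k (m + 1)) ((hu.norm_add_sub_le k m).trans (by gcongr; simp)) hz
    have hstep : ‖(u (k + m + 1) : H) - z‖ ^ 2 - ‖(u (k + m) : H) - z‖ ^ 2
        ≤ h * (growthRate F c z (u k) + K * (h * (m + 1 : ℕ))) := by
      refine (hu.evi z hz (k + m)).trans
        (mul_le_mul_of_nonneg_left (hrate.trans_eq ?_) hh)
      rw [hK]
      ring
    have herror : h * m * (K * (h * m)) ≤ h * m * (K * (h * (m + 1 : ℕ))) := by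
      gcongr
      simp
    rw [← add_assoc]
    push_cast at *
    nlinarith

end IsCatchingUp

theorem exists_tendsto_ultrafilter_of_isCatchingUp (hS : IsCompact S) {F : S → H} {M c K : ℝ}
    (hF : Continuous F) {u : ℕ → ℕ → S} (hu : ∀ n : ℕ, IsCatchingUp F M c (1 / ((n : ℝ) + 1)) (u n))
    (hevi : ∀ n, ∀ z ∈ S, ∀ k m : ℕ, ‖(u n (k + m) : H) - z‖ ^ 2 - ‖(u n k : H) - z‖ ^ 2
      ≤ (1 / ((n : ℝ) + 1) * m) * (growthRate F c z (u n k) + K * (1 / ((n : ℝ) + 1) * m))) :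
    ∃ (𝒰 : Ultrafilter ℕ) (X : ℝ≥0 → S), IsFlowLine F M c X ∧
      ∀ t : ℝ≥0, Tendsto (fun n : ℕ => u n ⌊(t : ℝ) * ((n : ℝ) + 1)⌋₊) 𝒰 (𝓝 (X t)) := by
  let 𝒰 : Ultrafilter ℕ := Ultrafilter.of atTop
  let idx : ℕ → ℝ≥0 → ℕ := fun n t => ⌊(t : ℝ) * ((n : ℝ) + 1)⌋₊
  have hidx_mono : ∀ n, Monotone (idx n) := fun n s t hst => Nat.floor_mono (by gcongr)
  have htime : ∀ t : ℝ≥0, Tendsto (fun n : ℕ => 1 / ((n : ℝ) + 1) * (idx n t : ℝ)) 𝒰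
      (𝓝 (t : ℝ)) := fun t => by
    have hdiv := (tendsto_nat_floor_mul_div_atTop (R := ℝ) (a := (t : ℝ)) t.2).comp
      (tendsto_atTop_add_const_right atTop (1 : ℝ) tendsto_natCast_atTop_atTop)
    refine (hdiv.mono_left (Ultrafilter.of_le _)).congr fun n => ?_
    simp only [idx, Function.comp]
    ring
  have : CompactSpace S := isCompact_iff_compactSpace.1 hS
  choose X hX using fun t : ℝ≥0 => (⟨_, (𝒰.map fun n => u n (idx n t)).le_nhds_lim⟩ :
    ∃ x : S, Tendsto (fun n => u n (idx n t)) 𝒰 (𝓝 x))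
  have hX' : ∀ t, Tendsto (fun n => (u n (idx n t) : H)) 𝒰 (𝓝 (X t : H)) := fun t =>
    (continuous_subtype_val.tendsto _).comp (hX t)
  refine ⟨𝒰, X, ⟨fun s t hst => ?_, K, fun z hz s t hst => ?_⟩, hX⟩
  · refine le_of_tendsto_of_tendsto ((hX' t).sub (hX' s)).norm
      (((htime t).sub (htime s)).const_mul (2 * M)) (Eventually.of_forall fun n => ?_)
    obtain ⟨m, hm⟩ := Nat.exists_eq_add_of_le (hidx_mono n hst)
    simp only [hm]
    refine ((hu n).norm_add_sub_le (idx n s) m).trans_eq ?_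
    push_cast
    ring
  · have hrate : Tendsto (fun n => growthRate F c z (u n (idx n s))) 𝒰
        (𝓝 (growthRate F c z (X s))) := by
      have : Continuous (growthRate F c z) := by unfold growthRate; fun_prop
      exact (this.tendsto _).comp (hX s)
    have hdur := (htime t).sub (htime s)
    refine le_of_tendsto_of_tendsto ((((hX' t).sub_const z).norm.pow 2).sub
      (((hX' s).sub_const z).norm.pow 2)) (hdur.mul (hrate.add (hdur.const_mul K)))
      (Eventually.of_forall fun n => ?_)
    obtain ⟨m, hm⟩ := Nat.exists_eq_add_of_le (hidx_mono n hst)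
    simp only [hm]
    refine (hevi n z hz (idx n s) m).trans_eq ?_
    push_cast
    ring

theorem IsProxRegular.exists_isFlowLine {C₀ : ℝ} (hC₀ : 0 ≤ C₀) (hS : IsProxRegular S C₀)
    (hS_compact : IsCompact S) {F : S → H} {M : ℝ} {κ : ℝ≥0} (hM : ∀ x, ‖F x‖ ≤ M)
    (hF : LipschitzWith κ F) (x₀ : S) :
    ∃ X : ℝ≥0 → S, X 0 = x₀ ∧ IsFlowLine F M (2 * C₀ * M) X := by
  have hM₀ : 0 ≤ M := (norm_nonneg _).trans (hM x₀)
  obtain ⟨D, hD⟩ := Metric.isBounded_iff.1 hS_compact.isBounded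
  choose u hu₀ hu using fun n : ℕ =>
    hS.exists_isCatchingUp hC₀ hM (h := 1 / ((n : ℝ) + 1)) (by positivity) x₀
  obtain ⟨𝒰, X, hX, hlim⟩ := exists_tendsto_ultrafilter_of_isCatchingUp hS_compact hF.continuous hu
    fun n z hz => (hu n).evi_add (by positivity) (by positivity) hM hF
      (fun x hx y hy => (dist_eq_norm x y).symm.trans_le (hD hx hy)) hz
  refine ⟨X, tendsto_nhds_unique (hlim 0) ?_, hX⟩
  simp [hu₀]

theorem gronwallBound_le_add_mul_mul_exp {δ ε K x : ℝ} (hε : 0 ≤ ε) (hK : 0 ≤ K) :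
    gronwallBound δ K ε x ≤ (δ + ε * x) * Real.exp (K * x) := by
  rcases hK.eq_or_lt with rfl | hK
  · simp [gronwallBound_K0]
  · have hexp : Real.exp (K * x) - 1 ≤ K * x * Real.exp (K * x) := by
      have hneg := mul_le_mul_of_nonneg_right (Real.add_one_le_exp (-(K * x)))
        (Real.exp_nonneg (K * x))
      rw [← Real.exp_add, neg_add_cancel, Real.exp_zero] at hneg
      linarith
    calc gronwallBound δ K ε x = δ * Real.exp (K * x) + ε / K * (Real.exp (K * x) - 1) := by
          rw [gronwallBound_of_K_ne_0 hK.ne']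
      _ ≤ δ * Real.exp (K * x) + ε / K * (K * x * Real.exp (K * x)) := by gcongr
      _ = (δ + ε * x) * Real.exp (K * x) := by field_simp

theorem le_mul_exp_of_sub_le {G : ℝ≥0 → ℝ} {c ε K : ℝ} (hG_cont : Continuous G) (hc : 0 ≤ c)
    (hε : 0 ≤ ε)
    (hG : ∀ s t : ℝ≥0, s ≤ t → G t - G s ≤ ((t : ℝ) - s) * (c * G s + ε + K * ((t : ℝ) - s)))
    (t : ℝ≥0) : G t ≤ (G 0 + ε * t) * Real.exp (c * t) := by
  have hslope : ∀ s ∈ Ico (0 : ℝ) t, ∀ q, c * G s.toNNReal + ε < q →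
      ∃ᶠ u in 𝓝[>] s, (u - s)⁻¹ * (G u.toNNReal - G s.toNNReal) < q := by
    intro s hs q hq
    have hlim : Tendsto (fun u => c * G s.toNNReal + ε + K * (u - s)) (𝓝[>] s)
        (𝓝 (c * G s.toNNReal + ε)) := by
      have : Continuous fun u => c * G s.toNNReal + ε + K * (u - s) := by fun_prop
      simpa using (this.tendsto s).mono_left nhdsWithin_le_nhds
    refine Eventually.frequently ?_
    filter_upwards [hlim.eventually_lt_const hq, self_mem_nhdsWithin] with u hu (hsu : s < u)
    have hinc := hG s.toNNReal u.toNNReal (Real.toNNReal_le_toNNReal hsu.le)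
    rw [Real.coe_toNNReal s hs.1, Real.coe_toNNReal u (hs.1.trans hsu.le)] at hinc
    exact ((inv_mul_le_iff₀ (sub_pos.2 hsu)).2 hinc).trans_lt hu
  have hbound := le_gronwallBound_of_liminf_deriv_right_le (f := fun s => G s.toNNReal)
    (f' := fun s => c * G s.toNNReal + ε) (δ := G 0) (K := c) (ε := ε)
    (hG_cont.comp continuous_real_toNNReal).continuousOn hslope (by simp) (fun s _ => le_rfl) t
    ⟨t.2, le_rfl⟩
  simp only [Real.toNNReal_coe, sub_zero] at hbound
  exact hbound.trans (gronwallBound_le_add_mul_mul_exp hε hc)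

namespace IsFlowLine

variable {F F' : S → H} {M M' c c' : ℝ} {X X' : ℝ≥0 → S}

theorem nonneg (hX : IsFlowLine F M c X) : 0 ≤ M := by
  have := (norm_nonneg _).trans (hX.norm_sub_le 0 1 zero_le_one)
  norm_num at this
  exact this

theorem norm_sub_le_abs (hX : IsFlowLine F M c X) (s t : ℝ≥0) :
    ‖(X t : H) - X s‖ ≤ 2 * M * |(t : ℝ) - s| := by
  rcases le_total s t with hst | hst
  · rw [abs_of_nonneg (sub_nonneg.2 (by exact_mod_cast hst))]
    exact hX.norm_sub_le s t hst
  · rw [norm_sub_rev, abs_sub_comm, abs_of_nonneg (sub_nonneg.2 (by exact_mod_cast hst))]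
    exact hX.norm_sub_le t s hst

theorem continuous (hX : IsFlowLine F M c X) : Continuous X := by
  refine (LipschitzWith.of_dist_le_mul (K := 2 * ⟨M, hX.nonneg⟩) fun s t => ?_).continuous
  rw [Subtype.dist_eq, dist_eq_norm, NNReal.dist_eq]
  exact hX.norm_sub_le_abs t s

theorem growthRate_add_le {κ : ℝ≥0} {D η : ℝ} (hF : LipschitzWith κ F)
    (hFF' : ∀ x, ‖F x - F' x‖ ≤ η) (hD : ∀ x ∈ S, ∀ y ∈ S, ‖x - y‖ ≤ D) (x x' : S) :
    growthRate F c x' x + growthRate F' c' x x'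
      ≤ (2 * κ + c + c') * ‖(x : H) - x'‖ ^ 2 + 2 * D * η := by
  have hsplit : inner ℝ ((x : H) - x') (F x) + inner ℝ ((x' : H) - x) (F' x')
      = inner ℝ ((x : H) - x') (F x - F x') + inner ℝ ((x : H) - x') (F x' - F' x') := by
    rw [← neg_sub (x : H) x', inner_neg_left, inner_sub_right, inner_sub_right]
    ring
  have hlip : inner ℝ ((x : H) - x') (F x - F x') ≤ κ * ‖(x : H) - x'‖ ^ 2 := by
    refine (real_inner_le_norm _ _).trans ?_
    rw [sq, mul_left_comm]
    gcongr
    exact norm_sub_le_of_lipschitzWith hF x x'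
  have hpert : inner ℝ ((x : H) - x') (F x' - F' x') ≤ D * η :=
    (real_inner_le_norm _ _).trans (mul_le_mul (hD _ x.2 _ x'.2) (hFF' _) (norm_nonneg _)
      ((norm_nonneg _).trans (hD _ x.2 _ x'.2)))
  unfold growthRate
  rw [norm_sub_rev (x' : H) x]
  nlinarith

theorem norm_sub_sq_le {κ : ℝ≥0} {D η : ℝ} (hX : IsFlowLine F M c X) (hX' : IsFlowLine F' M' c' X')
    (hc : 0 ≤ c) (hc' : 0 ≤ c') (hF : LipschitzWith κ F) (hFF' : ∀ x, ‖F x - F' x‖ ≤ η)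
    (hD : ∀ x ∈ S, ∀ y ∈ S, ‖x - y‖ ≤ D) (t : ℝ≥0) :
    ‖(X t : H) - X' t‖ ^ 2
      ≤ (‖(X 0 : H) - X' 0‖ ^ 2 + 2 * D * η * t) * Real.exp ((2 * κ + c + c') * t) := by
  have hD₀ : 0 ≤ D := (norm_nonneg _).trans (hD _ (X 0).2 _ (X 0).2)
  have hη₀ : 0 ≤ η := (norm_nonneg _).trans (hFF' (X 0))
  obtain ⟨K, hK⟩ := hX.evi
  obtain ⟨K', hK'⟩ := hX'.evi
  have hX_cont := continuous_subtype_val.comp hX.continuous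
  have hX'_cont := continuous_subtype_val.comp hX'.continuous
  refine le_mul_exp_of_sub_le (G := fun t => ‖(X t : H) - X' t‖ ^ 2)
    ((hX_cont.sub hX'_cont).norm.pow 2) (by positivity) (by positivity)
    (K := K + K' + 8 * M * M') (fun s t hst => ?_) t
  have hdur : (0 : ℝ) ≤ (t : ℝ) - s := sub_nonneg.2 (by exact_mod_cast hst)
  -- Polarization: up to the second order term `⟪X t - X s, X' t - X' s⟫`, each path may be moved
  -- while the other one is frozen at time `s`.
  have hpolar : ‖(X t : H) - X' t‖ ^ 2 = ‖(X t : H) - X' s‖ ^ 2 + ‖(X' t : H) - X s‖ ^ 2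
      - ‖(X s : H) - X' s‖ ^ 2 - 2 * inner ℝ ((X t : H) - X s) ((X' t : H) - X' s) := by
    simp only [← real_inner_self_eq_norm_sq, inner_sub_left, inner_sub_right]
    rw [real_inner_comm (X s : H) (X' t), real_inner_comm (X s : H) (X' s),
      real_inner_comm (X t : H) (X' s), real_inner_comm (X t : H) (X' t)]
    ring
  have hcross : -inner ℝ ((X t : H) - X s) ((X' t : H) - X' s)
      ≤ (2 * M * ((t : ℝ) - s)) * (2 * M' * ((t : ℝ) - s)) :=
    (neg_le_abs _).trans ((abs_real_inner_le_norm _ _).trans (mul_le_mul (hX.norm_sub_le s t hst)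
      (hX'.norm_sub_le s t hst) (norm_nonneg _) (mul_nonneg (by linarith [hX.nonneg]) hdur)))
  have hrate := mul_le_mul_of_nonneg_left
    (growthRate_add_le (c := c) (c' := c') hF hFF' hD (X s) (X' s)) hdur
  have hevi := hK (X' s) (X' s).2 s t hst
  have hevi' := hK' (X s) (X s).2 s t hst
  rw [norm_sub_rev (X' s : H) (X s)] at hevi'
  nlinarith

theorem proximal_of_hasDerivAt (hX : IsFlowLine F M c X) {t : ℝ≥0} {v : H}
    (hv : HasDerivAt (fun u : ℝ => (X u.toNNReal : H)) v t) {z : H} (hz : z ∈ S) :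
    0 ≤ 2 * inner ℝ (z - X t) (v - F (X t)) + c * ‖z - X t‖ ^ 2 := by
  obtain ⟨K, hK⟩ := hX.evi
  have hderiv : HasDerivAt (fun u : ℝ => ‖(X u.toNNReal : H) - z‖ ^ 2)
      (2 * inner ℝ ((X t : H) - z) v) t := by simpa using (hv.sub_const z).norm_sq
  have hrate : Tendsto (fun u : ℝ => growthRate F c z (X t) + K * (u - t)) (𝓝[>] (t : ℝ))
      (𝓝 (growthRate F c z (X t))) := by
    have : Continuous fun u : ℝ => growthRate F c z (X t) + K * (u - t) := by fun_prop
    simpa using (this.tendsto t).mono_left nhdsWithin_le_nhds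
  have hle : 2 * inner ℝ ((X t : H) - z) v ≤ growthRate F c z (X t) := by
    refine le_of_tendsto_of_tendsto
      ((hasDerivAt_iff_tendsto_slope.1 hderiv).mono_left (nhdsGT_le_nhdsNE (t : ℝ))) hrate ?_
    filter_upwards [self_mem_nhdsWithin] with u (hu : (t : ℝ) < u)
    have hevi := hK z hz t u.toNNReal (NNReal.le_toNNReal_of_coe_le hu.le)
    rw [Real.coe_toNNReal u (t.2.trans hu.le)] at hevi
    rw [slope_def_field, div_le_iff₀ (sub_pos.2 hu), Real.toNNReal_coe]
    linarith
  rw [growthRate] at hle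
  rw [← neg_sub (X t : H) z, inner_neg_left, norm_neg, inner_sub_right]
  linarith

end IsFlowLine

end FlowLines

/-! ### Domains with uniform exterior balls and normal cones -/

section Domain

variable {d : ℕ} {O : Set (E d)}

/-- The uniform exterior ball condition with the constant `C₀`: the complement of `O` contains, at
each boundary point and for each normal there, a ball of radius `1 / (2 C₀)`. -/
def HasUniformExteriorBall (O : Set (E d)) (C₀ : ℝ≥0) : Prop :=
  ∀ x ∈ frontier O, ∀ n ∈ inwardNormals O x, ∀ z ∈ closure O,
    0 ≤ inner ℝ (z - x) n + C₀ * ‖z - x‖ ^ 2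

/-- The uniform cone condition: on the part of the boundary within distance `R` of a given boundary
point, the inward normals lie in a cone, of aperture determined by `δ`, around a fixed direction. -/
def HasUniformNormalCones (O : Set (E d)) (δ R : ℝ) : Prop :=
  ∀ p ∈ frontier O, ∃ a : E d, ‖a‖ = 1 ∧
    ∀ x ∈ frontier O ∩ Metric.ball p R, ∀ n ∈ inwardNormals O x, δ ≤ inner ℝ n a

theorem IsAdmissible.exists_hasUniformExteriorBall (hO : IsAdmissible O) :
    ∃ C₀ : ℝ≥0, HasUniformExteriorBall O C₀ := by
  obtain ⟨C₀, hC₀, hball⟩ := hO.uniform_exterior_ball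
  refine ⟨⟨C₀, hC₀⟩, fun x hx n hn z hz => ?_⟩
  have hclosed : IsClosed {z : E d | 0 ≤ inner ℝ (z - x) n + C₀ * ‖z - x‖ ^ 2} :=
    isClosed_le continuous_const (by fun_prop)
  refine closure_minimal (fun z hz => ?_) hclosed hz
  simpa only [mem_ofPred_eq, norm_sub_rev z x] using hball z hz x hx n hn

theorem IsAdmissible.exists_hasUniformNormalCones (hO : IsAdmissible O) :
    ∃ δ > 0, ∃ R > 0, HasUniformNormalCones O δ R := by
  obtain ⟨k, -, δ, hδ, R, hR, a, c, ha, -, hcover, hcone⟩ := hO.exists_cover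
  refine ⟨δ, hδ, R, hR, fun p hp => ?_⟩
  obtain ⟨i, hi⟩ := mem_iUnion.1 (hcover hp)
  refine ⟨a i, ha i, fun x hx => hcone i x ⟨hx.1, ?_⟩⟩
  exact Metric.ball_subset (by linarith [Metric.mem_ball.1 hi]) hx.2

theorem mem_frontier_of_proximal (hO : IsOpen O) {p n : E d} (hp : p ∈ closure O) (hn : n ≠ 0)
    {C : ℝ} (hC : ∀ z ∈ O, 0 ≤ inner ℝ (z - p) n + C * ‖z - p‖ ^ 2) : p ∈ frontier O := by
  rw [hO.frontier_eq]
  refine ⟨hp, fun hpO => ?_⟩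
  have hpath : Tendsto (fun s : ℝ => p - s • n) (𝓝[>] 0) (𝓝 p) := by
    have : Continuous fun s : ℝ => p - s • n := by fun_prop
    simpa using (this.tendsto 0).mono_left nhdsWithin_le_nhds
  have hsmall : Tendsto (fun s : ℝ => C * s) (𝓝[>] 0) (𝓝 0) := by
    simpa using ((continuous_const_mul C).tendsto 0).mono_left nhdsWithin_le_nhds
  obtain ⟨s, ⟨hsO, hs⟩, hs₀ : 0 < s⟩ := (((hpath.eventually (hO.mem_nhds hpO)).and
    (hsmall.eventually_lt_const one_pos)).and self_mem_nhdsWithin).exists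
  have hle := hC _ hsO
  rw [sub_sub_cancel_left, inner_neg_left, real_inner_smul_left, real_inner_self_eq_norm_sq,
    norm_neg, norm_smul, Real.norm_of_nonneg hs₀.le] at hle
  have hpos : 0 < s * ‖n‖ ^ 2 := by positivity
  nlinarith

theorem inv_norm_smul_mem_inwardNormals {p n : E d} (hn : n ≠ 0) {C : ℝ}
    (hC : ∀ z ∈ closure O, 0 ≤ inner ℝ (z - p) n + C * ‖z - p‖ ^ 2) :
    ‖n‖⁻¹ • n ∈ inwardNormals O p := by
  refine ⟨norm_smul_inv_norm hn, ‖n‖⁻¹ * (|C| + 1), by positivity, fun z hz => ?_⟩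
  rw [real_inner_smul_right, mul_assoc, ← mul_add, norm_sub_rev p z]
  refine mul_nonneg (by positivity) ((hC z hz).trans ?_)
  gcongr
  linarith [le_abs_self C]

theorem HasUniformExteriorBall.isProxRegular {C₀ : ℝ≥0} (hball : HasUniformExteriorBall O C₀)
    (hO : IsOpen O) (hne : (closure O).Nonempty) : IsProxRegular (closure O) C₀ := by
  intro y
  obtain ⟨p, hp, hpd⟩ := isClosed_closure.exists_infDist_eq_dist hne y
  have hmin : ∀ x ∈ closure O, ‖p - y‖ ≤ ‖x - y‖ := fun x hx => by
    rw [← dist_eq_norm, ← dist_eq_norm, dist_comm p, dist_comm x, ← hpd]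
    exact Metric.infDist_le_dist_of_mem hx
  refine ⟨p, hp, hmin, fun z hz => ?_⟩
  rcases eq_or_ne p y with rfl | hpy
  · simp
  have hn : p - y ≠ 0 := sub_ne_zero.2 hpy
  have hprox : ∀ x ∈ closure O, 0 ≤ inner ℝ (x - p) (p - y) + 1 / 2 * ‖x - p‖ ^ 2 := fun x hx => by
    have hle := pow_le_pow_left₀ (norm_nonneg _) (hmin x hx) 2
    have hexpand := norm_add_sq_real (x - p) (p - y)
    rw [sub_add_sub_cancel] at hexpand
    linarith
  have hp_frontier := mem_frontier_of_proximal hO hp hn fun x hx => hprox x (subset_closure hx)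
  have hnormal := hball p hp_frontier _ (inv_norm_smul_mem_inwardNormals hn hprox) z hz
  calc 0 ≤ ‖p - y‖ * (inner ℝ (z - p) (‖p - y‖⁻¹ • (p - y)) + C₀ * ‖z - p‖ ^ 2) := by positivity
    _ = inner ℝ (z - p) (p - y) + C₀ * ‖p - y‖ * ‖z - p‖ ^ 2 := by
      rw [real_inner_smul_right]
      field_simp

end Domain

variable {d r : ℕ} {O : Set (E d)}

/-- The single constant `A` dominates all the constants of the reflected equation with the
coefficients `σ` and `b` on the domain `O`. -/
structure IsControlled (O : Set (E d)) (σ : closure O → E r →L[ℝ] E d) (b : closure O → E d)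
    (A : ℝ≥0) : Prop where
  isOpen : IsOpen O
  isCompact : IsCompact (closure O)
  one_le : 1 ≤ A
  exteriorBall : HasUniformExteriorBall O A
  norm_sub_le : ∀ x ∈ closure O, ∀ y ∈ closure O, ‖x - y‖ ≤ A
  norm_σ_le : ∀ x, ‖σ x‖ ≤ A
  norm_b_le : ∀ x, ‖b x‖ ≤ A
  lipschitz_σ : LipschitzWith A σ
  lipschitz_b : LipschitzWith A b

theorem exists_isControlled (hO : IsOpen O) (hO_bdd : Bornology.IsBounded O) {C₀ : ℝ≥0}
    (hball : HasUniformExteriorBall O C₀) {σ : closure O → E r →L[ℝ] E d} {κ : ℝ≥0}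
    (hσ : LipschitzWith κ σ) {b : closure O → E d} {κ' : ℝ≥0} (hb : LipschitzWith κ' b) :
    ∃ A, IsControlled O σ b A := by
  have hcompact : IsCompact (closure O) := hO_bdd.isCompact_closure
  have : CompactSpace (closure O) := isCompact_iff_compactSpace.1 hcompact
  obtain ⟨D, hD⟩ := Metric.isBounded_iff.1 hcompact.isBounded
  obtain ⟨B, hB⟩ := isCompact_univ.exists_bound_of_continuousOn hσ.continuous.continuousOn
  obtain ⟨B', hB'⟩ := isCompact_univ.exists_bound_of_continuousOn hb.continuous.continuousOn
  obtain ⟨A, hA⟩ :=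
    ({1, C₀, κ, κ', D.toNNReal, B.toNNReal, B'.toNNReal} : Finset ℝ≥0).bddAbove
  simp only [Finset.coe_insert, Finset.coe_singleton, mem_upperBounds, mem_insert_iff,
    mem_singleton_iff, forall_eq_or_imp, forall_eq, Real.toNNReal_le_iff_le_coe] at hA
  obtain ⟨hA₁, hAC₀, hAκ, hAκ', hAD, hAB, hAB'⟩ := hA
  exact ⟨A, {
    isOpen := hO
    isCompact := hcompact
    one_le := hA₁
    exteriorBall := fun x hx n hn z hz => (hball x hx n hn z hz).trans (by gcongr)
    norm_sub_le := fun x hx y hy => (dist_eq_norm x y).symm.trans_le ((hD hx hy).trans hAD)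
    norm_σ_le := fun x => (hB x (mem_univ x)).trans hAB
    norm_b_le := fun x => (hB' x (mem_univ x)).trans hAB'
    lipschitz_σ := hσ.weaken hAκ
    lipschitz_b := hb.weaken hAκ' }⟩

/-! ### The flow for an input with constant velocity -/

section Flow

variable {σ : closure O → E r →L[ℝ] E d} {b : closure O → E d} {A : ℝ≥0}

/-- The drift `σ(x) v + b(x)` for an input with constant velocity `v`. -/
def drift (σ : closure O → E r →L[ℝ] E d) (b : closure O → E d) (v : E r) (x : closure O) : E d :=
  σ x v + b x

namespace IsControlled

theorem norm_drift_le (h : IsControlled O σ b A) (v : E r) (x : closure O) :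
    ‖drift σ b v x‖ ≤ A * (‖v‖ + 1) :=
  calc ‖drift σ b v x‖ ≤ ‖σ x v‖ + ‖b x‖ := norm_add_le _ _
    _ ≤ A * ‖v‖ + A := add_le_add ((σ x).le_of_opNorm_le (h.norm_σ_le x) v) (h.norm_b_le x)
    _ = A * (‖v‖ + 1) := by ring

theorem lipschitzWith_drift (h : IsControlled O σ b A) (v : E r) :
    LipschitzWith (A * (‖v‖₊ + 1)) (drift σ b v) := by
  have hσ : LipschitzWith (‖v‖₊ * A) fun x => σ x v :=
    ((ContinuousLinearMap.apply ℝ (E d) v).lipschitz.weaken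
      (ContinuousLinearMap.opNorm_le_bound _ (norm_nonneg v) fun T => by
        rw [mul_comm]; exact T.le_opNorm v)).comp h.lipschitz_σ
  exact (hσ.add h.lipschitz_b).weaken (by rw [mul_add, mul_one, mul_comm])

theorem norm_drift_sub_drift_le (h : IsControlled O σ b A) (v v' : E r) (x : closure O) :
    ‖drift σ b v x - drift σ b v' x‖ ≤ A * ‖v - v'‖ := by
  have hlin : drift σ b v x - drift σ b v' x = σ x (v - v') := by simp [drift]
  rw [hlin]
  exact (σ x).le_of_opNorm_le (h.norm_σ_le x) _

theorem continuous_drift (h : IsControlled O σ b A) :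
    Continuous fun p : E r × closure O => drift σ b p.1 p.2 :=
  ((h.lipschitz_σ.continuous.comp continuous_snd).clm_apply continuous_fst).add
    (h.lipschitz_b.continuous.comp continuous_snd)

theorem exists_flow (h : IsControlled O σ b A) (v : E r) (x : closure O) :
    ∃ X : ℝ≥0 → closure O, X 0 = x ∧
      IsFlowLine (drift σ b v) (A * (‖v‖ + 1)) (2 * A * (A * (‖v‖ + 1))) X :=
  (h.exteriorBall.isProxRegular h.isOpen ⟨x, x.2⟩).exists_isFlowLine A.2 h.isCompact
    (h.norm_drift_le v) (h.lipschitzWith_drift v) x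

end IsControlled

/-- The solution, started at `x`, of the reflected equation for the input with the constant
velocity `v`. -/
noncomputable def flow (h : IsControlled O σ b A) (v : E r) (x : closure O) : ℝ≥0 → closure O :=
  (h.exists_flow v x).choose

theorem flow_zero (h : IsControlled O σ b A) (v : E r) (x : closure O) : flow h v x 0 = x :=
  (h.exists_flow v x).choose_spec.1

theorem isFlowLine_flow (h : IsControlled O σ b A) (v : E r) (x : closure O) :
    IsFlowLine (drift σ b v) (A * (‖v‖ + 1)) (2 * A * (A * (‖v‖ + 1))) (flow h v x) :=
  (h.exists_flow v x).choose_spec.2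

theorem norm_flow_sub_flow_sq_le (h : IsControlled O σ b A) (v v' : E r) (x x' : closure O)
    (t : ℝ≥0) : ‖(flow h v x t : E d) - flow h v' x' t‖ ^ 2
      ≤ (‖(x : E d) - x'‖ ^ 2 + 2 * A * (A * ‖v - v'‖) * t)
        * Real.exp ((2 * (A * (‖v‖ + 1)) + 2 * A * (A * (‖v‖ + 1)) + 2 * A * (A * (‖v'‖ + 1)))
          * t) := by
  have hle := (isFlowLine_flow h v x).norm_sub_sq_le (isFlowLine_flow h v' x') (by positivity)
    (by positivity) (h.lipschitzWith_drift v) (h.norm_drift_sub_drift_le v v') h.norm_sub_le t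
  rw [flow_zero, flow_zero] at hle
  exact_mod_cast hle

theorem continuous_flow (h : IsControlled O σ b A) :
    Continuous fun p : E r × closure O × ℝ≥0 => flow h p.1 p.2.1 p.2.2 := by
  rw [continuous_iff_continuousAt]
  rintro ⟨v₀, x₀, t₀⟩
  let f : E r × closure O × ℝ≥0 → ℝ := fun p =>
    √((‖(p.2.1 : E d) - x₀‖ ^ 2 + 2 * A * (A * ‖p.1 - v₀‖) * p.2.2)
      * Real.exp ((2 * (A * (‖p.1‖ + 1)) + 2 * A * (A * (‖p.1‖ + 1)) + 2 * A * (A * (‖v₀‖ + 1)))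
        * p.2.2)) + 2 * (A * (‖v₀‖ + 1)) * |(p.2.2 : ℝ) - t₀|
  have hf : Continuous f := by fun_prop
  have hf₀ : f (v₀, x₀, t₀) = 0 := by simp [f]
  rw [ContinuousAt, tendsto_iff_dist_tendsto_zero]
  refine squeeze_zero (fun _ => dist_nonneg) (g := f) ?_ (hf₀ ▸ hf.tendsto (v₀, x₀, t₀))
  rintro ⟨v, x, t⟩
  rw [Subtype.dist_eq, dist_eq_norm, ← sub_add_sub_cancel _ (flow h v₀ x₀ t : E d)]
  exact (norm_add_le _ _).trans (add_le_add
    (Real.le_sqrt_of_sq_le (norm_flow_sub_flow_sq_le h v v₀ x x₀ t))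
    ((isFlowLine_flow h v₀ x₀).norm_sub_le_abs t₀ t))

/-- The reflection term of `flow`. -/
noncomputable def push (h : IsControlled O σ b A) (v : E r) (x : closure O) (t : ℝ≥0) : E d :=
  flow h v x t - x - ∫ s in (0 : ℝ)..t, drift σ b v (flow h v x s.toNNReal)

theorem push_zero (h : IsControlled O σ b A) (v : E r) (x : closure O) : push h v x 0 = 0 := by
  simp [push, flow_zero]

theorem continuous_drift_flow (h : IsControlled O σ b A) :
    Continuous fun p : (E r × closure O) × ℝ =>
      drift σ b p.1.1 (flow h p.1.1 p.1.2 p.2.toNNReal) := by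
  have hflow : Continuous fun p : (E r × closure O) × ℝ => flow h p.1.1 p.1.2 p.2.toNNReal :=
    (continuous_flow h).comp (g := fun p : E r × closure O × ℝ≥0 => flow h p.1 p.2.1 p.2.2)
      (f := fun p : (E r × closure O) × ℝ => (p.1.1, p.1.2, p.2.toNNReal)) (by fun_prop)
  exact h.continuous_drift.comp ((continuous_fst.comp continuous_fst).prodMk hflow)

theorem continuous_drift_flow_right (h : IsControlled O σ b A) (v : E r) (x : closure O) :
    Continuous fun s : ℝ => drift σ b v (flow h v x s.toNNReal) :=
  (continuous_drift_flow h).comp (Continuous.prodMk_right (v, x))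

theorem continuous_push (h : IsControlled O σ b A) :
    Continuous fun p : E r × closure O × ℝ≥0 => push h p.1 p.2.1 p.2.2 := by
  have hint : Continuous fun p : (E r × closure O) × ℝ =>
      ∫ s in (0 : ℝ)..p.2, drift σ b p.1.1 (flow h p.1.1 p.1.2 s.toNNReal) :=
    intervalIntegral.continuous_parametric_primitive_of_continuous
      (f := fun (p : E r × closure O) s => drift σ b p.1 (flow h p.1 p.2 s.toNNReal))
      (continuous_drift_flow h)
  have hpair : Continuous fun p : E r × closure O × ℝ≥0 => (((p.1, p.2.1), (p.2.2 : ℝ)) :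
      (E r × closure O) × ℝ) := by fun_prop
  exact ((continuous_subtype_val.comp (continuous_flow h)).sub
    (continuous_subtype_val.comp (continuous_fst.comp continuous_snd))).sub (hint.comp hpair)

theorem push_sub_push (h : IsControlled O σ b A) (v : E r) (x : closure O) (s t : ℝ≥0) :
    push h v x t - push h v x s = ((flow h v x t : E d) - flow h v x s)
      - ∫ u in (s : ℝ)..t, drift σ b v (flow h v x u.toNNReal) := by
  have hcont := continuous_drift_flow_right h v x
  rw [push, push, ← intervalIntegral.integral_interval_sub_left
    (hcont.intervalIntegrable 0 t) (hcont.intervalIntegrable 0 s)]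
  abel

theorem norm_push_sub_push_le (h : IsControlled O σ b A) (v : E r) (x : closure O) {s t : ℝ≥0}
    (hst : s ≤ t) : ‖push h v x t - push h v x s‖ ≤ 3 * (A * (‖v‖ + 1)) * ((t : ℝ) - s) := by
  have hint : ‖∫ u in (s : ℝ)..t, drift σ b v (flow h v x u.toNNReal)‖
      ≤ A * (‖v‖ + 1) * ((t : ℝ) - s) := by
    rw [← abs_of_nonneg (sub_nonneg.2 (NNReal.coe_le_coe.2 hst))]
    exact intervalIntegral.norm_integral_le_of_norm_le_const fun u _ => h.norm_drift_le v _
  calc ‖push h v x t - push h v x s‖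
      ≤ 2 * (A * (‖v‖ + 1)) * ((t : ℝ) - s) + A * (‖v‖ + 1) * ((t : ℝ) - s) := by
        rw [push_sub_push]
        exact (norm_sub_le _ _).trans
          (add_le_add ((isFlowLine_flow h v x).norm_sub_le s t hst) hint)
    _ = 3 * (A * (‖v‖ + 1)) * ((t : ℝ) - s) := by ring

theorem hasDerivAt_flow_of_hasDerivAt_push (h : IsControlled O σ b A) {v : E r} {x : closure O}
    {t : ℝ≥0} {l : E d} (ht : 0 < t) (hl : HasDerivAt (fun u : ℝ => push h v x u.toNNReal) l t) :
    HasDerivAt (fun u : ℝ => (flow h v x u.toNNReal : E d)) (l + drift σ b v (flow h v x t)) t := by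
  have hint : HasDerivAt (fun u : ℝ => ∫ s in (0 : ℝ)..u, drift σ b v (flow h v x s.toNNReal))
      (drift σ b v (flow h v x t)) t := by
    simpa using ((continuous_drift_flow_right h v x).integral_hasStrictDerivAt 0 t).hasDerivAt
  refine ((hl.add hint).add_const (x : E d)).congr_of_eventuallyEq ?_
  filter_upwards [lt_mem_nhds (NNReal.coe_pos.2 ht)] with u hu
  simp only [push, Pi.add_apply, Real.coe_toNNReal u hu.le]
  abel

theorem mem_frontier_and_mem_inwardNormals_of_hasDerivAt_push (h : IsControlled O σ b A) {v : E r}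
    {x : closure O} {t : ℝ≥0} {l : E d} (ht : 0 < t)
    (hl : HasDerivAt (fun u : ℝ => push h v x u.toNNReal) l t) (hl₀ : l ≠ 0) :
    (flow h v x t : E d) ∈ frontier O ∧ ‖l‖⁻¹ • l ∈ inwardNormals O (flow h v x t) := by
  have hprox : ∀ z ∈ closure O, 0 ≤ inner ℝ (z - flow h v x t) l
      + A * (A * (‖v‖ + 1)) * ‖z - flow h v x t‖ ^ 2 := fun z hz => by
    have hle := (isFlowLine_flow h v x).proximal_of_hasDerivAt
      (hasDerivAt_flow_of_hasDerivAt_push h ht hl) hz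
    rw [add_sub_cancel_right] at hle
    linarith
  exact ⟨mem_frontier_of_proximal h.isOpen (flow h v x t).2 hl₀
    fun z hz => hprox z (subset_closure hz), inv_norm_smul_mem_inwardNormals hl₀ hprox⟩

end Flow

/-! ### The solution driven by a polygonal path -/

section Glue

variable {V S Ω Y : Type*} {τ : ℝ≥0}

theorem exists_nat_mul_le_le (hτ : 0 < τ) (t : ℝ≥0) :
    ∃ m : ℕ, m * τ ≤ t ∧ t ≤ (m + 1 : ℕ) * τ :=
  ⟨⌊t / τ⌋₊, (le_div_iff₀ hτ).1 (Nat.floor_le zero_le),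
    (div_le_iff₀ hτ).1 (by exact_mod_cast (Nat.lt_floor_add_one _).le)⟩

theorem induction_on_cells (hτ : 0 < τ) {P : ℝ≥0 → Prop} (zero : P 0)
    (cell : ∀ (m : ℕ) (t : ℝ≥0), P (m * τ) → m * τ ≤ t → t ≤ (m + 1 : ℕ) * τ → P t) (t : ℝ≥0) :
    P t := by
  have hnode : ∀ m : ℕ, P (m * τ) := by
    intro m
    induction m with
    | zero => simpa using zero
    | succ m ih => exact cell m _ ih (by gcongr; simp) le_rfl
  obtain ⟨m, hmt, htm⟩ := exists_nat_mul_le_le hτ t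
  exact cell m t (hnode m) hmt htm

theorem continuous_of_cells [TopologicalSpace Ω] [TopologicalSpace Y] (hτ : 0 < τ)
    {f : Ω × ℝ≥0 → Y} (g : ℕ → Ω × ℝ≥0 → Y) (hg : ∀ m, Continuous (g m))
    (hfg : ∀ (m : ℕ) p, m * τ ≤ p.2 → p.2 ≤ (m + 1 : ℕ) * τ → f p = g m p) : Continuous f := by
  have hfinite : LocallyFinite fun m : ℕ =>
      {p : Ω × ℝ≥0 | m * τ ≤ p.2 ∧ p.2 ≤ (m + 1 : ℕ) * τ} := by
    intro p
    refine ⟨{q | q.2 < p.2 + 1}, (isOpen_lt continuous_snd continuous_const).mem_nhds (by simp),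
      (Set.finite_le_nat ⌈(p.2 + 1) / τ⌉₊).subset ?_⟩
    rintro m ⟨q, ⟨hmq, -⟩, hqp⟩
    have hle : (m : ℝ≥0) ≤ ⌈(p.2 + 1) / τ⌉₊ :=
      ((le_div_iff₀ hτ).2 (hmq.trans (le_of_lt hqp))).trans (Nat.le_ceil _)
    exact_mod_cast hle
  refine hfinite.continuous (eq_univ_of_forall fun p => mem_iUnion.2 (exists_nat_mul_le_le hτ p.2))
    (fun m => (isClosed_Icc (a := m * τ) (b := (m + 1 : ℕ) * τ)).preimage continuous_snd)
    fun m => (hg m).continuousOn.congr fun p hp => hfg m p hp.1 hp.2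

/-- The state at time `m τ` of the system which follows `Ψ (v m)` on `[m τ, (m + 1) τ]`. -/
def glueNode (Ψ : V → S → ℝ≥0 → S) (τ : ℝ≥0) (v : ℕ → V) (s : S) : ℕ → S
  | 0 => s
  | m + 1 => Ψ (v m) (glueNode Ψ τ v s m) τ

/-- The state at time `t` of the system which follows `Ψ (v m)` on `[m τ, (m + 1) τ]`. -/
noncomputable def glue (Ψ : V → S → ℝ≥0 → S) (τ : ℝ≥0) (v : ℕ → V) (s : S) (t : ℝ≥0) : S :=
  Ψ (v ⌊t / τ⌋₊) (glueNode Ψ τ v s ⌊t / τ⌋₊) (t - ⌊t / τ⌋₊ * τ)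

variable {Ψ : V → S → ℝ≥0 → S}

theorem glue_eq (hΨ₀ : ∀ v s, Ψ v s 0 = s) (hτ : 0 < τ) (v : ℕ → V) (s : S) (m : ℕ) {t : ℝ≥0}
    (hmt : m * τ ≤ t) (htm : t ≤ (m + 1 : ℕ) * τ) :
    glue Ψ τ v s t = Ψ (v m) (glueNode Ψ τ v s m) (t - m * τ) := by
  rcases htm.lt_or_eq with hlt | rfl
  · have hfloor : ⌊t / τ⌋₊ = m := (Nat.floor_eq_iff zero_le).2
      ⟨(le_div_iff₀ hτ).2 hmt, (div_lt_iff₀ hτ).2 (by exact_mod_cast hlt)⟩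
    rw [glue, hfloor]
  · have hsub : ((m + 1 : ℕ) : ℝ≥0) * τ - m * τ = τ := by
      rw [Nat.cast_add_one, add_mul, one_mul, add_tsub_cancel_left]
    rw [glue, mul_div_cancel_right₀ _ hτ.ne', Nat.floor_natCast, tsub_self, hΨ₀, glueNode, hsub]

theorem glue_mul (hΨ₀ : ∀ v s, Ψ v s 0 = s) (hτ : 0 < τ) (v : ℕ → V) (s : S) (m : ℕ) :
    glue Ψ τ v s (m * τ) = glueNode Ψ τ v s m := by
  rw [glue_eq hΨ₀ hτ v s m le_rfl (by gcongr; simp), tsub_self, hΨ₀]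

variable [TopologicalSpace V] [TopologicalSpace S] [TopologicalSpace Ω]

theorem continuous_glueNode (hΨ : Continuous fun p : V × S × ℝ≥0 => Ψ p.1 p.2.1 p.2.2)
    {v : ℕ → Ω → V} (hv : ∀ m, Continuous (v m)) {s : Ω → S} (hs : Continuous s) (m : ℕ) :
    Continuous fun ω => glueNode Ψ τ (fun m => v m ω) (s ω) m := by
  induction m with
  | zero => exact hs
  | succ m ih => exact hΨ.comp ((hv m).prodMk (ih.prodMk continuous_const))

theorem continuous_glue (hΨ : Continuous fun p : V × S × ℝ≥0 => Ψ p.1 p.2.1 p.2.2)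
    (hΨ₀ : ∀ v s, Ψ v s 0 = s) (hτ : 0 < τ)
    {v : ℕ → Ω → V} (hv : ∀ m, Continuous (v m)) {s : Ω → S} (hs : Continuous s) :
    Continuous fun p : Ω × ℝ≥0 => glue Ψ τ (fun m => v m p.1) (s p.1) p.2 :=
  continuous_of_cells hτ
    (fun m p => Ψ (v m p.1) (glueNode Ψ τ (fun m => v m p.1) (s p.1) m) (p.2 - m * τ))
    (fun m => hΨ.comp (((hv m).comp continuous_fst).prodMk
      (((continuous_glueNode hΨ hv hs m).comp continuous_fst).prodMk
        (continuous_snd.sub continuous_const))))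
    fun m _ hmt htm => glue_eq hΨ₀ hτ _ _ m hmt htm

end Glue

section Dyadic

variable {r : ℕ}

/-- The mesh `2⁻ᴺ` of the dyadic partition of level `N`. -/
noncomputable def mesh (N : ℕ) : ℝ≥0 := (2 ^ N)⁻¹

theorem mesh_pos (N : ℕ) : 0 < mesh N := by unfold mesh; positivity

theorem coe_mesh (N : ℕ) : (mesh N : ℝ) = (2 ^ N)⁻¹ := by simp [mesh]

/-- The increment of `w` over `[m 2⁻ᴺ, (m + 1) 2⁻ᴺ]`. -/
noncomputable def dyadicIncrement (N : ℕ) (w : Path (E r)) (m : ℕ) : E r :=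
  w ((m + 1 : ℕ) * mesh N) - w (m * mesh N)

/-- The velocity of the polygonalization of `w` on `[m 2⁻ᴺ, (m + 1) 2⁻ᴺ]`. -/
noncomputable def velocity (N : ℕ) (w : Path (E r)) (m : ℕ) : E r :=
  (2 ^ N : ℝ) • dyadicIncrement N w m

theorem continuous_dyadicIncrement (N m : ℕ) :
    Continuous fun w : Path (E r) => dyadicIncrement N w m :=
  (continuous_eval_const _).sub (continuous_eval_const _)

theorem continuous_velocity (N m : ℕ) : Continuous fun w : Path (E r) => velocity N w m :=
  (continuous_dyadicIncrement N m).const_smul (2 ^ N : ℝ)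

theorem dyadicInterp_eq (N : ℕ) (w : Path (E r)) (m : ℕ) {t : ℝ≥0} (hmt : m * mesh N ≤ t)
    (htm : t ≤ (m + 1 : ℕ) * mesh N) : dyadicInterp N w t
      = w (m * mesh N) + ((t : ℝ) - m * mesh N) • velocity N w m := by
  have hN : (0 : ℝ≥0) < 2 ^ N := by positivity
  rw [mesh, ← div_eq_mul_inv, div_le_iff₀ hN] at hmt
  rw [mesh, ← div_eq_mul_inv, le_div_iff₀ hN] at htm
  change polygonal (fun m => w ((m : ℝ≥0) / 2 ^ N)) (2 ^ N * t) = _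
  rw [polygonal_eq _ m _ (by rwa [mul_comm]) (by rwa [mul_comm]), velocity, dyadicIncrement,
    smul_smul]
  simp only [div_eq_mul_inv, mesh]
  congr 2
  push_cast
  field_simp

theorem continuous_uncurry_dyadicInterp (N : ℕ) :
    Continuous fun p : Path (E r) × ℝ≥0 => dyadicInterp N p.1 p.2 := by
  refine continuous_of_cells (mesh_pos N) (fun m p => p.1 (m * mesh N)
    + ((p.2 : ℝ) - m * mesh N) • velocity N p.1 m) (fun m => ?_)
    fun m p hmt htm => dyadicInterp_eq N p.1 m hmt htm
  have hnode := (continuous_eval_const (F := Path (E r)) (m * mesh N)).comp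
    (continuous_fst (X := Path (E r)) (Y := ℝ≥0))
  have hvelocity := (continuous_velocity (r := r) N m).comp (continuous_fst (Y := ℝ≥0))
  exact hnode.add (((NNReal.continuous_coe.comp continuous_snd).sub continuous_const).smul
    hvelocity)

theorem continuous_dyadicInterp (N : ℕ) : Continuous (dyadicInterp (r := r) N) :=
  ContinuousMap.continuous_of_continuous_uncurry _ (continuous_uncurry_dyadicInterp N)

theorem hasDerivAt_dyadicInterp (N : ℕ) (w : Path (E r)) (m : ℕ) {u : ℝ}
    (hmu : (m * mesh N : ℝ≥0) < u) (hum : u < ((m + 1 : ℕ) * mesh N : ℝ≥0)) :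
    HasDerivAt (fun u : ℝ => dyadicInterp N w u.toNNReal) (velocity N w m) u := by
  have haffine : HasDerivAt (fun u : ℝ => w (m * mesh N) + (u - m * mesh N) • velocity N w m)
      (velocity N w m) u := by
    simpa using (((hasDerivAt_id u).sub_const ((m : ℝ) * mesh N)).smul_const
      (velocity N w m)).const_add (w (m * mesh N))
  refine haffine.congr_of_eventuallyEq ?_
  filter_upwards [Ioo_mem_nhds hmu hum] with x hx
  rw [dyadicInterp_eq N w m (NNReal.le_toNNReal_of_coe_le hx.1.le)
    (Real.toNNReal_le_iff_le_coe.2 hx.2.le),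
    Real.coe_toNNReal x ((NNReal.coe_nonneg _).trans hx.1.le)]

theorem ae_deriv_dyadicInterp (N : ℕ) (w : Path (E r)) (m : ℕ) {s t : ℝ≥0}
    (hms : m * mesh N ≤ s) (htm : t ≤ (m + 1 : ℕ) * mesh N) :
    ∀ᵐ u : ℝ, u ∈ Ioc (s : ℝ) t →
      deriv (fun u : ℝ => dyadicInterp N w u.toNNReal) u = velocity N w m := by
  filter_upwards [Measure.ae_ne volume (((m + 1 : ℕ) * mesh N : ℝ≥0) : ℝ)] with u hu hsut
  exact (hasDerivAt_dyadicInterp N w m ((NNReal.coe_le_coe.2 hms).trans_lt hsut.1)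
    ((hsut.2.trans (NNReal.coe_le_coe.2 htm)).lt_of_ne hu)).deriv

end Dyadic

section Solution

variable {d r : ℕ} {O : Set (E d)} {σ : closure O → E r →L[ℝ] E d} {b : closure O → E d}
  {A : ℝ≥0}

/-- The flow of the pair consisting of the solution and its reflection term. -/
noncomputable def pairFlow (h : IsControlled O σ b A) (v : E r) (s : closure O × E d) (t : ℝ≥0) :
    closure O × E d :=
  (flow h v s.1 t, s.2 + push h v s.1 t)

theorem pairFlow_zero (h : IsControlled O σ b A) (v : E r) (s : closure O × E d) :
    pairFlow h v s 0 = s := by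
  simp [pairFlow, flow_zero, push_zero]

theorem continuous_pairFlow (h : IsControlled O σ b A) :
    Continuous fun p : E r × (closure O × E d) × ℝ≥0 => pairFlow h p.1 p.2.1 p.2.2 := by
  have hq : Continuous fun p : E r × (closure O × E d) × ℝ≥0 => (p.1, p.2.1.1, p.2.2) := by fun_prop
  exact ((continuous_flow h).comp hq).prodMk
    ((by fun_prop : Continuous fun p : E r × (closure O × E d) × ℝ≥0 => p.2.1.2).add
      ((continuous_push h).comp hq))

/-- The state at time `t` of the pair driven by the `N`-dyadic polygonalization of `w`. -/
noncomputable def state (h : IsControlled O σ b A) (N : ℕ) (x₀ : closure O) (w : Path (E r))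
    (t : ℝ≥0) : closure O × E d :=
  glue (pairFlow h) (mesh N) (velocity N w) (x₀, 0) t

theorem continuous_uncurry_state (h : IsControlled O σ b A) (N : ℕ) (x₀ : closure O) :
    Continuous fun p : Path (E r) × ℝ≥0 => state h N x₀ p.1 p.2 :=
  continuous_glue (continuous_pairFlow h) (pairFlow_zero h) (mesh_pos N)
    (v := fun m w => velocity N w m) (continuous_velocity N) continuous_const

/-- The reflected path driven by the `N`-dyadic polygonalization of `w`. -/
noncomputable def solX (h : IsControlled O σ b A) (N : ℕ) (x₀ : closure O) (w : Path (E r)) :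
    Path (closure O) where
  toFun t := (state h N x₀ w t).1
  continuous_toFun := continuous_fst.comp
    ((continuous_uncurry_state h N x₀).comp (Continuous.prodMk_right w))

/-- The reflection term of the path driven by the `N`-dyadic polygonalization of `w`. -/
noncomputable def solL (h : IsControlled O σ b A) (N : ℕ) (x₀ : closure O) (w : Path (E r)) :
    Path (E d) where
  toFun t := (state h N x₀ w t).2
  continuous_toFun := continuous_snd.comp
    ((continuous_uncurry_state h N x₀).comp (Continuous.prodMk_right w))

theorem continuous_solX (h : IsControlled O σ b A) (N : ℕ) (x₀ : closure O) :
    Continuous (solX h N x₀) :=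
  ContinuousMap.continuous_of_continuous_uncurry _
    (continuous_fst.comp (continuous_uncurry_state h N x₀))

theorem continuous_solL (h : IsControlled O σ b A) (N : ℕ) (x₀ : closure O) :
    Continuous (solL h N x₀) :=
  ContinuousMap.continuous_of_continuous_uncurry _
    (continuous_snd.comp (continuous_uncurry_state h N x₀))

variable (h : IsControlled O σ b A) (N : ℕ) (x₀ : closure O) (w : Path (E r))

theorem state_eq (m : ℕ) {t : ℝ≥0} (hmt : m * mesh N ≤ t) (htm : t ≤ (m + 1 : ℕ) * mesh N) :
    state h N x₀ w t
      = pairFlow h (velocity N w m) (state h N x₀ w (m * mesh N)) (t - m * mesh N) := by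
  rw [state, glue_eq (pairFlow_zero h) (mesh_pos N) _ _ m hmt htm, state,
    glue_mul (pairFlow_zero h) (mesh_pos N)]

theorem state_zero : state h N x₀ w 0 = (x₀, 0) := by
  simpa [state, glueNode] using
    glue_mul (pairFlow_zero h) (mesh_pos N) (velocity N w) (x₀, 0) 0

theorem solX_zero : solX h N x₀ w 0 = x₀ := congrArg Prod.fst (state_zero h N x₀ w)

theorem solL_zero : solL h N x₀ w 0 = 0 := congrArg Prod.snd (state_zero h N x₀ w)

theorem solX_eq (m : ℕ) {t : ℝ≥0} (hmt : m * mesh N ≤ t) (htm : t ≤ (m + 1 : ℕ) * mesh N) :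
    solX h N x₀ w t = flow h (velocity N w m) (solX h N x₀ w (m * mesh N)) (t - m * mesh N) :=
  congrArg Prod.fst (state_eq h N x₀ w m hmt htm)

theorem solL_eq (m : ℕ) {t : ℝ≥0} (hmt : m * mesh N ≤ t) (htm : t ≤ (m + 1 : ℕ) * mesh N) :
    solL h N x₀ w t = solL h N x₀ w (m * mesh N)
      + push h (velocity N w m) (solX h N x₀ w (m * mesh N)) (t - m * mesh N) :=
  congrArg Prod.snd (state_eq h N x₀ w m hmt htm)

end Solution

section Equation

variable {d r : ℕ} {O : Set (E d)} {σ : closure O → E r →L[ℝ] E d} {b : closure O → E d}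
  {A : ℝ≥0}

namespace IsControlled

theorem intervalIntegrable_b (h : IsControlled O σ b A) (x : Path (closure O)) (s t : ℝ) :
    IntervalIntegrable (fun u : ℝ => b (x u.toNNReal)) volume s t :=
  (h.lipschitz_b.continuous.comp
    (x.continuous.comp continuous_real_toNNReal)).intervalIntegrable _ _

theorem intervalIntegrable_σ_const (h : IsControlled O σ b A) (x : Path (closure O)) (v : E r)
    (s t : ℝ) : IntervalIntegrable (fun u : ℝ => σ (x u.toNNReal) v) volume s t :=
  ((h.lipschitz_σ.continuous.comp (x.continuous.comp continuous_real_toNNReal)).clm_apply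
    continuous_const).intervalIntegrable _ _

end IsControlled

theorem ae_σ_deriv_dyadicInterp (N : ℕ) (w : Path (E r)) (x : Path (closure O)) (m : ℕ)
    {s t : ℝ≥0} (hms : m * mesh N ≤ s) (hst : s ≤ t) (htm : t ≤ (m + 1 : ℕ) * mesh N) :
    ∀ᵐ u : ℝ, u ∈ uIoc (s : ℝ) t →
      σ (x u.toNNReal) (deriv (fun u : ℝ => dyadicInterp N w u.toNNReal) u)
        = σ (x u.toNNReal) (velocity N w m) := by
  filter_upwards [ae_deriv_dyadicInterp N w m hms htm] with u hu hsut
  rw [hu (uIoc_of_le (NNReal.coe_le_coe.2 hst) ▸ hsut)]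

theorem integral_σ_deriv_dyadicInterp (N : ℕ) (w : Path (E r)) (x : Path (closure O)) (m : ℕ)
    {s t : ℝ≥0} (hms : m * mesh N ≤ s) (hst : s ≤ t) (htm : t ≤ (m + 1 : ℕ) * mesh N) :
    (∫ u in (s : ℝ)..t, σ (x u.toNNReal) (deriv (fun u : ℝ => dyadicInterp N w u.toNNReal) u))
      = ∫ u in (s : ℝ)..t, σ (x u.toNNReal) (velocity N w m) :=
  intervalIntegral.integral_congr_ae (ae_σ_deriv_dyadicInterp N w x m hms hst htm)

theorem IsControlled.intervalIntegrable_σ (h : IsControlled O σ b A) (N : ℕ) (w : Path (E r))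
    (x : Path (closure O)) (s t : ℝ≥0) :
    IntervalIntegrable (fun u : ℝ => σ (x u.toNNReal)
      (deriv (fun u : ℝ => dyadicInterp N w u.toNNReal) u)) volume s t := by
  have hfrom : ∀ t : ℝ≥0, IntervalIntegrable (fun u : ℝ => σ (x u.toNNReal)
      (deriv (fun u : ℝ => dyadicInterp N w u.toNNReal) u)) volume (0 : ℝ≥0) t := by
    refine induction_on_cells (mesh_pos N) (by simp) fun m t ih hmt htm => ih.trans ?_
    have hae := ae_σ_deriv_dyadicInterp (σ := σ) N w x m le_rfl hmt htm
    refine (h.intervalIntegrable_σ_const x (velocity N w m) _ _).congr_ae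
      ((ae_restrict_iff' measurableSet_uIoc).2 ?_)
    filter_upwards [hae] with u hu hmut using (hu hmut).symm
  exact (hfrom s).symm.trans (hfrom t)

theorem integral_drift_flow (h : IsControlled O σ b A) (N : ℕ) (x₀ : closure O) (w : Path (E r))
    (m : ℕ) {t : ℝ≥0} (hmt : m * mesh N ≤ t) (htm : t ≤ (m + 1 : ℕ) * mesh N) :
    ∫ u in (0 : ℝ)..(t - m * mesh N : ℝ≥0), drift σ b (velocity N w m)
        (flow h (velocity N w m) (solX h N x₀ w (m * mesh N)) u.toNNReal)
      = ∫ u in ((m * mesh N : ℝ≥0) : ℝ)..t,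
        drift σ b (velocity N w m) (solX h N x₀ w u.toNNReal) := by
  rw [NNReal.coe_sub hmt, ← sub_self ((m * mesh N : ℝ≥0) : ℝ),
    ← intervalIntegral.integral_comp_sub_right]
  refine intervalIntegral.integral_congr fun u hu => ?_
  rw [uIcc_of_le (NNReal.coe_le_coe.2 hmt)] at hu
  have hshift : (u - (m * mesh N : ℝ≥0)).toNNReal = u.toNNReal - m * mesh N := by
    rw [NNReal.sub_def, Real.coe_toNNReal u ((NNReal.coe_nonneg _).trans hu.1)]
  simp only [hshift]
  rw [solX_eq h N x₀ w m (NNReal.le_toNNReal_of_coe_le hu.1)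
    ((Real.toNNReal_le_iff_le_coe.2 hu.2).trans htm)]

theorem solX_eq_add_solL (h : IsControlled O σ b A) (N : ℕ) (x₀ : closure O) (w : Path (E r))
    (t : ℝ≥0) : (solX h N x₀ w t : E d) = x₀
    + (∫ s in (0 : ℝ)..t, σ (solX h N x₀ w s.toNNReal)
        (deriv (fun u : ℝ => dyadicInterp N w u.toNNReal) s))
    + (∫ s in (0 : ℝ)..t, b (solX h N x₀ w s.toNNReal)) + solL h N x₀ w t := by
  revert t
  refine induction_on_cells (mesh_pos N) (by simp [solX_zero, solL_zero])
    fun m t ih hmt htm => ?_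
  set x := solX h N x₀ w with hx
  set s : ℝ≥0 := m * mesh N with hs
  have hσ₀ := h.intervalIntegrable_σ N w x 0 s
  rw [NNReal.coe_zero] at hσ₀
  have hb := h.intervalIntegrable_b x
  have hpush : push h (velocity N w m) (x s) (t - s) = x t - x s
      - ((∫ u in (s : ℝ)..t, σ (x u.toNNReal) (velocity N w m))
        + ∫ u in (s : ℝ)..t, b (x u.toNNReal)) := by
    rw [push, integral_drift_flow h N x₀ w m hmt htm, hx, solX_eq h N x₀ w m hmt htm, ← hx,
      ← intervalIntegral.integral_add (h.intervalIntegrable_σ_const x _ _ _) (hb _ _)]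
    rfl
  rw [← intervalIntegral.integral_add_adjacent_intervals hσ₀ (h.intervalIntegrable_σ N w x s t),
    ← intervalIntegral.integral_add_adjacent_intervals (hb 0 s) (hb s t),
    integral_σ_deriv_dyadicInterp N w x m hs.ge hmt htm, solL_eq h N x₀ w m hmt htm, ← hx, ← hs,
    hpush, ih]
  abel

end Equation

/-! ### Total variation of the reflection term -/

section Variation

variable {F : Type*} [NormedAddCommGroup F] [NormedSpace ℝ F] {f : ℝ → F} {C : ℝ≥0} {a b : ℝ}

theorem ae_norm_deriv_le_of_lipschitzOnWith (hf : LipschitzOnWith C f (Icc a b)) :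
    ∀ᵐ u : ℝ, u ∈ Ioc a b → ‖deriv f u‖ ≤ C := by
  filter_upwards [(Ioo_ae_eq_Ioc (μ := volume) (a := a) (b := b)).mem_iff] with u hu huab
  exact norm_deriv_le_of_lipschitzOn (Icc_mem_nhds (hu.2 huab).1 (hu.2 huab).2) hf

theorem lipschitzOnWith_integral {g : ℝ → F} (hg : IntervalIntegrable g volume a b)
    (hab : a ≤ b) (hC : ∀ᵐ u : ℝ, u ∈ Ioc a b → ‖g u‖ ≤ C) :
    LipschitzOnWith C (fun t => ∫ u in a..t, g u) (Icc a b) := by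
  have hgt : ∀ t ∈ Icc a b, IntervalIntegrable g volume a t := fun t ht =>
    hg.mono_set (uIcc_subset_uIcc left_mem_uIcc (uIcc_of_le hab ▸ ht))
  refine LipschitzOnWith.of_dist_le_mul fun s hs t ht => ?_
  rw [dist_eq_norm, intervalIntegral.integral_interval_sub_left (hgt s hs) (hgt t ht),
    Real.dist_eq]
  refine intervalIntegral.norm_integral_le_of_norm_le_const_ae ?_
  filter_upwards [hC] with u hu hst
  exact hu ⟨(le_min ht.1 hs.1).trans_lt hst.1, hst.2.trans (max_le ht.2 hs.2)⟩

theorem norm_le_of_hasDerivAt_of_norm_sub_le {V : ℝ → ℝ} {f' : F} {V' u : ℝ}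
    (hf : HasDerivAt f f' u) (hV : HasDerivAt V V' u)
    (hfV : ∀ᶠ t in 𝓝[>] u, ‖f t - f u‖ ≤ V t - V u) : ‖f'‖ ≤ V' := by
  refine le_of_tendsto_of_tendsto
    ((hasDerivAt_iff_tendsto_slope.1 hf).mono_left (nhdsGT_le_nhdsNE u)).norm
    ((hasDerivAt_iff_tendsto_slope.1 hV).mono_left (nhdsGT_le_nhdsNE u)) ?_
  filter_upwards [self_mem_nhdsWithin, hfV] with t hut ht
  rw [slope_def_module, slope_def_field, norm_smul, norm_inv,
    Real.norm_of_nonneg (sub_nonneg.2 (le_of_lt hut)), inv_mul_eq_div]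
  gcongr
  exact sub_nonneg.2 (le_of_lt hut)

omit [NormedSpace ℝ F] in
theorem norm_sub_le_variationOnFromTo_sub {s : Set ℝ} (hf : LocallyBoundedVariationOn f s)
    {x y z : ℝ} (hx : x ∈ s) (hy : y ∈ s) (hz : z ∈ s) (hyz : y ≤ z) :
    ‖f z - f y‖ ≤ variationOnFromTo f s x z - variationOnFromTo f s x y := by
  rw [variationOnFromTo.sub_right hf hx hz hy, variationOnFromTo.eq_of_le _ _ hyz,
    ← dist_eq_norm, dist_edist]
  exact ENNReal.toReal_mono (hf y z hy hz)
    (eVariationOn.edist_le f ⟨hz, hyz, le_rfl⟩ ⟨hy, le_rfl, hyz⟩)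

theorem eVariationOn_le_measure_Ioc {Y : Type*} [PseudoEMetricSpace Y] {g : ℝ → Y}
    {μ : Measure ℝ} (hg : ∀ s t, a ≤ s → s ≤ t → t ≤ b → edist (g t) (g s) ≤ μ (Ioc s t)) :
    eVariationOn g (Icc a b) ≤ μ (Ioc a b) := by
  refine iSup_le fun ⟨n, u, hu, huab⟩ => ?_
  have hsum : ∀ n : ℕ, ∑ i ∈ Finset.range n, edist (g (u (i + 1))) (g (u i))
      ≤ μ (Ioc (u 0) (u n)) := by
    intro n
    induction n with
    | zero => simp
    | succ n ih =>
      rw [Finset.sum_range_succ, ← Ioc_union_Ioc_eq_Ioc (hu n.zero_le) (hu n.le_succ),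
        measure_union (Ioc_disjoint_Ioc_of_le le_rfl) measurableSet_Ioc]
      exact add_le_add ih (hg _ _ (huab n).1 (hu n.le_succ) (huab (n + 1)).2)
  exact (hsum n).trans (measure_mono (Ioc_subset_Ioc (huab 0).1 (huab n).2))

variable [FiniteDimensional ℝ F]

theorem ae_differentiableAt_of_lipschitzOnWith (hf : LipschitzOnWith C f (Icc a b)) :
    ∀ᵐ u : ℝ, u ∈ Ioc a b → DifferentiableAt ℝ f u := by
  filter_upwards [hf.ae_differentiableWithinAt_of_mem_real,
    (Ioo_ae_eq_Ioc (μ := volume) (a := a) (b := b)).mem_iff] with u hdiff hu huab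
  exact (hdiff (Ioc_subset_Icc_self huab)).differentiableAt
    (Icc_mem_nhds (hu.2 huab).1 (hu.2 huab).2)

theorem integrableOn_deriv_of_lipschitzOnWith (hf : LipschitzOnWith C f (Icc a b)) :
    IntegrableOn (deriv f) (Ioc a b) := by
  have : CompleteSpace F := FiniteDimensional.complete ℝ F
  exact Measure.integrableOn_of_bounded (by simp) (aestronglyMeasurable_deriv f _)
    ((ae_restrict_iff' measurableSet_Ioc).2 (ae_norm_deriv_le_of_lipschitzOnWith hf))

theorem integral_deriv_of_lipschitzOnWith (hab : a ≤ b) (hf : LipschitzOnWith C f (Icc a b)) :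
    ∫ u in a..b, deriv f u = f b - f a := by
  have : CompleteSpace F := FiniteDimensional.complete ℝ F
  have hint : IntervalIntegrable (deriv f) volume a b :=
    (intervalIntegrable_iff_integrableOn_Ioc_of_le hab).2 (integrableOn_deriv_of_lipschitzOnWith hf)
  have hprim := lipschitzOnWith_integral hint hab (ae_norm_deriv_le_of_lipschitzOnWith hf)
  rw [← uIcc_of_le hab] at hprim
  have hf' : LipschitzOnWith C f (uIcc a b) := uIcc_of_le hab ▸ hf
  obtain ⟨c, hc⟩ := (hf'.absolutelyContinuousOnInterval.sub
    hprim.absolutelyContinuousOnInterval).const_of_ae_hasDerivAt_zero (by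
      filter_upwards [hint.ae_hasDerivAt_integral, ae_differentiableAt_of_lipschitzOnWith hf,
        Measure.ae_ne volume a] with u hderiv hdiff hua hu
      have huab : u ∈ Icc a b := uIcc_of_le hab ▸ hu
      simpa using (hdiff ⟨huab.1.lt_of_ne' hua, huab.2⟩).hasDerivAt.sub
        (hderiv hu a left_mem_uIcc))
  have ha := hc a left_mem_uIcc
  have hb := hc b right_mem_uIcc
  simp only [Pi.sub_apply, intervalIntegral.integral_same, sub_zero] at ha hb
  rw [ha, ← hb, sub_sub_cancel]

theorem edist_le_lintegral_enorm_deriv (hab : a ≤ b) (hf : LipschitzOnWith C f (Icc a b)) :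
    edist (f b) (f a) ≤ ∫⁻ u in Ioc a b, ‖deriv f u‖ₑ := by
  rw [edist_eq_enorm_sub, ← integral_deriv_of_lipschitzOnWith hab hf,
    intervalIntegral.integral_of_le hab]
  exact enorm_integral_le_lintegral_enorm _

theorem eVariationOn_le_lintegral_enorm_deriv (hf : LipschitzOnWith C f (Icc a b)) :
    eVariationOn f (Icc a b) ≤ ∫⁻ u in Ioc a b, ‖deriv f u‖ₑ := by
  rw [← withDensity_apply _ measurableSet_Ioc]
  refine eVariationOn_le_measure_Ioc fun s t has hst htb => ?_
  rw [withDensity_apply _ measurableSet_Ioc]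
  exact edist_le_lintegral_enorm_deriv hst (hf.mono (Icc_subset_Icc has htb))

theorem ae_norm_deriv_le_deriv_variationOnFromTo (hf : LipschitzOnWith C f (Icc a b)) :
    ∀ᵐ u : ℝ, u ∈ Ioc a b → ‖deriv f u‖ ≤ deriv (variationOnFromTo f (Icc a b) a) u := by
  rcases lt_or_ge b a with hba | hab
  · simp [Ioc_eq_empty hba.not_gt]
  have hbv : LocallyBoundedVariationOn f (Icc a b) := hf.locallyBoundedVariationOn
  have ha : a ∈ Icc a b := left_mem_Icc.2 hab
  filter_upwards [ae_differentiableAt_of_lipschitzOnWith hf,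
    (Ioo_ae_eq_Ioc (μ := volume) (a := a) (b := b)).mem_iff,
    (variationOnFromTo.monotoneOn hbv ha).ae_differentiableWithinAt_of_mem] with u hdiff hu hV huab
  have hmem : u ∈ Icc a b := Ioc_subset_Icc_self huab
  have hnhds : Icc a b ∈ 𝓝 u := Icc_mem_nhds (hu.2 huab).1 (hu.2 huab).2
  refine norm_le_of_hasDerivAt_of_norm_sub_le (hdiff huab).hasDerivAt
    ((hV hmem).differentiableAt hnhds).hasDerivAt ?_
  filter_upwards [self_mem_nhdsWithin, mem_nhdsWithin_of_mem_nhds hnhds] with t hut ht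
  exact norm_sub_le_variationOnFromTo_sub hbv ha hmem ht (le_of_lt hut)

theorem lintegral_enorm_deriv_le_eVariationOn (hab : a ≤ b) (hf : LipschitzOnWith C f (Icc a b)) :
    ∫⁻ u in Ioc a b, ‖deriv f u‖ₑ ≤ eVariationOn f (Icc a b) := by
  have hbv : LocallyBoundedVariationOn f (Icc a b) := hf.locallyBoundedVariationOn
  have ha : a ∈ Icc a b := left_mem_Icc.2 hab
  have hb : b ∈ Icc a b := right_mem_Icc.2 hab
  set V := variationOnFromTo f (Icc a b) a with hV
  have hmono : MonotoneOn V (uIcc a b) := uIcc_of_le hab ▸ variationOnFromTo.monotoneOn hbv ha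
  have hVa : V a = 0 := variationOnFromTo.self _ _ _
  have hVb : 0 ≤ V b := hVa ▸ hmono left_mem_uIcc right_mem_uIcc hab
  have hderiv := (ae_restrict_iff' measurableSet_Ioc).2
    (ae_norm_deriv_le_deriv_variationOnFromTo hf)
  have hintegral : ∫ u in Ioc a b, deriv V u ≤ V b := by
    have hmem := hmono.intervalIntegral_deriv_mem_uIcc
    rw [hVa, sub_zero, uIcc_of_le hVb, intervalIntegral.integral_of_le hab] at hmem
    exact hmem.2
  calc ∫⁻ u in Ioc a b, ‖deriv f u‖ₑ ≤ ∫⁻ u in Ioc a b, ENNReal.ofReal (deriv V u) := by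
        refine lintegral_mono_ae (hderiv.mono fun u hu => ?_)
        rw [← ofReal_norm]
        exact ENNReal.ofReal_le_ofReal hu
    _ = ENNReal.ofReal (∫ u in Ioc a b, deriv V u) :=
        (ofReal_integral_eq_lintegral_ofReal ((intervalIntegrable_iff_integrableOn_Ioc_of_le
          hab).1 hmono.intervalIntegrable_deriv)
          (hderiv.mono fun u hu => (norm_nonneg _).trans hu)).symm
    _ ≤ ENNReal.ofReal (V b) := ENNReal.ofReal_le_ofReal hintegral
    _ = eVariationOn f (Icc a b) := by
        rw [hV, variationOnFromTo.eq_of_le _ _ hab, ENNReal.ofReal_toReal (hbv a b ha hb),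
          inter_self]

theorem lintegral_enorm_deriv_eq_eVariationOn (hab : a ≤ b)
    (hf : LipschitzOnWith C f (Icc a b)) :
    ∫⁻ u in Ioc a b, ‖deriv f u‖ₑ = eVariationOn f (Icc a b) :=
  (lintegral_enorm_deriv_le_eVariationOn hab hf).antisymm (eVariationOn_le_lintegral_enorm_deriv hf)

end Variation

/-- Lebesgue measure on `[0, ∞)`. -/
noncomputable def lebesgueNNReal : Measure ℝ≥0 := (volume : Measure ℝ).comap (↑)

theorem measurableEmbedding_coe_nnreal : MeasurableEmbedding ((↑) : ℝ≥0 → ℝ) :=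
  MeasurableEmbedding.subtype_coe measurableSet_Ici

theorem map_coe_lebesgueNNReal :
    lebesgueNNReal.map ((↑) : ℝ≥0 → ℝ) = volume.restrict (Ici 0) := by
  rw [lebesgueNNReal, measurableEmbedding_coe_nnreal.map_comap]
  exact congrArg _ Subtype.range_coe

theorem ae_lebesgueNNReal_of_ae {P : ℝ≥0 → Prop} (hP : ∀ᵐ u : ℝ, 0 < u → P u.toNNReal) :
    ∀ᵐ s ∂lebesgueNNReal, P s := by
  have hmap : ∀ᵐ u : ℝ ∂lebesgueNNReal.map (↑), P u.toNNReal := by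
    rw [map_coe_lebesgueNNReal, ae_restrict_iff' measurableSet_Ici]
    filter_upwards [hP, Measure.ae_ne volume 0] with u hu hu₀ hu_nonneg
    exact hu (lt_of_le_of_ne' hu_nonneg hu₀)
  filter_upwards [measurableEmbedding_coe_nnreal.ae_map_iff.1 hmap] with s hs
  rwa [Real.toNNReal_coe] at hs

theorem restrict_map_coe_lebesgueNNReal (t : ℝ≥0) :
    (lebesgueNNReal.restrict (Icc 0 t)).map ((↑) : ℝ≥0 → ℝ) = volume.restrict (Ioc 0 (t : ℝ)) := by
  have hpre : Icc 0 t = ((↑) : ℝ≥0 → ℝ) ⁻¹' Iic (t : ℝ) := by ext u; simp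
  rw [hpre, ← Measure.restrict_map measurableEmbedding_coe_nnreal.measurable measurableSet_Iic,
    map_coe_lebesgueNNReal, Measure.restrict_restrict measurableSet_Iic,
    inter_comm, Ici_inter_Iic, Measure.restrict_congr_set Ioc_ae_eq_Icc]

theorem setLIntegral_Icc_lebesgueNNReal (g : ℝ → ℝ≥0∞) (t : ℝ≥0) :
    ∫⁻ s in Icc 0 t, g s ∂lebesgueNNReal = ∫⁻ u in Ioc 0 (t : ℝ), g u := by
  rw [← restrict_map_coe_lebesgueNNReal, measurableEmbedding_coe_nnreal.lintegral_map]

theorem setIntegral_Icc_lebesgueNNReal {G : Type*} [NormedAddCommGroup G] [NormedSpace ℝ G]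
    (g : ℝ → G) (t : ℝ≥0) :
    ∫ s in Icc 0 t, g s ∂lebesgueNNReal = ∫ u in Ioc 0 (t : ℝ), g u := by
  rw [← restrict_map_coe_lebesgueNNReal, measurableEmbedding_coe_nnreal.integral_map]

section TotalVariation

variable {d : ℕ} {ℓ : Path (E d)}

theorem eVariationOn_comp_toNNReal {Y : Type*} [PseudoEMetricSpace Y] (g : ℝ≥0 → Y) (t : ℝ≥0) :
    eVariationOn (fun u : ℝ => g u.toNNReal) (Icc 0 (t : ℝ)) = eVariationOn g (Icc 0 t) := by
  have himage : Real.toNNReal '' Icc (0 : ℝ) t = Icc 0 t := by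
    refine Subset.antisymm ?_ fun s hs => ⟨s, ⟨s.2, NNReal.coe_le_coe.2 hs.2⟩, Real.toNNReal_coe⟩
    rintro _ ⟨u, hu, rfl⟩
    exact ⟨zero_le, Real.toNNReal_le_iff_le_coe.2 hu.2⟩
  rw [← himage]
  exact eVariationOn.comp_eq_of_monotoneOn g Real.toNNReal fun _ _ _ _ huv => Real.toNNReal_mono huv

/-- The speed measure `|ℓ'| dt` of a path, which is its total variation measure as soon as the path
is locally Lipschitz. -/
noncomputable def speedMeasure (ℓ : Path (E d)) : Measure ℝ≥0 :=
  lebesgueNNReal.withDensity fun s => ‖deriv (fun u : ℝ => ℓ u.toNNReal) s‖₊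

/-- The direction `ℓ' / |ℓ'|` of a path (with value `0` where the derivative vanishes). -/
noncomputable def direction (ℓ : Path (E d)) (s : ℝ≥0) : E d :=
  ‖deriv (fun u : ℝ => ℓ u.toNNReal) s‖⁻¹ • deriv (fun u : ℝ => ℓ u.toNNReal) s

theorem measurable_deriv_coe (ℓ : Path (E d)) :
    Measurable fun s : ℝ≥0 => deriv (fun u : ℝ => ℓ u.toNNReal) s :=
  (measurable_deriv _).comp NNReal.continuous_coe.measurable

theorem measurable_direction (ℓ : Path (E d)) : Measurable (direction ℓ) :=
  (measurable_deriv_coe ℓ).norm.inv.smul (measurable_deriv_coe ℓ)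

theorem lipschitzOnWith_comp_toNNReal {C T : ℝ≥0} (hℓ : LipschitzOnWith C ℓ (Iic T)) :
    LipschitzOnWith C (fun u : ℝ => ℓ u.toNNReal) (Icc 0 (T : ℝ)) := by
  rw [← mul_one C]
  exact hℓ.comp Real.lipschitzWith_toNNReal.lipschitzOnWith
    fun u hu => Real.toNNReal_le_iff_le_coe.2 hu.2

theorem isTotalVariationMeasure_speedMeasure
    (hℓ : ∀ T : ℝ≥0, ∃ C : ℝ≥0, LipschitzOnWith C ℓ (Iic T)) :
    IsTotalVariationMeasure ℓ (speedMeasure ℓ) := by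
  intro t
  obtain ⟨C, hC⟩ := hℓ t
  rw [speedMeasure, withDensity_apply _ measurableSet_Icc, ← eVariationOn_comp_toNNReal,
    ← lintegral_enorm_deriv_eq_eVariationOn t.coe_nonneg (lipschitzOnWith_comp_toNNReal hC)]
  exact setLIntegral_Icc_lebesgueNNReal (fun u => ‖deriv (fun u : ℝ => ℓ u.toNNReal) u‖ₑ) t

theorem locallyBoundedVariationOn_univ (hℓ : ∀ T : ℝ≥0, ∃ C : ℝ≥0, LipschitzOnWith C ℓ (Iic T)) :
    LocallyBoundedVariationOn ℓ univ := by
  intro s t _ _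
  obtain ⟨C, hC⟩ := hℓ t
  refine ne_top_of_le_ne_top ?_ (eVariationOn.mono ℓ fun u hu => ⟨zero_le, hu.2.2⟩ :
    eVariationOn ℓ (univ ∩ Icc s t) ≤ eVariationOn ℓ (Icc 0 t))
  rw [← eVariationOn_comp_toNNReal, ← lintegral_enorm_deriv_eq_eVariationOn t.coe_nonneg
    (lipschitzOnWith_comp_toNNReal hC)]
  exact (integrableOn_deriv_of_lipschitzOnWith (lipschitzOnWith_comp_toNNReal hC)).2.ne

theorem ae_speedMeasure_of_ae_deriv {P : ℝ≥0 → E d → Prop}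
    (hP : ∀ᵐ u : ℝ, 0 < u → deriv (fun u : ℝ => ℓ u.toNNReal) u ≠ 0 → P u.toNNReal
      (‖deriv (fun u : ℝ => ℓ u.toNNReal) u‖⁻¹ • deriv (fun u : ℝ => ℓ u.toNNReal) u)) :
    ∀ᵐ s ∂speedMeasure ℓ, P s (direction ℓ s) := by
  rw [speedMeasure, ae_withDensity_iff (measurable_deriv_coe ℓ).nnnorm.coe_nnreal_ennreal]
  refine ae_lebesgueNNReal_of_ae ?_
  filter_upwards [hP] with u hu hu_pos hne
  rw [Real.coe_toNNReal u hu_pos.le] at hne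
  rw [direction, Real.coe_toNNReal u hu_pos.le]
  exact hu hu_pos (by simpa using hne)

theorem eq_integral_direction (hℓ₀ : ℓ 0 = 0)
    (hℓ : ∀ T : ℝ≥0, ∃ C : ℝ≥0, LipschitzOnWith C ℓ (Iic T)) (t : ℝ≥0) :
    ℓ t = ∫ s in Icc 0 t, direction ℓ s ∂speedMeasure ℓ := by
  obtain ⟨C, hC⟩ := hℓ t
  have hFTC := integral_deriv_of_lipschitzOnWith t.coe_nonneg (lipschitzOnWith_comp_toNNReal hC)
  rw [Real.toNNReal_coe, Real.toNNReal_zero, hℓ₀, sub_zero,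
    intervalIntegral.integral_of_le t.coe_nonneg] at hFTC
  rw [speedMeasure, setIntegral_withDensity_eq_setIntegral_smul (measurable_deriv_coe ℓ).nnnorm _
    measurableSet_Icc, ← hFTC, ← setIntegral_Icc_lebesgueNNReal]
  refine integral_congr_ae (ae_of_all _ fun s => ?_)
  change _ = ‖deriv (fun u : ℝ => ℓ u.toNNReal) s‖ • direction ℓ s
  rcases eq_or_ne (deriv (fun u : ℝ => ℓ u.toNNReal) s) 0 with hs | hs
  · simp [hs]
  · rw [direction, smul_inv_smul₀ (norm_ne_zero_iff.2 hs)]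

end TotalVariation

section Existence

variable {d r : ℕ} {O : Set (E d)} {σ : closure O → E r →L[ℝ] E d} {b : closure O → E d}
  {A : ℝ≥0}

theorem dist_nnreal_of_le {s t : ℝ≥0} (hst : s ≤ t) : dist s t = (t : ℝ) - s := by
  rw [dist_comm, NNReal.dist_eq, abs_of_nonneg (sub_nonneg.2 (NNReal.coe_le_coe.2 hst))]

theorem lipschitzOnWith_of_dist_le_mul_of_le {Y : Type*} [PseudoMetricSpace Y] {g : ℝ≥0 → Y}
    {K : ℝ≥0} {S : Set ℝ≥0}
    (hle : ∀ s ∈ S, ∀ t ∈ S, s ≤ t → dist (g s) (g t) ≤ K * ((t : ℝ) - s)) :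
    LipschitzOnWith K g S := by
  refine LipschitzOnWith.of_dist_le_mul fun s hs t ht => ?_
  rcases le_total s t with hst | hts
  · exact dist_nnreal_of_le hst ▸ hle s hs t ht hst
  · rw [dist_comm, dist_comm s, dist_nnreal_of_le hts]
    exact hle t ht s hs hts

theorem lipschitzOnWith_Iic_of_Iic_of_Icc {Y : Type*} [PseudoMetricSpace Y] {g : ℝ≥0 → Y}
    {K K' c c' : ℝ≥0} (hc : LipschitzOnWith K g (Iic c)) (hcc' : LipschitzOnWith K' g (Icc c c')) :
    LipschitzOnWith (K + K') g (Iic c') := by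
  refine lipschitzOnWith_of_dist_le_mul_of_le fun s _ t ht hst => ?_
  push_cast
  rcases le_total t c with htc | hct
  · have hdist := hc.dist_le_mul s (hst.trans htc) t htc
    rw [dist_nnreal_of_le hst] at hdist
    nlinarith [K'.coe_nonneg, NNReal.coe_le_coe.2 hst]
  rcases le_total c s with hcs | hsc
  · have hdist := hcc'.dist_le_mul s ⟨hcs, hst.trans ht⟩ t ⟨hct, ht⟩
    rw [dist_nnreal_of_le hst] at hdist
    nlinarith [K.coe_nonneg, NNReal.coe_le_coe.2 hst]
  · have hleft := hc.dist_le_mul s hsc c (mem_Iic.2 le_rfl)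
    have hright := hcc'.dist_le_mul c ⟨le_rfl, hct.trans ht⟩ t ⟨hct, ht⟩
    rw [dist_nnreal_of_le hsc] at hleft
    rw [dist_nnreal_of_le hct] at hright
    nlinarith [dist_triangle (g s) (g c) (g t), K.coe_nonneg, K'.coe_nonneg,
      NNReal.coe_le_coe.2 hsc, NNReal.coe_le_coe.2 hct]

theorem lipschitzOnWith_solL_Icc (h : IsControlled O σ b A) (N : ℕ) (x₀ : closure O)
    (w : Path (E r)) (m : ℕ) :
    LipschitzOnWith (3 * (A * (‖velocity N w m‖₊ + 1))) (solL h N x₀ w)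
      (Icc (m * mesh N) ((m + 1 : ℕ) * mesh N)) := by
  refine lipschitzOnWith_of_dist_le_mul_of_le fun s hs t ht hst => ?_
  rw [dist_comm, dist_eq_norm, solL_eq h N x₀ w m ht.1 ht.2, solL_eq h N x₀ w m hs.1 hs.2,
    add_sub_add_left_eq_sub]
  refine (norm_push_sub_push_le h _ _ (tsub_le_tsub_right hst _)).trans_eq ?_
  rw [NNReal.coe_sub ht.1, NNReal.coe_sub hs.1, sub_sub_sub_cancel_right]
  simp

theorem exists_lipschitzOnWith_solL (h : IsControlled O σ b A) (N : ℕ) (x₀ : closure O)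
    (w : Path (E r)) (T : ℝ≥0) : ∃ C : ℝ≥0, LipschitzOnWith C (solL h N x₀ w) (Iic T) := by
  have hnode : ∀ m : ℕ, ∃ C : ℝ≥0, LipschitzOnWith C (solL h N x₀ w) (Iic (m * mesh N)) := by
    intro m
    induction m with
    | zero =>
      refine ⟨0, LipschitzOnWith.of_dist_le_mul fun s hs t ht => ?_⟩
      rw [Nat.cast_zero, zero_mul, mem_Iic, le_zero_iff] at hs ht
      simp [hs, ht]
    | succ m ih =>
      obtain ⟨C, hC⟩ := ih
      exact ⟨_, lipschitzOnWith_Iic_of_Iic_of_Icc hC (lipschitzOnWith_solL_Icc h N x₀ w m)⟩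
  obtain ⟨m, -, hTm⟩ := exists_nat_mul_le_le (mesh_pos N) T
  obtain ⟨C, hC⟩ := hnode (m + 1)
  exact ⟨C, hC.mono (Iic_subset_Iic.2 hTm)⟩

theorem ae_differentiableAt_solL (h : IsControlled O σ b A) (N : ℕ) (x₀ : closure O)
    (w : Path (E r)) :
    ∀ᵐ u : ℝ, 0 < u → DifferentiableAt ℝ (fun u : ℝ => solL h N x₀ w u.toNNReal) u := by
  have hT : ∀ T : ℕ, ∀ᵐ u : ℝ, u ∈ Ioc (0 : ℝ) (T : ℝ≥0) →
      DifferentiableAt ℝ (fun u : ℝ => solL h N x₀ w u.toNNReal) u := fun T => by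
    obtain ⟨C, hC⟩ := exists_lipschitzOnWith_solL h N x₀ w T
    exact ae_differentiableAt_of_lipschitzOnWith (lipschitzOnWith_comp_toNNReal hC)
  filter_upwards [ae_all_iff.2 hT] with u hu hu_pos
  obtain ⟨T, huT⟩ := exists_nat_ge u
  exact hu T ⟨hu_pos, by exact_mod_cast huT⟩

theorem hasDerivAt_push_of_hasDerivAt_solL (h : IsControlled O σ b A) (N : ℕ) (x₀ : closure O)
    (w : Path (E r)) {m : ℕ} {t : ℝ≥0} (hmt : m * mesh N < t) (htm : t < (m + 1 : ℕ) * mesh N)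
    {l : E d} (hl : HasDerivAt (fun u : ℝ => solL h N x₀ w u.toNNReal) l t) :
    HasDerivAt (fun u : ℝ => push h (velocity N w m) (solX h N x₀ w (m * mesh N)) u.toNNReal) l
      ((t - m * mesh N : ℝ≥0) : ℝ) := by
  set s : ℝ≥0 := m * mesh N with hs
  have htN : t < s + mesh N := by rwa [hs, ← add_one_mul, ← Nat.cast_add_one]
  have hcoe : ((t - s : ℝ≥0) : ℝ) = t - s := NNReal.coe_sub hmt.le
  rw [← sub_add_cancel (t : ℝ) s, ← hcoe] at hl
  refine ((hl.comp_add_const _ _).sub_const (solL h N x₀ w s)).congr_of_eventuallyEq ?_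
  have hpos : (0 : ℝ) < (t - s : ℝ≥0) := NNReal.coe_pos.2 (tsub_pos_of_lt hmt)
  have hlt : ((t - s : ℝ≥0) : ℝ) < mesh N :=
    NNReal.coe_lt_coe.2 (tsub_lt_iff_left hmt.le |>.2 htN)
  filter_upwards [Ioo_mem_nhds hpos hlt] with u hu
  have hu_mesh : u.toNNReal + s ≤ (m + 1 : ℕ) * mesh N := by
    rw [Nat.cast_add_one, add_one_mul, add_comm]
    gcongr
    exact Real.toNNReal_le_iff_le_coe.2 hu.2.le
  rw [Real.toNNReal_add hu.1.le s.coe_nonneg, Real.toNNReal_coe,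
    solL_eq h N x₀ w m le_add_self hu_mesh, ← hs, add_tsub_cancel_right, add_sub_cancel_left]

theorem mem_frontier_and_mem_inwardNormals_of_hasDerivAt_solL (h : IsControlled O σ b A) (N : ℕ)
    (x₀ : closure O) (w : Path (E r)) {t : ℝ≥0} (ht : ∀ m : ℕ, t ≠ m * mesh N) {l : E d}
    (hl : HasDerivAt (fun u : ℝ => solL h N x₀ w u.toNNReal) l t) (hl₀ : l ≠ 0) :
    (solX h N x₀ w t : E d) ∈ frontier O ∧ ‖l‖⁻¹ • l ∈ inwardNormals O (solX h N x₀ w t) := by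
  obtain ⟨m, hmt, htm⟩ := exists_nat_mul_le_le (mesh_pos N) t
  have hmt' : m * mesh N < t := lt_of_le_of_ne' hmt (ht m)
  have htm' : t < (m + 1 : ℕ) * mesh N := lt_of_le_of_ne htm (ht (m + 1))
  rw [solX_eq h N x₀ w m hmt htm]
  exact mem_frontier_and_mem_inwardNormals_of_hasDerivAt_push h (tsub_pos_of_lt hmt')
    (hasDerivAt_push_of_hasDerivAt_solL h N x₀ w hmt' htm' hl) hl₀

theorem isReflectedSolution_sol (h : IsControlled O σ b A) (N : ℕ) (x₀ : closure O)
    (w : Path (E r)) :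
    IsReflectedSolution O σ b x₀ (dyadicInterp N w) (solX h N x₀ w) (solL h N x₀ w) := by
  have hlip := exists_lipschitzOnWith_solL h N x₀ w
  have hdir : ∀ᵐ s ∂speedMeasure (solL h N x₀ w), (solX h N x₀ w s : E d) ∈ frontier O ∧
      direction (solL h N x₀ w) s ∈ inwardNormals O (solX h N x₀ w s) := by
    refine ae_speedMeasure_of_ae_deriv (P := fun s v => (solX h N x₀ w s : E d) ∈ frontier O ∧
      v ∈ inwardNormals O (solX h N x₀ w s)) ?_
    filter_upwards [ae_differentiableAt_solL h N x₀ w,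
      ae_all_iff.2 fun m : ℕ => Measure.ae_ne volume ((m * mesh N : ℝ≥0) : ℝ)]
      with u hdiff hgrid hu hne
    lift u to ℝ≥0 using hu.le
    rw [Real.toNNReal_coe]
    exact mem_frontier_and_mem_inwardNormals_of_hasDerivAt_solL h N x₀ w
      (fun m hm => hgrid m (congrArg _ hm)) (hdiff hu).hasDerivAt hne
  exact
    { locallyBoundedVariation := locallyBoundedVariationOn_univ hlip
      equation := solX_eq_add_solL h N x₀ w
      reflection := ⟨speedMeasure (solL h N x₀ w), isTotalVariationMeasure_speedMeasure hlip,
        hdir.mono fun _ hs => hs.1, direction (solL h N x₀ w), measurable_direction _,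
        hdir.mono fun _ hs => hs.2, eq_integral_direction (solL_zero h N x₀ w) hlip⟩ }

end Existence

/-! ### Oscillation of reflected paths -/

section ShortIntervals

variable {s t : ℝ≥0}

/-- `P u v` holds for all sufficiently short subintervals `[u, v]` of `[s, t]`. -/
def OnShortIntervals (s t : ℝ≥0) (P : ℝ≥0 → ℝ≥0 → Prop) : Prop :=
  ∀ᶠ δ : ℝ≥0 in 𝓝[>] 0, ∀ u v, s ≤ u → u ≤ v → v ≤ t → v ≤ u + δ → P u v

theorem le_of_onShortIntervals_le (hst : s ≤ t) {f : ℝ≥0 → ℝ}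
    (hf : OnShortIntervals s t fun u v => f v ≤ f u) : f t ≤ f s := by
  obtain ⟨δ, hle, hδ : 0 < δ⟩ := (Eventually.and hf self_mem_nhdsWithin).exists
  have hiter : ∀ (k : ℕ) (v : ℝ≥0), s ≤ v → v ≤ t → v ≤ s + k * δ → f v ≤ f s := by
    intro k
    induction k with
    | zero => exact fun v hsv _ hv => (le_antisymm (by simpa using hv) hsv) ▸ le_rfl
    | succ k ih =>
      intro v hsv hvt hv
      have hu : max s (v - δ) ≤ v := max_le hsv tsub_le_self
      refine (hle _ v (le_max_left _ _) hu hvt ?_).trans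
        (ih _ (le_max_left _ _) (hu.trans hvt) (max_le le_self_add ?_))
      · exact tsub_le_iff_right.1 (le_max_right _ _)
      · rw [tsub_le_iff_right]
        exact hv.trans_eq (by push_cast; ring)
  obtain ⟨k, hk⟩ := exists_nat_ge (t / δ)
  exact hiter k t hst le_rfl (((div_le_iff₀ hδ).1 hk).trans le_add_self)

theorem le_of_forall_onShortIntervals_sub_le (hst : s ≤ t) {g a : ℝ≥0 → ℝ}
    (h : ∀ ε > 0, OnShortIntervals s t fun u v => g v - g u ≤ ε * (a v - a u)) : g t ≤ g s := by
  have hε : ∀ ε > 0, g t - g s ≤ ε * (a t - a s) := fun ε hε => by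
    have hle : g t - ε * a t ≤ g s - ε * a s := by
      refine le_of_onShortIntervals_le (f := fun u => g u - ε * a u) hst ?_
      filter_upwards [h ε hε] with δ hδ u v hsu huv hvt huvδ
      linarith [hδ u v hsu huv hvt huvδ]
    linarith
  have hlim : Tendsto (fun ε : ℝ => ε * (a t - a s)) (𝓝[>] 0) (𝓝 0) := by
    simpa using ((continuous_mul_const (a t - a s)).tendsto 0).mono_left nhdsWithin_le_nhds
  exact sub_nonpos.1 (ge_of_tendsto hlim (eventually_nhdsWithin_of_forall hε))

theorem onShortIntervals_norm_sub_le {F : Type*} [SeminormedAddCommGroup F] {Z : ℝ≥0 → F}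
    (hZ : Continuous Z) (s t : ℝ≥0) {ε : ℝ} (hε : 0 < ε) :
    OnShortIntervals s t fun u v => ∀ y ∈ Ioc u v, ‖Z v - Z y‖ ≤ ε := by
  obtain ⟨δ, hδ, hdist⟩ := Metric.uniformContinuousOn_iff.1
    (isCompact_Icc.uniformContinuousOn_of_continuous (s := Icc s t) hZ.continuousOn) ε hε
  filter_upwards [Ioo_mem_nhdsGT (Real.toNNReal_pos.2 hδ)] with η hη u v hsu huv hvt huvη y hy
  rw [← dist_eq_norm]
  refine (hdist v ⟨hsu.trans huv, hvt⟩ y ⟨hsu.trans hy.1.le, hy.2.trans hvt⟩ ?_).le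
  rw [dist_comm, dist_nnreal_of_le hy.2, sub_lt_iff_lt_add']
  have hv : v < y + δ.toNNReal := (huvη.trans (add_le_add_left hy.1.le η)).trans_lt
    (add_lt_add_right hη.2 y)
  have hv' := NNReal.coe_lt_coe.2 hv
  rwa [NNReal.coe_add, Real.coe_toNNReal δ hδ.le] at hv'

theorem le_of_le_of_bootstrap {φ : ℝ≥0 → ℝ} (hφ : Continuous φ) {c D : ℝ} (hcD : c < D)
    (hs : φ s ≤ c) (hboot : ∀ τ ∈ Icc s t, (∀ u ∈ Icc s τ, φ u ≤ D) → φ τ ≤ c) :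
    ∀ τ ∈ Icc s t, φ τ ≤ c := by
  have hlt : ∀ u ∈ Icc s t, φ u < D := by
    by_contra! hex
    obtain ⟨u, hu, hDu⟩ := hex
    obtain ⟨τ, ⟨hτ, hDτ⟩, hleast⟩ := (isCompact_Icc.inter_right
      (isClosed_Ici.preimage hφ)).exists_isLeast ⟨u, hu, hDu⟩
    have hsτ : s ≠ τ := by
      rintro rfl
      exact (hs.trans_lt hcD).not_ge hDτ
    have hbefore : Ico s τ ⊆ {u | φ u ≤ D} := fun u hu => by
      by_contra hlt
      have hDu : D ≤ φ u := (not_le.1 hlt).le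
      exact hu.2.not_ge (hleast ⟨⟨hu.1, hu.2.le.trans hτ.2⟩, hDu⟩)
    have hup := closure_minimal hbefore (isClosed_le hφ continuous_const)
    rw [closure_Ico hsτ] at hup
    exact ((hboot τ hτ hup).trans_lt hcD).not_ge hDτ
  exact fun τ hτ => hboot τ hτ fun u hu => (hlt u ⟨hu.1, hu.2.trans hτ.2⟩).le

end ShortIntervals

theorem norm_sq_sub_norm_sq_le {F : Type*} [NormedAddCommGroup F] [InnerProductSpace ℝ F]
    (x y : F) : ‖x‖ ^ 2 - ‖y‖ ^ 2 ≤ 2 * inner ℝ x (x - y) := by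
  have hexpand := norm_sub_sq_real x y
  rw [inner_sub_right, real_inner_self_eq_norm_sq]
  nlinarith [sq_nonneg ‖x - y‖]

section Reflection

variable {d : ℕ} {O : Set (E d)}

/-- `ℓ` is a reflection term for the path `x` with the total variation measure `μ` and the
direction `n`. -/
structure IsReflection (O : Set (E d)) (x : Path (closure O)) (ℓ : Path (E d)) (μ : Measure ℝ≥0)
    (n : ℝ≥0 → E d) : Prop where
  finite : ∀ t, μ (Icc 0 t) ≠ ∞
  measurable : Measurable n
  mem_frontier : ∀ᵐ s ∂μ, (x s : E d) ∈ frontier O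
  mem_inwardNormals : ∀ᵐ s ∂μ, n s ∈ inwardNormals O (x s)
  measure_zero : μ {0} = 0
  eq_integral : ∀ t : ℝ≥0, ℓ t = ∫ s in Icc 0 t, n s ∂μ

theorem IsReflectedSolution.exists_isReflection {r : ℕ} {σ : closure O → E r →L[ℝ] E d}
    {b : closure O → E d} {x₀ : closure O} {w : Path (E r)} {x : Path (closure O)} {ℓ : Path (E d)}
    (hx : IsReflectedSolution O σ b x₀ w x ℓ) : ∃ μ n, IsReflection O x ℓ μ n := by
  obtain ⟨μ, hμ, hfrontier, n, hn, hnormals, heq⟩ := hx.reflection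
  refine ⟨μ, n, fun t => ?_, hn, hfrontier, hnormals, ?_, heq⟩
  · rw [hμ t, ← univ_inter (Icc 0 t)]
    exact hx.locallyBoundedVariation 0 t (mem_univ _) (mem_univ _)
  · rw [← Icc_self, hμ 0, Icc_self, eVariationOn.subsingleton _ subsingleton_singleton]

namespace IsReflection

variable {x x' : Path (closure O)} {ℓ ℓ' : Path (E d)} {μ μ' : Measure ℝ≥0} {n n' : ℝ≥0 → E d}
  {C₀ : ℝ≥0} {s t : ℝ≥0}

theorem zero (h : IsReflection O x ℓ μ n) : ℓ 0 = 0 := by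
  rw [h.eq_integral, Icc_self, Measure.restrict_zero_set h.measure_zero, integral_zero_measure]

theorem integrableOn (h : IsReflection O x ℓ μ n) (t : ℝ≥0) : IntegrableOn n (Icc 0 t) μ := by
  refine Measure.integrableOn_of_bounded (M := 1) (h.finite t)
    h.measurable.aestronglyMeasurable ?_
  filter_upwards [ae_restrict_of_ae h.mem_inwardNormals] with s hs using hs.1.le

theorem integrableOn_Ioc (h : IsReflection O x ℓ μ n) (s t : ℝ≥0) : IntegrableOn n (Ioc s t) μ :=
  (h.integrableOn t).mono_set fun _ hu => ⟨zero_le, hu.2⟩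

theorem sub_eq (h : IsReflection O x ℓ μ n) (hst : s ≤ t) :
    ℓ t - ℓ s = ∫ u in Ioc s t, n u ∂μ := by
  rw [h.eq_integral, h.eq_integral, ← Icc_union_Ioc_eq_Icc (zero_le (a := s)) hst,
    setIntegral_union ((Iic_disjoint_Ioc le_rfl).mono_left Icc_subset_Iic_self) measurableSet_Ioc
      (h.integrableOn s) (h.integrableOn_Ioc s t), add_sub_cancel_left]

theorem finite_Ioc (h : IsReflection O x ℓ μ n) (s t : ℝ≥0) : μ (Ioc s t) ≠ ∞ :=
  ne_top_of_le_ne_top (h.finite t) (measure_mono fun _ hu => ⟨zero_le, hu.2⟩)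

theorem measureReal_add (h : IsReflection O x ℓ μ n) {u : ℝ≥0} (hsu : s ≤ u) (hut : u ≤ t) :
    μ.real (Ioc s t) = μ.real (Ioc s u) + μ.real (Ioc u t) := by
  rw [← Ioc_union_Ioc_eq_Ioc hsu hut, measureReal_union (Ioc_disjoint_Ioc_of_le le_rfl)
    measurableSet_Ioc (h.finite_Ioc s u) (h.finite_Ioc u t)]

theorem tendsto_measureReal_Ioc (h : IsReflection O x ℓ μ n) (s : ℝ≥0) :
    Tendsto (fun t => μ.real (Ioc s t)) (𝓝[>] s) (𝓝 0) := by
  have hempty : ⋂ t > s, Ioc s t = ∅ := by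
    refine eq_empty_of_forall_notMem fun u hu => ?_
    have hle : ∀ t > s, u ∈ Ioc s t := fun t ht => mem_iInter₂.1 hu t ht
    exact (hle (s + 1) (by simp)).1.not_ge
      (le_of_forall_gt_imp_ge_of_dense fun t ht => (hle t ht).2)
  have hlim := tendsto_measure_biInter_gt (μ := μ) (s := fun t => Ioc s t) (a := s)
    (fun t _ => measurableSet_Ioc.nullMeasurableSet) (fun _ _ _ hij => Ioc_subset_Ioc_right hij)
    ⟨s + 1, by simp, h.finite_Ioc _ _⟩
  rw [hempty, measure_empty] at hlim
  exact (ENNReal.tendsto_toReal ENNReal.zero_ne_top).comp hlim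

theorem inner_sub_le (h : IsReflection O x ℓ μ n) (hst : s ≤ t) {c : E d} {κ : ℝ}
    (hκ : ∀ᵐ u ∂μ, u ∈ Ioc s t → inner ℝ c (n u) ≤ κ) :
    inner ℝ c (ℓ t - ℓ s) ≤ κ * μ.real (Ioc s t) := by
  rw [h.sub_eq hst, ← integral_inner (h.integrableOn_Ioc s t), mul_comm, ← smul_eq_mul,
    ← setIntegral_const]
  exact setIntegral_mono_on_ae ((h.integrableOn_Ioc s t).const_inner c)
    (integrableOn_const (h.finite_Ioc s t)) measurableSet_Ioc hκ

theorem onShortIntervals_inner_sub_le (h : IsReflection O x ℓ μ n) {Z : ℝ≥0 → E d}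
    (hZ : Continuous Z) {κ ε : ℝ} (hε : 0 < ε)
    (hκ : ∀ᵐ u ∂μ, u ∈ Ioc s t → inner ℝ (Z u) (n u) ≤ κ) :
    OnShortIntervals s t fun u v => inner ℝ (Z v) (ℓ v - ℓ u) ≤ (κ + ε) * μ.real (Ioc u v) := by
  filter_upwards [onShortIntervals_norm_sub_le hZ s t hε] with δ hδ u v hsu huv hvt huvδ
  refine h.inner_sub_le huv ?_
  filter_upwards [hκ, h.mem_inwardNormals] with y hy hn hyuv
  have hdiff : inner ℝ (Z v - Z y) (n y) ≤ ε :=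
    (real_inner_le_norm _ _).trans (by rw [hn.1, mul_one]; exact hδ u v hsu huv hvt huvδ y hyuv)
  rw [inner_sub_left] at hdiff
  linarith [hy ⟨hsu.trans_lt hyuv.1, hyuv.2.trans hvt⟩]

theorem norm_sub_sq_le_of_inner_le (h : IsReflection O x ℓ μ n) (hst : s ≤ t) {κ : ℝ}
    (hκ : ∀ᵐ u ∂μ, u ∈ Ioc s t → inner ℝ (ℓ u - ℓ s) (n u) ≤ κ) :
    ‖ℓ t - ℓ s‖ ^ 2 ≤ 2 * κ * μ.real (Ioc s t) := by
  have hle := le_of_forall_onShortIntervals_sub_le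
    (g := fun u => ‖ℓ u - ℓ s‖ ^ 2 - 2 * κ * μ.real (Ioc s u))
    (a := fun u => 2 * μ.real (Ioc s u)) hst fun ε hε => ?_
  · simp only [sub_self, norm_zero, Ioc_self, measureReal_empty, mul_zero] at hle
    linarith
  · filter_upwards [h.onShortIntervals_inner_sub_le (by fun_prop) hε hκ] with δ hδ u v hsu huv hvt
      huvδ
    have hsq := norm_sq_sub_norm_sq_le (ℓ v - ℓ s) (ℓ u - ℓ s)
    rw [sub_sub_sub_cancel_right] at hsq
    simp only [h.measureReal_add hsu huv]
    linarith [hδ u v hsu huv hvt huvδ]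

theorem ae_inner_sub_le (h : IsReflection O x ℓ μ n) (hball : HasUniformExteriorBall O C₀) :
    ∀ᵐ u ∂μ, ∀ z ∈ closure O, inner ℝ ((x u : E d) - z) (n u) ≤ C₀ * ‖(x u : E d) - z‖ ^ 2 := by
  filter_upwards [h.mem_frontier, h.mem_inwardNormals] with u hu hn z hz
  have hnormal := hball _ hu _ hn z hz
  rw [← neg_sub, inner_neg_left, norm_neg] at hnormal
  linarith

theorem norm_sub_sq_le (h : IsReflection O x ℓ μ n) (hball : HasUniformExteriorBall O C₀)
    (hst : s ≤ t) {D ω : ℝ} (hD : ∀ u ∈ Icc s t, ‖(x u : E d) - x s‖ ≤ D)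
    (hω : ∀ u ∈ Icc s t, ‖((x u : E d) - ℓ u) - (x s - ℓ s)‖ ≤ ω) :
    ‖ℓ t - ℓ s‖ ^ 2 ≤ 2 * (C₀ * D ^ 2 + ω) * μ.real (Ioc s t) := by
  refine h.norm_sub_sq_le_of_inner_le hst ?_
  filter_upwards [h.ae_inner_sub_le hball, h.mem_inwardNormals] with u hu hn hus
  have husc := Ioc_subset_Icc_self hus
  have hx : C₀ * ‖(x u : E d) - x s‖ ^ 2 ≤ C₀ * D ^ 2 := by gcongr; exact hD u husc
  have hfree : -inner ℝ (((x u : E d) - ℓ u) - (x s - ℓ s)) (n u) ≤ ω := by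
    rw [← inner_neg_left]
    refine (real_inner_le_norm _ _).trans ?_
    rw [hn.1, mul_one, norm_neg]
    exact hω u husc
  have hsplit : ℓ u - ℓ s = ((x u : E d) - x s) - (((x u : E d) - ℓ u) - (x s - ℓ s)) := by abel
  rw [hsplit, inner_sub_left]
  linarith [hu (x s) (x s).2]

theorem mul_measureReal_le (h : IsReflection O x ℓ μ n) {δ R : ℝ}
    (hcone : HasUniformNormalCones O δ R) (hst : s ≤ t)
    (hx : ∀ u ∈ Icc s t, ‖(x u : E d) - x s‖ < R / 2) :
    δ * μ.real (Ioc s t) ≤ ‖ℓ t - ℓ s‖ := by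
  by_cases hhit : ∃ u ∈ Icc s t, (x u : E d) ∈ frontier O
  · obtain ⟨u₀, hu₀, hu₀O⟩ := hhit
    obtain ⟨a, ha, hnormals⟩ := hcone _ hu₀O
    have hpush : inner ℝ (-a) (ℓ t - ℓ s) ≤ -δ * μ.real (Ioc s t) := by
      refine h.inner_sub_le hst ?_
      filter_upwards [h.mem_frontier, h.mem_inwardNormals] with u hu hn hus
      rw [inner_neg_left, real_inner_comm, neg_le_neg_iff]
      refine hnormals (x u) ⟨hu, ?_⟩ _ hn
      rw [Metric.mem_ball, dist_eq_norm, ← sub_sub_sub_cancel_right _ _ (x s : E d)]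
      linarith [norm_sub_le ((x u : E d) - x s) (x u₀ - x s), hx u (Ioc_subset_Icc_self hus),
        hx u₀ hu₀]
    have hnorm := real_inner_le_norm a (ℓ t - ℓ s)
    rw [ha, one_mul] at hnorm
    rw [inner_neg_left] at hpush
    linarith
  · have hnull : μ (Ioc s t) = 0 := measure_mono_null
      (fun u hu hu' => hhit ⟨u, Ioc_subset_Icc_self hu, hu'⟩) (ae_iff.1 h.mem_frontier)
    rw [measureReal_def, hnull, ENNReal.toReal_zero, mul_zero]
    positivity

theorem mul_norm_sub_le (h : IsReflection O x ℓ μ n) (hball : HasUniformExteriorBall O C₀)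
    {δ R : ℝ} (hcone : HasUniformNormalCones O δ R) (hδ : 0 ≤ δ) (hst : s ≤ t) {D ω : ℝ}
    (hDR : D < R / 2) (hD : ∀ u ∈ Icc s t, ‖(x u : E d) - x s‖ ≤ D)
    (hω : ∀ u ∈ Icc s t, ‖((x u : E d) - ℓ u) - (x s - ℓ s)‖ ≤ ω) :
    δ * ‖ℓ t - ℓ s‖ ≤ 2 * (C₀ * D ^ 2 + ω) := by
  have hω₀ : 0 ≤ ω := (norm_nonneg _).trans (hω s ⟨le_rfl, hst⟩)
  have hvar := h.mul_measureReal_le hcone hst fun u hu => (hD u hu).trans_lt hDR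
  rcases (norm_nonneg (ℓ t - ℓ s)).eq_or_lt with hzero | hpos
  · rw [← hzero, mul_zero]
    positivity
  refine le_of_mul_le_mul_right ?_ hpos
  calc δ * ‖ℓ t - ℓ s‖ * ‖ℓ t - ℓ s‖ = δ * ‖ℓ t - ℓ s‖ ^ 2 := by ring
    _ ≤ δ * (2 * (C₀ * D ^ 2 + ω) * μ.real (Ioc s t)) := by
      gcongr
      exact h.norm_sub_sq_le hball hst hD hω
    _ = 2 * (C₀ * D ^ 2 + ω) * (δ * μ.real (Ioc s t)) := by ring
    _ ≤ 2 * (C₀ * D ^ 2 + ω) * ‖ℓ t - ℓ s‖ := by gcongr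

theorem norm_sub_le_of_norm_sub_le (h : IsReflection O x ℓ μ n)
    (hball : HasUniformExteriorBall O C₀) {δ R : ℝ} (hcone : HasUniformNormalCones O δ R)
    (hδ : 0 < δ) (hst : s ≤ t) {D ω : ℝ} (hDR : D < R / 2) (hDδ : 4 * C₀ * D ≤ δ)
    (hD : ∀ u ∈ Icc s t, ‖(x u : E d) - x s‖ ≤ D)
    (hω : ∀ u ∈ Icc s t, ‖((x u : E d) - ℓ u) - (x s - ℓ s)‖ ≤ ω) :
    ‖(x t : E d) - x s‖ ≤ 2 * (1 + 2 / δ) * ω := by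
  have hcont : Continuous fun u => ‖(x u : E d) - x s‖ := by fun_prop
  obtain ⟨u, hu, hmax⟩ := isCompact_Icc.exists_isMaxOn ⟨s, left_mem_Icc.2 hst⟩
    (hcont.continuousOn (s := Icc s t))
  refine (hmax ⟨hst, le_rfl⟩).trans ?_
  set M := ‖(x u : E d) - x s‖
  have hsub : ∀ v ∈ Icc s u, v ∈ Icc s t := fun v hv => ⟨hv.1, hv.2.trans hu.2⟩
  have hℓ : δ * ‖ℓ u - ℓ s‖ ≤ 2 * (C₀ * M ^ 2 + ω) :=
    h.mul_norm_sub_le hball hcone hδ.le hu.1 ((hD u hu).trans_lt hDR)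
      (fun v hv => hmax (hsub v hv)) fun v hv => hω v (hsub v hv)
  have hquad : 4 * C₀ * M ^ 2 ≤ δ * M :=
    calc 4 * C₀ * M ^ 2 = 4 * C₀ * M * M := by ring
      _ ≤ 4 * C₀ * D * M := by gcongr; exact hD u hu
      _ ≤ δ * M := by gcongr
  have hM : M ≤ ω + ‖ℓ u - ℓ s‖ := by
    have hsplit : (x u : E d) - x s = (((x u : E d) - ℓ u) - (x s - ℓ s)) + (ℓ u - ℓ s) := by abel
    exact (congrArg norm hsplit).trans_le ((norm_add_le _ _).trans (by gcongr; exact hω u hu))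
  have hδM : δ * M ≤ 2 * (δ + 2) * ω := by nlinarith
  calc M ≤ 2 * (δ + 2) * ω / δ := (le_div_iff₀' hδ).2 hδM
    _ = 2 * (1 + 2 / δ) * ω := by field_simp

theorem norm_sub_sq_le_of_driver_sub_driver_le (h : IsReflection O x ℓ μ n)
    (h' : IsReflection O x' ℓ' μ' n') (hball : HasUniformExteriorBall O C₀) (hst : s ≤ t)
    {S K : ℝ} (hS : ∀ u ∈ Icc s t, ‖(x u : E d) - x' u‖ ≤ S)
    (hK : ∀ u v, s ≤ u → u ≤ v → v ≤ t →
      ‖((x v : E d) - ℓ v - (x u - ℓ u)) - ((x' v : E d) - ℓ' v - (x' u - ℓ' u))‖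
        ≤ K * ((v : ℝ) - u)) :
    ‖(x t : E d) - x' t‖ ^ 2 ≤ ‖(x s : E d) - x' s‖ ^ 2
      + 2 * (S * (K * ((t : ℝ) - s)) + C₀ * S ^ 2 * (μ.real (Ioc s t) + μ'.real (Ioc s t))) := by
  have hS₀ : 0 ≤ S := (norm_nonneg _).trans (hS s ⟨le_rfl, hst⟩)
  have hpt : ∀ᵐ u ∂μ, u ∈ Ioc s t → inner ℝ ((x u : E d) - x' u) (n u) ≤ C₀ * S ^ 2 := by
    filter_upwards [h.ae_inner_sub_le hball] with u hu hus
    exact (hu _ (x' u).2).trans (by gcongr; exact hS u (Ioc_subset_Icc_self hus))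
  have hpt' : ∀ᵐ u ∂μ', u ∈ Ioc s t → inner ℝ ((x' u : E d) - x u) (n' u) ≤ C₀ * S ^ 2 := by
    filter_upwards [h'.ae_inner_sub_le hball] with u hu hus
    refine (hu _ (x u).2).trans ?_
    rw [norm_sub_rev]
    gcongr
    exact hS u (Ioc_subset_Icc_self hus)
  have hle := le_of_forall_onShortIntervals_sub_le
    (g := fun u => ‖(x u : E d) - x' u‖ ^ 2
      - 2 * (S * (K * u) + C₀ * S ^ 2 * (μ.real (Ioc s u) + μ'.real (Ioc s u))))
    (a := fun u => 2 * (μ.real (Ioc s u) + μ'.real (Ioc s u))) hst fun ε hε => ?_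
  · simp only [Ioc_self, measureReal_empty] at hle
    linarith
  · filter_upwards [h.onShortIntervals_inner_sub_le (by fun_prop) hε hpt,
      h'.onShortIntervals_inner_sub_le (by fun_prop) hε hpt'] with δ hδ hδ' u v hsu huv hvt huvδ
    have hsq := norm_sq_sub_norm_sq_le ((x v : E d) - x' v) (x u - x' u)
    have hdriver := (real_inner_le_norm ((x v : E d) - x' v) _).trans
      (mul_le_mul (hS v ⟨hsu.trans huv, hvt⟩) (hK u v hsu huv hvt) (norm_nonneg _) hS₀)
    have hpush := hδ u v hsu huv hvt huvδ
    have hpush' := hδ' u v hsu huv hvt huvδ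
    rw [← neg_sub, inner_neg_left] at hpush'
    have hsplit : (x v : E d) - x' v - (x u - x' u)
        = ((x v : E d) - ℓ v - (x u - ℓ u)) - ((x' v : E d) - ℓ' v - (x' u - ℓ' u))
          + (ℓ v - ℓ u) - (ℓ' v - ℓ' u) := by abel
    rw [hsplit, inner_sub_right, inner_add_right] at hsq
    simp only [h.measureReal_add hsu huv, h'.measureReal_add hsu huv]
    linarith

end IsReflection

/-- Over every time interval, a path reflected in `O` moves by at most `C` times the oscillation of
its driver `x - ℓ`. -/
def IsOscillationConst (O : Set (E d)) (C : ℝ≥0) : Prop :=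
  ∀ (x : Path (closure O)) (ℓ : Path (E d)) (μ : Measure ℝ≥0) (n : ℝ≥0 → E d),
    IsReflection O x ℓ μ n → ∀ (s t : ℝ≥0) (ω : ℝ), s ≤ t →
      (∀ u ∈ Icc s t, ‖((x u : E d) - ℓ u) - (x s - ℓ s)‖ ≤ ω) → ‖(x t : E d) - x s‖ ≤ C * ω

theorem exists_isOscillationConst {A : ℝ≥0} (hball : HasUniformExteriorBall O A)
    (hdiam : ∀ x ∈ closure O, ∀ y ∈ closure O, ‖x - y‖ ≤ A) {δ R : ℝ} (hδ : 0 < δ) (hR : 0 < R)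
    (hcone : HasUniformNormalCones O δ R) : ∃ C, IsOscillationConst O C := by
  set D := min (R / 4) (δ / (4 * (A + 1))) with hD
  have hD₀ : 0 < D := by positivity
  have hDR : D < R / 2 := (min_le_left _ _).trans_lt (by linarith)
  have hDδ : 4 * A * D ≤ δ := by
    have hle := min_le_right (R / 4) (δ / (4 * (A + 1)))
    rw [← hD, le_div_iff₀ (by positivity)] at hle
    linarith
  refine ⟨.mk (2 * (1 + 2 / δ) + A * (2 * (1 + 2 / δ)) / D) (by positivity),
    fun x ℓ μ n h s t ω hst hω => ?_⟩
  have hω₀ : 0 ≤ ω := (norm_nonneg _).trans (hω s ⟨le_rfl, hst⟩)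
  rw [NNReal.coe_mk, add_mul]
  rcases lt_or_ge (2 * (1 + 2 / δ) * ω) D with hsmall | hlarge
  · refine le_add_of_le_of_nonneg (le_of_le_of_bootstrap (φ := fun u => ‖(x u : E d) - x s‖)
      (by fun_prop) hsmall (by simpa using by positivity) (fun τ hτ hle => ?_) t ⟨hst, le_rfl⟩)
      (by positivity)
    exact h.norm_sub_le_of_norm_sub_le hball hcone hδ hτ.1 hDR hDδ hle
      fun u hu => hω u ⟨hu.1, hu.2.trans hτ.2⟩
  · refine le_add_of_nonneg_of_le (by positivity) ((hdiam _ (x t).2 _ (x s).2).trans ?_)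
    rw [div_mul_eq_mul_div, le_div_iff₀ hD₀, mul_assoc]
    gcongr

end Reflection

/-! ### Uniqueness -/

section Uniqueness

variable {d r : ℕ} {O : Set (E d)} {σ : closure O → E r →L[ℝ] E d} {b : closure O → E d}
  {A : ℝ≥0} {x₀ : closure O} {N : ℕ} {w : Path (E r)} {x x' : Path (closure O)}
  {ℓ ℓ' : Path (E d)} {μ μ' : Measure ℝ≥0} {n n' : ℝ≥0 → E d} {m : ℕ} {s t : ℝ≥0}

theorem IsControlled.intervalIntegrable_drift (h : IsControlled O σ b A) (v : E r)
    (x : Path (closure O)) (s t : ℝ) :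
    IntervalIntegrable (fun u : ℝ => drift σ b v (x u.toNNReal)) volume s t :=
  ((h.lipschitzWith_drift v).continuous.comp
    (x.continuous.comp continuous_real_toNNReal)).intervalIntegrable _ _

namespace IsReflectedSolution

theorem eq_of_time_zero (hx : IsReflectedSolution O σ b x₀ w x ℓ) (h : IsReflection O x ℓ μ n) :
    x 0 = x₀ := by
  have heq := hx.equation 0
  simp only [NNReal.coe_zero, intervalIntegral.integral_same, add_zero, h.zero] at heq
  exact Subtype.ext heq

theorem driver_sub_eq (h : IsControlled O σ b A)
    (hx : IsReflectedSolution O σ b x₀ (dyadicInterp N w) x ℓ)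
    (hms : m * mesh N ≤ s) (hst : s ≤ t) (htm : t ≤ (m + 1 : ℕ) * mesh N) :
    (x t : E d) - ℓ t - (x s - ℓ s)
      = ∫ u in (s : ℝ)..t, drift σ b (velocity N w m) (x u.toNNReal) := by
  have hσ := h.intervalIntegrable_σ N w x 0
  have hb := h.intervalIntegrable_b x 0
  rw [NNReal.coe_zero] at hσ
  have hdrift : ∫ u in (s : ℝ)..t, drift σ b (velocity N w m) (x u.toNNReal)
      = (∫ u in (s : ℝ)..t, σ (x u.toNNReal) (velocity N w m))
        + ∫ u in (s : ℝ)..t, b (x u.toNNReal) :=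
    intervalIntegral.integral_add (h.intervalIntegrable_σ_const x _ _ _)
      (h.intervalIntegrable_b x s t)
  rw [hdrift, ← integral_σ_deriv_dyadicInterp N w x m hms hst htm,
    ← intervalIntegral.integral_interval_sub_left (hσ t) (hσ s),
    ← intervalIntegral.integral_interval_sub_left (hb t) (hb s), hx.equation t, hx.equation s]
  abel

theorem norm_driver_sub_driver_le (h : IsControlled O σ b A)
    (hx : IsReflectedSolution O σ b x₀ (dyadicInterp N w) x ℓ)
    (hx' : IsReflectedSolution O σ b x₀ (dyadicInterp N w) x' ℓ')
    (hms : m * mesh N ≤ s) (hst : s ≤ t) (htm : t ≤ (m + 1 : ℕ) * mesh N) {S : ℝ}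
    (hS : ∀ u ∈ Icc s t, ‖(x u : E d) - x' u‖ ≤ S) :
    ‖((x t : E d) - ℓ t - (x s - ℓ s)) - ((x' t : E d) - ℓ' t - (x' s - ℓ' s))‖
      ≤ A * (‖velocity N w m‖ + 1) * S * ((t : ℝ) - s) := by
  have hst' := NNReal.coe_le_coe.2 hst
  rw [hx.driver_sub_eq h hms hst htm, hx'.driver_sub_eq h hms hst htm,
    ← intervalIntegral.integral_sub (h.intervalIntegrable_drift _ x _ _)
      (h.intervalIntegrable_drift _ x' _ _), ← abs_of_nonneg (sub_nonneg.2 hst')]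
  refine intervalIntegral.norm_integral_le_of_norm_le_const fun u hu => ?_
  rw [uIoc_of_le hst'] at hu
  have hlip := (h.lipschitzWith_drift (velocity N w m)).dist_le_mul (x u.toNNReal) (x' u.toNNReal)
  rw [dist_eq_norm, Subtype.dist_eq, dist_eq_norm] at hlip
  refine hlip.trans ?_
  push_cast
  gcongr
  exact hS _ ⟨NNReal.le_toNNReal_of_coe_le hu.1.le, Real.toNNReal_le_iff_le_coe.2 hu.2⟩

theorem eqOn_Icc_of_small (h : IsControlled O σ b A)
    (hx : IsReflectedSolution O σ b x₀ (dyadicInterp N w) x ℓ)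
    (hx' : IsReflectedSolution O σ b x₀ (dyadicInterp N w) x' ℓ')
    (hℓ : IsReflection O x ℓ μ n) (hℓ' : IsReflection O x' ℓ' μ' n')
    (hms : m * mesh N ≤ s) (htm : t ≤ (m + 1 : ℕ) * mesh N)
    (hsmall : 2 * (A * (‖velocity N w m‖ + 1) * ((t : ℝ) - s)
      + A * (μ.real (Ioc s t) + μ'.real (Ioc s t))) < 1) (hs : x s = x' s) :
    EqOn x x' (Icc s t) := by
  intro u hu
  have hcont : Continuous fun u => ‖(x u : E d) - x' u‖ := by fun_prop
  obtain ⟨v, hv, hmax⟩ := isCompact_Icc.exists_isMaxOn ⟨u, hu⟩ (hcont.continuousOn (s := Icc s t))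
  set S := ‖(x v : E d) - x' v‖
  have hS : ∀ u ∈ Icc s v, ‖(x u : E d) - x' u‖ ≤ S := fun u hu => hmax ⟨hu.1, hu.2.trans hv.2⟩
  have hsq := hℓ.norm_sub_sq_le_of_driver_sub_driver_le hℓ' h.exteriorBall hv.1 hS
    fun u₁ u₂ hsu huv hut => hx.norm_driver_sub_driver_le h hx' (hms.trans hsu) huv
      ((hut.trans hv.2).trans htm) fun u hu => hS u ⟨hsu.trans hu.1, hu.2.trans hut⟩
  have hvar : 2 * (A * (‖velocity N w m‖ + 1) * ((v : ℝ) - s)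
      + A * (μ.real (Ioc s v) + μ'.real (Ioc s v))) < 1 := by
    refine lt_of_le_of_lt ?_ hsmall
    gcongr
    exacts [hv.2, hℓ.finite_Ioc _ _, hv.2, hℓ'.finite_Ioc _ _, hv.2]
  rw [hs, sub_self, norm_zero] at hsq
  have hzero : S ^ 2 = 0 := by nlinarith [sq_nonneg S]
  have hle : ‖(x u : E d) - x' u‖ ≤ 0 := (hmax hu).trans_eq (pow_eq_zero_iff two_ne_zero |>.1 hzero)
  exact Subtype.ext (sub_eq_zero.1 (norm_le_zero_iff.1 hle))

theorem eventually_nhdsGT_eq (h : IsControlled O σ b A)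
    (hx : IsReflectedSolution O σ b x₀ (dyadicInterp N w) x ℓ)
    (hx' : IsReflectedSolution O σ b x₀ (dyadicInterp N w) x' ℓ') (hs : x s = x' s) :
    ∀ᶠ t in 𝓝[>] s, x t = x' t := by
  obtain ⟨μ, n, hℓ⟩ := hx.exists_isReflection
  obtain ⟨μ', n', hℓ'⟩ := hx'.exists_isReflection
  set m := ⌊s / mesh N⌋₊
  have hms : m * mesh N ≤ s := (le_div_iff₀ (mesh_pos N)).1 (Nat.floor_le zero_le)
  have hsm : s < (m + 1 : ℕ) * mesh N :=
    (div_lt_iff₀ (mesh_pos N)).1 (by exact_mod_cast Nat.lt_floor_add_one _)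
  have htime : Tendsto (fun t : ℝ≥0 => (t : ℝ) - s) (𝓝[>] s) (𝓝 0) := by
    have hcont : Continuous fun t : ℝ≥0 => (t : ℝ) - s := by fun_prop
    simpa using (hcont.tendsto s).mono_left nhdsWithin_le_nhds
  have hlim := ((htime.const_mul (A * (‖velocity N w m‖ + 1))).add
    (((hℓ.tendsto_measureReal_Ioc s).add (hℓ'.tendsto_measureReal_Ioc s)).const_mul
      (A : ℝ))).const_mul 2
  filter_upwards [hlim.eventually_lt_const (u := 1) (by simp), self_mem_nhdsWithin,
    mem_nhdsWithin_of_mem_nhds (gt_mem_nhds hsm)] with t hsmall hst htm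
  exact hx.eqOn_Icc_of_small h hx' hℓ hℓ' hms htm.le hsmall hs ⟨hst.le, le_rfl⟩

theorem unique (h : IsControlled O σ b A)
    (hx : IsReflectedSolution O σ b x₀ (dyadicInterp N w) x ℓ)
    (hx' : IsReflectedSolution O σ b x₀ (dyadicInterp N w) x' ℓ') : x = x' ∧ ℓ = ℓ' := by
  obtain ⟨μ, n, hℓ⟩ := hx.exists_isReflection
  obtain ⟨μ', n', hℓ'⟩ := hx'.exists_isReflection
  have hxx' : x = x' := by
    ext1 t
    have hsub : Icc 0 t ⊆ {u | x u = x' u} :=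
      ((isClosed_eq x.continuous x'.continuous).inter
        isClosed_Icc).Icc_subset_of_forall_mem_nhdsWithin
        ((hx.eq_of_time_zero hℓ).trans (hx'.eq_of_time_zero hℓ').symm)
        fun s hs => hx.eventually_nhdsGT_eq h hx' hs.1
    exact hsub ⟨zero_le, le_rfl⟩
  subst hxx'
  refine ⟨rfl, ?_⟩
  ext1 t
  exact add_left_cancel ((hx.equation t).symm.trans (hx'.equation t))

end IsReflectedSolution

end Uniqueness

/-! ### Moments of martingale transforms of sub-Gaussian walks -/

section SubgaussianMoments

variable {Ω : Type*} {mΩ : MeasurableSpace Ω} {P : Measure Ω} {X : Ω → ℝ} {c : ℝ≥0}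

theorem lintegral_exp_mul_le_of_hasSubgaussianMGF (hX : HasSubgaussianMGF X c P) (t : ℝ) :
    ∫⁻ ω, ENNReal.ofReal (Real.exp (t * X ω)) ∂P
      ≤ ENNReal.ofReal (Real.exp (c * t ^ 2 / 2)) := by
  rw [← ofReal_integral_eq_lintegral_ofReal (hX.integrable_exp_mul t)
    (ae_of_all _ fun ω => (Real.exp_pos _).le)]
  exact ENNReal.ofReal_le_ofReal (hX.mgf_le t)

theorem hasSubgaussianMGF_of_lintegral_exp_mul_le (hX : AEMeasurable X P)
    (h : ∀ t : ℝ, ∫⁻ ω, ENNReal.ofReal (Real.exp (t * X ω)) ∂P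
      ≤ ENNReal.ofReal (Real.exp (c * t ^ 2 / 2))) : HasSubgaussianMGF X c P := by
  have hmeas : ∀ t : ℝ, AEStronglyMeasurable (fun ω => Real.exp (t * X ω)) P := fun t =>
    (Real.measurable_exp.comp_aemeasurable (hX.const_mul t)).aestronglyMeasurable
  have hpos : ∀ t : ℝ, 0 ≤ᵐ[P] fun ω => Real.exp (t * X ω) := fun t =>
    ae_of_all _ fun ω => (Real.exp_pos _).le
  refine ⟨fun t => ⟨hmeas t, ?_⟩, fun t => ?_⟩
  · exact (hasFiniteIntegral_iff_ofReal (hpos t)).2 ((h t).trans_lt ENNReal.ofReal_lt_top)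
  · rw [mgf, integral_eq_lintegral_of_nonneg_ae (hpos t) (hmeas t)]
    exact ENNReal.toReal_le_of_le_ofReal (Real.exp_pos _).le (h t)

theorem abs_pow_le_factorial_mul_exp_add_exp (x : ℝ) (q : ℕ) :
    |x| ^ q ≤ q.factorial * (Real.exp x + Real.exp (-x)) := by
  have hfac : (0 : ℝ) < q.factorial := by positivity
  have hexp : Real.exp |x| ≤ Real.exp x + Real.exp (-x) := by
    rcases abs_choice x with habs | habs <;> rw [habs]
    exacts [le_add_of_nonneg_right (Real.exp_pos _).le, le_add_of_nonneg_left (Real.exp_pos _).le]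
  exact (div_le_iff₀' hfac).1 ((Real.pow_div_factorial_le_exp |x| (abs_nonneg x) q).trans hexp)

/-- The constant in the bound for the `q`-th moment of a sub-Gaussian variable. -/
noncomputable def subgaussianMoment (q : ℕ) : ℝ := 2 * q.factorial * Real.exp (1 / 2)

theorem one_le_subgaussianMoment (q : ℕ) : 1 ≤ subgaussianMoment q := by
  have hfac : (1 : ℝ) ≤ q.factorial := by exact_mod_cast q.factorial_pos
  exact one_le_mul_of_one_le_of_one_le (by linarith) (Real.one_le_exp (by norm_num))

theorem subgaussianMoment_nonneg (q : ℕ) : 0 ≤ subgaussianMoment q :=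
  zero_le_one.trans (one_le_subgaussianMoment q)

theorem lintegral_enorm_pow_le_of_hasSubgaussianMGF (hX : HasSubgaussianMGF X c P) (hc : c ≠ 0)
    (q : ℕ) : ∫⁻ ω, ‖X ω‖ₑ ^ q ∂P ≤ ENNReal.ofReal (subgaussianMoment q * √c ^ q) := by
  set θ : ℝ := √c
  have hθ : 0 < θ := Real.sqrt_pos.2 (by exact_mod_cast hc.bot_lt)
  have hexp : ∀ t : ℝ, t ^ 2 = (θ ^ 2)⁻¹ →
      ∫⁻ ω, ENNReal.ofReal (Real.exp (t * X ω)) ∂P ≤ ENNReal.ofReal (Real.exp (1 / 2)) := by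
    intro t ht
    refine (lintegral_exp_mul_le_of_hasSubgaussianMGF hX t).trans_eq ?_
    rw [ht, Real.sq_sqrt c.coe_nonneg, mul_inv_cancel₀ (by exact_mod_cast hc)]
  have hpt : ∀ ω, ‖X ω‖ₑ ^ q ≤ ENNReal.ofReal (θ ^ q * q.factorial)
      * (ENNReal.ofReal (Real.exp (θ⁻¹ * X ω)) + ENNReal.ofReal (Real.exp (-θ⁻¹ * X ω))) := by
    intro ω
    rw [← ofReal_norm, ← ENNReal.ofReal_pow (norm_nonneg _), Real.norm_eq_abs,
      ← ENNReal.ofReal_add (Real.exp_pos _).le (Real.exp_pos _).le,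
      ← ENNReal.ofReal_mul (by positivity), mul_assoc, neg_mul]
    refine ENNReal.ofReal_le_ofReal (le_trans (le_of_eq ?_) (mul_le_mul_of_nonneg_left
      (abs_pow_le_factorial_mul_exp_add_exp (θ⁻¹ * X ω) q) (by positivity)))
    rw [← mul_pow, abs_mul, abs_of_pos (inv_pos.2 hθ), mul_inv_cancel_left₀ hθ.ne']
  calc ∫⁻ ω, ‖X ω‖ₑ ^ q ∂P
      ≤ ENNReal.ofReal (θ ^ q * q.factorial)
        * (ENNReal.ofReal (Real.exp (1 / 2)) + ENNReal.ofReal (Real.exp (1 / 2))) := by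
        refine (lintegral_mono hpt).trans ?_
        have hmeas : AEMeasurable (fun ω => ENNReal.ofReal (Real.exp (θ⁻¹ * X ω))) P :=
          (Real.measurable_exp.comp_aemeasurable (hX.aemeasurable.const_mul _)).ennreal_ofReal
        rw [lintegral_const_mul' _ _ ENNReal.ofReal_ne_top, lintegral_add_left' hmeas]
        gcongr
        exacts [hexp _ (inv_pow θ 2), hexp _ ((neg_sq _).trans (inv_pow θ 2))]
    _ = _ := by
        rw [← ENNReal.ofReal_add (Real.exp_pos _).le (Real.exp_pos _).le,
          ← ENNReal.ofReal_mul (by positivity), subgaussianMoment]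
        ring_nf

theorem eLpNorm_le_of_hasSubgaussianMGF (hX : HasSubgaussianMGF X c P) {q : ℕ} (hq : q ≠ 0) :
    eLpNorm X q P ≤ ENNReal.ofReal (subgaussianMoment q * √c) := by
  rcases eq_or_ne c 0 with rfl | hc
  · simp [eLpNorm_congr_ae hX.ae_eq_zero_of_hasSubgaussianMGF_zero]
  have hκ := one_le_subgaussianMoment q
  have hint : ∫⁻ ω, ‖X ω‖ₑ ^ (q : ℝ) ∂P ≤ ENNReal.ofReal (subgaussianMoment q * √c) ^ (q : ℝ) := by
    simp only [ENNReal.rpow_natCast]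
    refine (lintegral_enorm_pow_le_of_hasSubgaussianMGF hX hc q).trans ?_
    rw [← ENNReal.ofReal_pow (mul_nonneg (subgaussianMoment_nonneg q) (Real.sqrt_nonneg _)),
      mul_pow]
    gcongr
    exact le_self_pow₀ hκ hq
  rw [eLpNorm_eq_lintegral_rpow_enorm_toReal (by exact_mod_cast hq) (ENNReal.natCast_ne_top q),
    ENNReal.toReal_natCast, one_div]
  exact (ENNReal.rpow_inv_le_iff (by positivity)).2 hint

end SubgaussianMoments

section Coordinates

variable {n : ℕ}

theorem norm_le_sum_abs_coord (x : E n) : ‖x‖ ≤ ∑ i, |x i| := by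
  rw [EuclideanSpace.norm_eq]
  refine Real.sqrt_le_iff.2 ⟨by positivity, ?_⟩
  simp only [Real.norm_eq_abs]
  exact Finset.sum_sq_le_sq_sum_of_nonneg fun i _ => abs_nonneg _

theorem eLpNorm_le_of_coord_le {Ω : Type*} {mΩ : MeasurableSpace Ω} {P : Measure Ω}
    {X : Ω → E n} {q : ℝ≥0∞} (hq : 1 ≤ q) {c : ℝ}
    (hX : ∀ j, AEStronglyMeasurable (fun ω => X ω j) P)
    (hc : ∀ j, eLpNorm (fun ω => X ω j) q P ≤ ENNReal.ofReal c) :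
    eLpNorm X q P ≤ ENNReal.ofReal (n * c) := by
  have hpt : ∀ ω, ‖X ω‖ ≤ (∑ j, fun ω => ‖X ω j‖) ω := fun ω => by
    rw [Finset.sum_apply]
    exact norm_le_sum_abs_coord (X ω)
  calc eLpNorm X q P ≤ ∑ j, eLpNorm (fun ω => ‖X ω j‖) q P :=
        (eLpNorm_mono_real hpt).trans (eLpNorm_sum_le (fun j _ => (hX j).norm) hq)
    _ ≤ ∑ _j : Fin n, ENNReal.ofReal c :=
        Finset.sum_le_sum fun j _ => (eLpNorm_norm fun ω => X ω j).trans_le (hc j)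
    _ = ENNReal.ofReal (n * c) := by
        rw [Finset.sum_const, Finset.card_univ, Fintype.card_fin, nsmul_eq_mul,
          ENNReal.ofReal_mul (Nat.cast_nonneg n), ENNReal.ofReal_natCast]

end Coordinates

section SubgaussianWalk

/-- The constant in the bound for the `q`-th moments of the sums of the increments of a
semimartingale with values in `ℝⁿ` that is driven by a sub-Gaussian walk in `ℝʳ`. -/
noncomputable def semimartingaleMoment (r n q : ℕ) : ℝ :=
  n * subgaussianMoment q + ((r * subgaussianMoment (q * 2)) ^ 2 + 1)

variable {Ω : Type*} {mΩ : MeasurableSpace Ω}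

/-- The steps `ξ` are independent of the past, as described by the filtration `𝓖`, and
sub-Gaussian, with variance proxy `h` in each direction. -/
structure IsSubgaussianWalk {H : Type*} [NormedAddCommGroup H] [InnerProductSpace ℝ H]
    [MeasurableSpace H] (P : Measure Ω) (h : ℝ≥0) (𝓖 : Filtration ℕ mΩ) (ξ : ℕ → Ω → H) :
    Prop where
  measurable_succ : ∀ m, Measurable[𝓖 (m + 1)] (ξ m)
  indep : ∀ m, Indep (𝓖 m) (MeasurableSpace.comap (ξ m) inferInstance) P
  hasSubgaussianMGF : ∀ m a, HasSubgaussianMGF (fun ω => inner ℝ a (ξ m ω)) (h * ‖a‖₊ ^ 2) P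

namespace IsSubgaussianWalk

variable {P : Measure Ω} {h : ℝ≥0} {𝓖 : Filtration ℕ mΩ}

section InnerProductSpace

variable {H : Type*} [NormedAddCommGroup H] [InnerProductSpace ℝ H] [MeasurableSpace H]
  {ξ : ℕ → Ω → H}

theorem measurable (hξ : IsSubgaussianWalk P h 𝓖 ξ) (m : ℕ) : Measurable (ξ m) :=
  (hξ.measurable_succ m).mono (𝓖.le _) le_rfl

variable [BorelSpace H] [SecondCountableTopology H]

theorem measurable_sum_inner (hξ : IsSubgaussianWalk P h 𝓖 ξ) {U : ℕ → Ω → H} (hU : Adapted 𝓖 U)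
    (i k : ℕ) :
    Measurable[𝓖 (i + k)] fun ω => ∑ m ∈ Finset.range k, inner ℝ (U (i + m) ω) (ξ (i + m) ω) := by
  refine Finset.measurable_fun_sum _ fun m hm => ?_
  have hmk : m < k := Finset.mem_range.1 hm
  exact ((hU (i + m)).mono (𝓖.mono (by lia)) le_rfl).inner
    ((hξ.measurable_succ (i + m)).mono (𝓖.mono (by lia)) le_rfl)

variable [IsProbabilityMeasure P]

theorem lintegral_exp_add_inner_le (hξ : IsSubgaussianWalk P h 𝓖 ξ) {m : ℕ} {S : Ω → ℝ}
    {U : Ω → H} {c : ℝ} (hS : Measurable[𝓖 m] S) (hU : Measurable[𝓖 m] U)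
    (hc : ∀ ω, ‖U ω‖ ≤ c) :
    ∫⁻ ω, ENNReal.ofReal (Real.exp (S ω + inner ℝ (U ω) (ξ m ω))) ∂P
      ≤ ENNReal.ofReal (Real.exp (h * c ^ 2 / 2)) * ∫⁻ ω, ENNReal.ofReal (Real.exp (S ω)) ∂P := by
  have hSU : Measurable[𝓖 m] fun ω => (S ω, U ω) := hS.prodMk hU
  have hSU' : Measurable fun ω => (S ω, U ω) := hSU.mono (𝓖.le m) le_rfl
  have hind : IndepFun (fun ω => (S ω, U ω)) (ξ m) P :=
    (IndepFun_iff_Indep ..).2 (indep_of_indep_of_le_left (hξ.indep m) hSU.comap_le)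
  have hmap := (indepFun_iff_map_prod_eq_prod_map_map hSU'.aemeasurable
    (hξ.measurable m).aemeasurable).1 hind
  have hF : Measurable fun p : (ℝ × H) × H =>
      ENNReal.ofReal (Real.exp (p.1.1 + inner ℝ p.1.2 p.2)) := by fun_prop
  rw [← lintegral_map (f := fun p : (ℝ × H) × H => ENNReal.ofReal
    (Real.exp (p.1.1 + inner ℝ p.1.2 p.2))) hF (hSU'.prodMk (hξ.measurable m)), hmap,
    lintegral_prod _ hF.aemeasurable, lintegral_map hF.lintegral_prod_right' hSU',
    ← lintegral_const_mul' _ _ ENNReal.ofReal_ne_top]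
  refine lintegral_mono fun ω => ?_
  dsimp only
  rw [lintegral_map (by fun_prop) (hξ.measurable m)]
  simp_rw [Real.exp_add, ENNReal.ofReal_mul (Real.exp_pos _).le]
  rw [lintegral_const_mul' _ _ ENNReal.ofReal_ne_top, mul_comm]
  gcongr
  have hexp := lintegral_exp_mul_le_of_hasSubgaussianMGF (hξ.hasSubgaussianMGF m (U ω)) 1
  simp only [one_mul, one_pow, mul_one, NNReal.coe_mul, NNReal.coe_pow, coe_nnnorm] at hexp
  refine hexp.trans (ENNReal.ofReal_le_ofReal (Real.exp_le_exp.2 ?_))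
  gcongr
  exact hc ω

theorem hasSubgaussianMGF_add_inner (hξ : IsSubgaussianWalk P h 𝓖 ξ) {m : ℕ} {S : Ω → ℝ}
    {U : Ω → H} {c v : ℝ≥0} (hS : Measurable[𝓖 m] S) (hU : Measurable[𝓖 m] U)
    (hc : ∀ ω, ‖U ω‖ ≤ c) (hSv : HasSubgaussianMGF S v P) :
    HasSubgaussianMGF (fun ω => S ω + inner ℝ (U ω) (ξ m ω)) (v + h * c ^ 2) P := by
  have hm : Measurable (ξ m) := hξ.measurable m
  have hS' : Measurable S := hS.mono (𝓖.le m) le_rfl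
  have hU' : Measurable U := hU.mono (𝓖.le m) le_rfl
  refine hasSubgaussianMGF_of_lintegral_exp_mul_le (by fun_prop) fun t => ?_
  have hstep := hξ.lintegral_exp_add_inner_le (U := fun ω => t • U ω) (c := |t| * c)
    (hS.const_mul t) (hU.const_smul t) fun ω => by
      rw [norm_smul, Real.norm_eq_abs]
      exact mul_le_mul_of_nonneg_left (hc ω) (abs_nonneg t)
  simp only [real_inner_smul_left, ← mul_add] at hstep
  refine hstep.trans ((mul_le_mul_right
    (lintegral_exp_mul_le_of_hasSubgaussianMGF hSv t) _).trans_eq ?_)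
  rw [← ENNReal.ofReal_mul (Real.exp_pos _).le, ← Real.exp_add, mul_pow, sq_abs]
  push_cast
  ring_nf

theorem hasSubgaussianMGF_sum_inner (hξ : IsSubgaussianWalk P h 𝓖 ξ) {U : ℕ → Ω → H} {c : ℝ≥0}
    (hU : Adapted 𝓖 U) (hc : ∀ m ω, ‖U m ω‖ ≤ c) (i k : ℕ) :
    HasSubgaussianMGF (fun ω => ∑ m ∈ Finset.range k, inner ℝ (U (i + m) ω) (ξ (i + m) ω))
      (k * (h * c ^ 2)) P := by
  induction k with
  | zero => simp
  | succ k ih =>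
    simp_rw [Finset.sum_range_succ, Nat.cast_succ, add_one_mul]
    exact hξ.hasSubgaussianMGF_add_inner (hξ.measurable_sum_inner hU i k) (hU _) (hc _) ih

theorem eLpNorm_sum_inner_le (hξ : IsSubgaussianWalk P h 𝓖 ξ) {U : ℕ → Ω → H} {c : ℝ≥0}
    (hU : Adapted 𝓖 U) (hc : ∀ m ω, ‖U m ω‖ ≤ c) (i k : ℕ) {q : ℕ} (hq : q ≠ 0) :
    eLpNorm (fun ω => ∑ m ∈ Finset.range k, inner ℝ (U (i + m) ω) (ξ (i + m) ω)) q P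
      ≤ ENNReal.ofReal (subgaussianMoment q * c * √(k * h)) := by
  refine (eLpNorm_le_of_hasSubgaussianMGF (hξ.hasSubgaussianMGF_sum_inner hU hc i k) hq).trans_eq ?_
  push_cast
  rw [← mul_assoc, Real.sqrt_mul (by positivity), Real.sqrt_sq c.coe_nonneg, mul_assoc, mul_comm √_]

end InnerProductSpace

section Euclidean

variable [IsProbabilityMeasure P] {r n : ℕ} {ξ : ℕ → Ω → E r}

theorem eLpNorm_sum_apply_le (hξ : IsSubgaussianWalk P h 𝓖 ξ) {U : ℕ → Ω → E r →L[ℝ] E n}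
    {c : ℝ≥0} (hU : Adapted 𝓖 U) (hc : ∀ m ω, ‖U m ω‖ ≤ c) (i k : ℕ) {q : ℕ} (hq : q ≠ 0) :
    eLpNorm (fun ω => ∑ m ∈ Finset.range k, U (i + m) ω (ξ (i + m) ω)) q P
      ≤ ENNReal.ofReal (n * (subgaussianMoment q * c * √(k * h))) := by
  set M : Fin n → Ω → ℝ := fun j ω => ∑ m ∈ Finset.range k,
    inner ℝ (ContinuousLinearMap.adjoint (U (i + m) ω) (EuclideanSpace.single j 1)) (ξ (i + m) ω)
  have hadj : ∀ j : Fin n, Measurable fun T : E r →L[ℝ] E n =>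
      ContinuousLinearMap.adjoint T (EuclideanSpace.single j (1 : ℝ)) := fun j =>
    (ContinuousLinearMap.adjoint.continuous.clm_apply continuous_const).measurable
  have hV : ∀ j, Adapted 𝓖 fun m ω =>
      ContinuousLinearMap.adjoint (U m ω) (EuclideanSpace.single j (1 : ℝ)) := fun j m =>
    (hadj j).comp (hU m)
  have hM : ∀ j, Measurable (M j) := fun j =>
    (hξ.measurable_sum_inner (hV j) i k).mono (𝓖.le _) le_rfl
  have hM_le : ∀ j, eLpNorm (M j) q P ≤ ENNReal.ofReal (subgaussianMoment q * c * √(k * h)) := by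
    refine fun j => hξ.eLpNorm_sum_inner_le (hV j) (fun m ω => ?_) i k hq
    refine (ContinuousLinearMap.le_opNorm _ _).trans ?_
    simpa using hc m ω
  refine eLpNorm_le_of_coord_le (by exact_mod_cast Nat.one_le_iff_ne_zero.2 hq)
    (fun j => ?_) fun j => ?_
  all_goals
    have hcoord : (fun ω => (∑ m ∈ Finset.range k, U (i + m) ω (ξ (i + m) ω)) j) = M j := by
      ext ω
      simp [M, ContinuousLinearMap.adjoint_inner_left, EuclideanSpace.inner_single_left]
    rw [hcoord]
  exacts [(hM j).aestronglyMeasurable, hM_le j]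

theorem eLpNorm_le (hξ : IsSubgaussianWalk P h 𝓖 ξ) (m : ℕ) {q : ℕ} (hq : q ≠ 0) :
    eLpNorm (ξ m) q P ≤ ENNReal.ofReal (r * (subgaussianMoment q * √h)) := by
  simpa using hξ.eLpNorm_sum_apply_le (U := fun _ _ => ContinuousLinearMap.id ℝ (E r)) (c := 1)
    (fun _ => measurable_const) (fun _ _ => ContinuousLinearMap.norm_id_le) m 1 hq

theorem eLpNorm_norm_sq_add_le (hξ : IsSubgaussianWalk P h 𝓖 ξ) (m : ℕ) {q : ℕ} (hq : q ≠ 0) :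
    eLpNorm (fun ω => ‖ξ m ω‖ ^ 2 + h) q P
      ≤ ENNReal.ofReal (((r * subgaussianMoment (q * 2)) ^ 2 + 1) * h) := by
  have hm := hξ.measurable m
  have hsq : eLpNorm (fun ω => ‖ξ m ω‖ ^ 2) q P
      ≤ ENNReal.ofReal ((r * subgaussianMoment (q * 2)) ^ 2 * h) := by
    have hpow := eLpNorm_norm_rpow (p := q) (μ := P) (ξ m) (q := 2) (by norm_num)
    have hnorm := hξ.eLpNorm_le m (q := q * 2) (by lia)
    have hκ := subgaussianMoment_nonneg (q * 2)
    simp only [Real.rpow_ofNat, ENNReal.ofReal_ofNat] at hpow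
    rw [Nat.cast_mul, Nat.cast_ofNat] at hnorm
    rw [hpow]
    refine (ENNReal.rpow_le_rpow hnorm zero_le_two).trans_eq ?_
    rw [ENNReal.ofReal_rpow_of_nonneg (by positivity) zero_le_two, Real.rpow_ofNat, ← mul_assoc,
      mul_pow, Real.sq_sqrt h.coe_nonneg]
  refine (eLpNorm_add_le (f := fun ω => ‖ξ m ω‖ ^ 2) (g := fun _ => (h : ℝ)) (by fun_prop)
    (by fun_prop) (by exact_mod_cast Nat.one_le_iff_ne_zero.2 hq)).trans ?_
  rw [eLpNorm_const _ (by exact_mod_cast hq) (NeZero.ne P), measure_univ, ENNReal.one_rpow,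
    mul_one, Real.enorm_of_nonneg h.coe_nonneg, add_mul, one_mul,
    ENNReal.ofReal_add (by positivity) h.coe_nonneg]
  gcongr

theorem eLpNorm_sum_norm_sq_add_le (hξ : IsSubgaussianWalk P h 𝓖 ξ) (i k : ℕ) {q : ℕ}
    (hq : q ≠ 0) :
    eLpNorm (fun ω => ∑ m ∈ Finset.range k, (‖ξ (i + m) ω‖ ^ 2 + h)) q P
      ≤ ENNReal.ofReal (((r * subgaussianMoment (q * 2)) ^ 2 + 1) * (k * h)) := by
  have hm := hξ.measurable
  have htri := eLpNorm_sum_le (μ := P) (p := q) (s := Finset.range k)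
    (f := fun m ω => ‖ξ (i + m) ω‖ ^ 2 + h) (fun m _ => by fun_prop)
    (by exact_mod_cast Nat.one_le_iff_ne_zero.2 hq)
  rw [Finset.sum_fn] at htri
  refine htri.trans ((Finset.sum_le_sum fun m _ => hξ.eLpNorm_norm_sq_add_le _ hq).trans_eq ?_)
  rw [Finset.sum_const, Finset.card_range, nsmul_eq_mul, ← ENNReal.ofReal_natCast,
    ← ENNReal.ofReal_mul (Nat.cast_nonneg k)]
  ring_nf

theorem eLpNorm_sum_le_of_norm_sub_le (hξ : IsSubgaussianWalk P h 𝓖 ξ)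
    {U : ℕ → Ω → E r →L[ℝ] E n} {c : ℝ≥0} (hU : Adapted 𝓖 U) (hc : ∀ m ω, ‖U m ω‖ ≤ c)
    {D : ℕ → Ω → E n} (hD : ∀ m ω, ‖D m ω - U m ω (ξ m ω)‖ ≤ c * (‖ξ m ω‖ ^ 2 + h)) (i : ℕ)
    {k : ℕ} (hk : k * h ≤ 1) {q : ℕ} (hq : q ≠ 0) :
    eLpNorm (fun ω => ∑ m ∈ Finset.range k, D (i + m) ω) q P
      ≤ ENNReal.ofReal (c * semimartingaleMoment r n q * √(k * h)) := by
  set M : Ω → E n := fun ω => ∑ m ∈ Finset.range k, U (i + m) ω (ξ (i + m) ω)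
  set Q : Ω → ℝ := fun ω => ∑ m ∈ Finset.range k, (‖ξ (i + m) ω‖ ^ 2 + h)
  have hξm := hξ.measurable
  have hUm : ∀ m, Measurable (U m) := fun m => (hU m).mono (𝓖.le m) le_rfl
  have hM : Measurable M := Finset.measurable_fun_sum _ fun m _ =>
    ContinuousLinearMap.measurable_apply₂.comp ((hUm (i + m)).prodMk (hξm (i + m)))
  have hQ : Measurable Q := by fun_prop
  have hpt : ∀ ω, ‖∑ m ∈ Finset.range k, D (i + m) ω‖ ≤ ‖M ω‖ + c * Q ω := by
    intro ω
    refine (norm_le_norm_add_norm_sub' _ (M ω)).trans (add_le_add_right ?_ _)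
    rw [← Finset.sum_sub_distrib, Finset.mul_sum]
    exact norm_sum_le_of_le _ fun m _ => hD (i + m) ω
  have hkh : (k * h : ℝ) ≤ √(k * h) := Real.le_sqrt_self_iff.2 (by exact_mod_cast hk)
  have hκ := subgaussianMoment_nonneg q
  calc eLpNorm (fun ω => ∑ m ∈ Finset.range k, D (i + m) ω) q P
      ≤ eLpNorm (fun ω => ‖M ω‖) q P + eLpNorm ((c : ℝ) • Q) q P :=
        (eLpNorm_mono_real hpt).trans (eLpNorm_add_le hM.norm.aestronglyMeasurable
          (hQ.const_smul (c : ℝ)).aestronglyMeasurable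
          (by exact_mod_cast Nat.one_le_iff_ne_zero.2 hq))
    _ ≤ ENNReal.ofReal (n * (subgaussianMoment q * c * √(k * h)))
        + ENNReal.ofReal c * ENNReal.ofReal
          (((r * subgaussianMoment (q * 2)) ^ 2 + 1) * √(k * h)) := by
        rw [eLpNorm_norm, eLpNorm_const_smul, Real.enorm_of_nonneg c.coe_nonneg]
        gcongr
        · exact hξ.eLpNorm_sum_apply_le hU hc i k hq
        · refine (hξ.eLpNorm_sum_norm_sq_add_le i k hq).trans (ENNReal.ofReal_le_ofReal ?_)
          gcongr
    _ = _ := by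
        rw [← ENNReal.ofReal_mul c.coe_nonneg, ← ENNReal.ofReal_add (by positivity)
          (by positivity), semimartingaleMoment]
        ring_nf

end Euclidean

end IsSubgaussianWalk

end SubgaussianWalk

/-! ### Dyadic increments under Wiener measure -/

section Wiener

variable {r : ℕ}

theorem measurable_dyadicIncrement (N m : ℕ) :
    Measurable fun w : Path (E r) => dyadicIncrement N w m :=
  (continuous_dyadicIncrement N m).measurable

theorem measurable_dyadicIncrement_coord (N m : ℕ) (i : Fin r) :
    Measurable fun w : Path (E r) => dyadicIncrement N w m i :=
  (EuclideanSpace.proj (𝕜 := ℝ) i).continuous.measurable.comp (measurable_dyadicIncrement N m)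

/-- The filtration on path space generated by the increments over the dyadic intervals of length
`2⁻ᴺ`: at time `m`, the first `m` increments are known. -/
noncomputable def dyadicPast (r N : ℕ) : Filtration ℕ (pathMeasurableSpace (E r)) where
  seq m := ⨆ k < m, MeasurableSpace.comap (fun w => dyadicIncrement N w k) inferInstance
  mono' _ _ hmn := iSup₂_le fun k hk => le_iSup₂_of_le k (hk.trans_le hmn) le_rfl
  le' _ := iSup₂_le fun k _ => (measurable_dyadicIncrement N k).comap_le

theorem measurable_dyadicIncrement_of_lt (N : ℕ) {k m : ℕ} (hk : k < m) :
    Measurable[dyadicPast r N m] fun w => dyadicIncrement N w k :=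
  (comap_measurable _).mono (le_iSup₂_of_le k hk le_rfl) le_rfl

theorem comap_le_iSup_comap_coord {Ω : Type*} (f : Ω → E r) :
    MeasurableSpace.comap f inferInstance
      ≤ ⨆ i, MeasurableSpace.comap (fun ω => f ω i) inferInstance := by
  let _ : MeasurableSpace Ω := ⨆ i, MeasurableSpace.comap (fun ω => f ω i) inferInstance
  have hcoord : Measurable fun ω i => f ω i := measurable_pi_iff.2 fun i =>
    (comap_measurable _).mono (le_iSup (fun i => MeasurableSpace.comap (fun ω => f ω i) _) i) le_rfl
  exact ((WithLp.measurable_toLp 2 (Fin r → ℝ)).comp hcoord).comap_le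

theorem indep_iSup_lt_of_iIndep_prod {Ω ι : Type*} {mΩ : MeasurableSpace Ω} {P : Measure Ω}
    {𝓜 : ι × ℕ → MeasurableSpace Ω} (hle : ∀ p, 𝓜 p ≤ mΩ) (hind : iIndep 𝓜 P)
    {𝓗 : ℕ → MeasurableSpace Ω} (h𝓗 : ∀ k, 𝓗 k ≤ ⨆ i, 𝓜 (i, k)) (m : ℕ) :
    Indep (⨆ k < m, 𝓗 k) (𝓗 m) P := by
  have hdisj : Disjoint {p : ι × ℕ | p.2 < m} {p | p.2 = m} :=
    Set.disjoint_left.2 fun p hlt heq => (ne_of_lt hlt) heq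
  have hpast : ⨆ k < m, 𝓗 k ≤ ⨆ p ∈ {p : ι × ℕ | p.2 < m}, 𝓜 p :=
    iSup₂_le fun k hk => (h𝓗 k).trans (iSup_le fun i =>
      le_iSup₂ (f := fun p (_ : p ∈ {p : ι × ℕ | p.2 < m}) => 𝓜 p) (i, k) hk)
  have hpresent : 𝓗 m ≤ ⨆ p ∈ {p : ι × ℕ | p.2 = m}, 𝓜 p := (h𝓗 m).trans (iSup_le fun i =>
    le_iSup₂ (f := fun p (_ : p ∈ {p : ι × ℕ | p.2 = m}) => 𝓜 p) (i, m) rfl)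
  exact indep_of_indep_of_le_left (indep_of_indep_of_le_right
    (indep_iSup_of_disjoint hle hind hdisj) hpresent) hpast

theorem hasSubgaussianMGF_gaussianReal (v : ℝ≥0) : HasSubgaussianMGF id v (gaussianReal 0 v) where
  integrable_exp_mul := integrable_exp_mul_gaussianReal
  mgf_le t := by simp [mgf_id_gaussianReal]

namespace IsWienerMeasure

variable {𝕎 : Measure (Path (E r))}

theorem iIndepFun_coord (h𝕎 : IsWienerMeasure 𝕎) (N : ℕ) :
    iIndepFun (fun (p : Fin r × ℕ) w => dyadicIncrement N w p.2 p.1) 𝕎 := by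
  refine iIndepFun_uncurry' (X := fun (i : Fin r) (m : ℕ) (w : Path (E r)) =>
    dyadicIncrement N w m i) (fun i m => measurable_dyadicIncrement_coord N m i) ?_ fun i => ?_
  · exact h𝕎.indep.comp (fun _ (f : ℝ≥0 → ℝ) (m : ℕ) =>
      f ((m + 1 : ℕ) * mesh N) - f (m * mesh N)) fun i => by fun_prop
  · refine (h𝕎.isBrownian i).toIsPreBrownianReal.hasIndepIncrements.nat
      (t := fun m : ℕ => (m : ℝ≥0) * mesh N) fun m n hmn => ?_
    dsimp only
    gcongr

theorem map_coord (h𝕎 : IsWienerMeasure 𝕎) (N m : ℕ) (i : Fin r) :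
    𝕎.map (fun w => dyadicIncrement N w m i) = gaussianReal 0 (mesh N) := by
  have hlen : nndist (((m + 1 : ℕ) * mesh N : ℝ≥0) : ℝ) ((m * mesh N : ℝ≥0) : ℝ) = mesh N := by
    ext
    rw [coe_nndist, Real.dist_eq]
    push_cast
    rw [add_mul, one_mul, add_sub_cancel_left, abs_of_nonneg (NNReal.coe_nonneg _)]
  rw [← hlen]
  exact ((h𝕎.isBrownian i).toIsPreBrownianReal.hasLaw_sub ((m + 1 : ℕ) * mesh N)
    (m * mesh N)).map_eq

theorem hasSubgaussianMGF_inner (h𝕎 : IsWienerMeasure 𝕎) (N m : ℕ) (a : E r) :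
    HasSubgaussianMGF (fun w => inner ℝ a (dyadicIncrement N w m)) (mesh N * ‖a‖₊ ^ 2) 𝕎 := by
  have hind : iIndepFun (fun (i : Fin r) w => a i * dyadicIncrement N w m i) 𝕎 :=
    ((h𝕎.iIndepFun_coord N).precomp (g := fun i : Fin r => (i, m))
      fun i j hij => congrArg Prod.fst hij).comp (fun i x => a i * x) fun i => by fun_prop
  have hcoord : ∀ i : Fin r, HasSubgaussianMGF (fun w => dyadicIncrement N w m i) (mesh N) 𝕎 :=
    fun i => (HasSubgaussianMGF.id_map_iff (measurable_dyadicIncrement_coord N m i).aemeasurable).1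
      (by rw [h𝕎.map_coord N m i]; exact hasSubgaussianMGF_gaussianReal _)
  have hsum := HasSubgaussianMGF.sum_of_iIndepFun hind (s := Finset.univ)
    fun i _ => (hcoord i).const_mul (a i)
  convert hsum using 1
  · ext w
    simp [PiLp.inner_apply, mul_comm]
  · ext
    push_cast
    rw [EuclideanSpace.norm_sq_eq, Finset.mul_sum]
    exact Finset.sum_congr rfl fun i _ => by rw [Real.norm_eq_abs, sq_abs, mul_comm]; rfl

theorem isSubgaussianWalk (h𝕎 : IsWienerMeasure 𝕎) (N : ℕ) :
    IsSubgaussianWalk 𝕎 (mesh N) (dyadicPast r N) fun m w => dyadicIncrement N w m where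
  measurable_succ m := measurable_dyadicIncrement_of_lt N m.lt_succ_self
  indep := indep_iSup_lt_of_iIndep_prod
    (fun p => (measurable_dyadicIncrement_coord N p.2 p.1).comap_le)
    (h𝕎.iIndepFun_coord N).iIndep fun _ => comap_le_iSup_comap_coord _
  hasSubgaussianMGF := h𝕎.hasSubgaussianMGF_inner N

end IsWienerMeasure

end Wiener

/-! ### Hölder norms by dyadic chaining -/

theorem succ_mul_mesh_le_iff {ℓ k T : ℕ} :
    ((k + 1 : ℕ) : ℝ≥0) * mesh ℓ ≤ T ↔ k < T * 2 ^ ℓ := by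
  rw [mesh, ← div_eq_mul_inv, div_le_iff₀ (by positivity)]
  norm_cast

theorem coe_mesh_rpow (ℓ : ℕ) (γ : ℝ) : (mesh ℓ : ℝ) ^ γ = ((2 : ℝ) ^ (-γ)) ^ ℓ := by
  rw [coe_mesh, Real.inv_rpow (by positivity), ← Real.rpow_natCast, ← Real.rpow_natCast,
    ← Real.rpow_mul (by norm_num), ← Real.rpow_mul (by norm_num), ← Real.rpow_neg (by norm_num)]
  ring_nf

theorem tendsto_mesh : Tendsto (fun n => (mesh n : ℝ)) atTop (𝓝 0) := by
  simp_rw [coe_mesh, ← inv_pow]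
  exact tendsto_pow_atTop_nhds_zero_of_lt_one (by norm_num) (by norm_num)

theorem exists_mesh_le {δ : ℝ} (hδ : 0 < δ) {T : ℕ} (hT : δ ≤ T) :
    ∃ n, (mesh n : ℝ) ≤ 2 * δ ∧ δ * 2 ^ n ≤ T + 1 := by
  rcases le_or_gt δ 1 with hδ_one | hδ_one
  · obtain ⟨n, hlt, hle⟩ := exists_nat_pow_near_of_lt_one hδ hδ_one (y := (1 / 2 : ℝ))
      (by norm_num) (by norm_num)
    refine ⟨n, ?_, ?_⟩
    · rw [pow_succ, one_div] at hlt
      rw [coe_mesh, ← inv_pow]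
      linarith
    · rw [one_div, inv_pow, ← one_div, le_div_iff₀ (by positivity)] at hle
      linarith [(Nat.cast_nonneg T : (0 : ℝ) ≤ T)]
  · refine ⟨0, ?_, ?_⟩
    · rw [coe_mesh, pow_zero, inv_one]
      linarith
    · rw [pow_zero]
      linarith

/-- The largest multiple of `2⁻ⁿ` which is at most `u`. -/
noncomputable def dyadicFloor (n : ℕ) (u : ℝ≥0) : ℝ≥0 := ⌊u * 2 ^ n⌋₊ * mesh n

theorem dyadicFloor_le (n : ℕ) (u : ℝ≥0) : dyadicFloor n u ≤ u := by
  rw [dyadicFloor, mesh, ← div_eq_mul_inv, div_le_iff₀ (by positivity)]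
  exact Nat.floor_le zero_le

theorem le_dyadicFloor_add (n : ℕ) (u : ℝ≥0) : u ≤ dyadicFloor n u + mesh n := by
  have hle : u ≤ (⌊u * 2 ^ n⌋₊ + 1) * mesh n := by
    rw [mesh, ← div_eq_mul_inv, le_div_iff₀ (by positivity)]
    exact (Nat.lt_floor_add_one _).le
  rwa [add_mul, one_mul] at hle

theorem tendsto_dyadicFloor (u : ℝ≥0) : Tendsto (fun n => dyadicFloor n u) atTop (𝓝 u) := by
  rw [← NNReal.tendsto_coe]
  refine tendsto_of_tendsto_of_tendsto_of_le_of_le (g := fun n => (u : ℝ) - mesh n)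
    (h := fun _ => (u : ℝ)) ?_ tendsto_const_nhds (fun n => ?_) fun n => ?_
  · simpa using tendsto_const_nhds.sub tendsto_mesh
  · rw [sub_le_iff_le_add]
    exact_mod_cast le_dyadicFloor_add n u
  · exact_mod_cast dyadicFloor_le n u

theorem dyadicFloor_eq_two_mul (n : ℕ) (u : ℝ≥0) :
    dyadicFloor n u = (2 * ⌊u * 2 ^ n⌋₊ : ℕ) * mesh (n + 1) := by
  rw [dyadicFloor, mesh, mesh, pow_succ]
  push_cast
  field_simp

theorem floor_mul_two_pow_succ (n : ℕ) (u : ℝ≥0) :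
    ⌊u * 2 ^ (n + 1)⌋₊ = 2 * ⌊u * 2 ^ n⌋₊ ∨ ⌊u * 2 ^ (n + 1)⌋₊ = 2 * ⌊u * 2 ^ n⌋₊ + 1 := by
  have hfloor : ⌊u * 2 ^ (n + 1)⌋₊ / 2 = ⌊u * 2 ^ n⌋₊ := by
    rw [← Nat.floor_div_ofNat, pow_succ, ← mul_assoc]
    congr 1
    exact mul_div_cancel_right₀ _ (by norm_num)
  lia

/-- Up to time `T`, the increment of `f` over each dyadic interval of length `2⁻ˡ` is at most
`R 2⁻ᵝˡ`: the Hölder condition that dyadic chaining starts from. -/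
def HasDyadicIncrementsLE {F : Type*} [PseudoMetricSpace F] (β R : ℝ) (T : ℕ) (f : ℝ≥0 → F) :
    Prop :=
  ∀ ℓ k : ℕ, k < T * 2 ^ ℓ →
    dist (f (k * mesh ℓ)) (f ((k + 1 : ℕ) * mesh ℓ)) ≤ R * (mesh ℓ : ℝ) ^ β

/-- The Hölder constant that dyadic chaining yields from unit dyadic increments on `[0, T]`. -/
noncomputable def chainingConst (β : ℝ) (T : ℕ) : ℝ := 2 * (T + 2 + 2 / (1 - 2 ^ (-β)))

theorem two_rpow_neg_lt_one {β : ℝ} (hβ : 0 < β) : (2 : ℝ) ^ (-β) < 1 :=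
  Real.rpow_lt_one_of_one_lt_of_neg one_lt_two (neg_lt_zero.2 hβ)

theorem chainingConst_pos {β : ℝ} (hβ : 0 < β) (T : ℕ) : 0 < chainingConst β T := by
  have hgap := sub_pos.2 (two_rpow_neg_lt_one hβ)
  rw [chainingConst]
  positivity

namespace HasDyadicIncrementsLE

variable {F : Type*} [PseudoMetricSpace F] {f : ℝ≥0 → F} {β R : ℝ} {T : ℕ}

theorem dist_dyadicFloor_succ_le (hf : HasDyadicIncrementsLE β R T f) (hβ : 0 ≤ β) (hR : 0 ≤ R)
    {u : ℝ≥0} (hu : u ≤ T) (n : ℕ) :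
    dist (f (dyadicFloor n u)) (f (dyadicFloor (n + 1) u)) ≤ R * (mesh n : ℝ) ^ β := by
  have hmesh : (mesh (n + 1) : ℝ) ≤ mesh n := by
    rw [coe_mesh, coe_mesh]
    gcongr <;> norm_num
  rcases floor_mul_two_pow_succ n u with hfloor | hfloor
  · rw [dyadicFloor_eq_two_mul, dyadicFloor, hfloor, dist_self]
    positivity
  · have hle := (dyadicFloor_le (n + 1) u).trans hu
    rw [dyadicFloor, hfloor] at hle
    rw [dyadicFloor_eq_two_mul, dyadicFloor, hfloor]
    refine (hf (n + 1) _ (succ_mul_mesh_le_iff.1 hle)).trans ?_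
    gcongr

theorem dist_dyadicFloor_le (hf : HasDyadicIncrementsLE β R T f) (hf_cont : Continuous f)
    (hβ : 0 < β) (hR : 0 ≤ R) {u : ℝ≥0} (hu : u ≤ T) (n : ℕ) :
    dist (f (dyadicFloor n u)) (f u) ≤ R * (mesh n : ℝ) ^ β / (1 - 2 ^ (-β)) := by
  rw [coe_mesh_rpow]
  refine dist_le_of_le_geometric_of_tendsto _ R (two_rpow_neg_lt_one hβ) (fun m => ?_)
    ((hf_cont.tendsto u).comp (tendsto_dyadicFloor u)) n
  rw [← coe_mesh_rpow]
  exact hf.dist_dyadicFloor_succ_le hβ.le hR hu m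

theorem dist_dyadicFloor_dyadicFloor_le (hf : HasDyadicIncrementsLE β R T f) (hR : 0 ≤ R)
    {s t : ℝ≥0} (hst : s ≤ t) (ht : t ≤ T) (n : ℕ) :
    dist (f (dyadicFloor n s)) (f (dyadicFloor n t))
      ≤ ((t - s) * 2 ^ n + 1) * (R * (mesh n : ℝ) ^ β) := by
  have hfloor : ⌊s * 2 ^ n⌋₊ ≤ ⌊t * 2 ^ n⌋₊ := Nat.floor_mono (by gcongr)
  have hsum := dist_le_Ico_sum_of_dist_le (f := fun k : ℕ => f (k * mesh n)) hfloor
    (d := fun _ => R * (mesh n : ℝ) ^ β) fun {k} _ hk => hf n k <| succ_mul_mesh_le_iff.1 <| by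
      refine le_trans ?_ ((dyadicFloor_le n t).trans ht)
      rw [dyadicFloor]
      gcongr
      lia
  refine hsum.trans ?_
  rw [Finset.sum_const, Nat.card_Ico, nsmul_eq_mul, Nat.cast_sub hfloor]
  refine mul_le_mul_of_nonneg_right ?_ (by positivity)
  have hle_t : (⌊t * 2 ^ n⌋₊ : ℝ) ≤ t * 2 ^ n := by
    exact_mod_cast Nat.floor_le (zero_le (a := t * 2 ^ n))
  have hlt_s : (s * 2 ^ n : ℝ) < ⌊s * 2 ^ n⌋₊ + 1 := by
    exact_mod_cast Nat.lt_floor_add_one (s * 2 ^ n)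
  linarith

theorem dist_le_of_two_pow_le (hf : HasDyadicIncrementsLE β R T f) (hf_cont : Continuous f)
    (hβ : 0 < β) (hR : 0 ≤ R) {s t : ℝ≥0} (hst : s ≤ t) (ht : t ≤ T) {n : ℕ}
    (hn : ((t : ℝ) - s) * 2 ^ n ≤ T + 1) :
    dist (f s) (f t) ≤ (T + 2 + 2 / (1 - 2 ^ (-β))) * R * (mesh n : ℝ) ^ β := by
  have hs := hf.dist_dyadicFloor_le hf_cont hβ hR (hst.trans ht) n
  rw [dist_comm] at hs
  calc dist (f s) (f t)
      ≤ dist (f s) (f (dyadicFloor n s)) + dist (f (dyadicFloor n s)) (f (dyadicFloor n t))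
          + dist (f (dyadicFloor n t)) (f t) := dist_triangle4 _ _ _ _
    _ ≤ R * (mesh n : ℝ) ^ β / (1 - 2 ^ (-β)) + (T + 1 + 1) * (R * (mesh n : ℝ) ^ β)
          + R * (mesh n : ℝ) ^ β / (1 - 2 ^ (-β)) := by
        refine add_le_add_three hs ?_ (hf.dist_dyadicFloor_le hf_cont hβ hR ht n)
        exact (hf.dist_dyadicFloor_dyadicFloor_le hR hst ht n).trans (by gcongr)
    _ = _ := by ring

theorem dist_le (hf : HasDyadicIncrementsLE β R T f) (hf_cont : Continuous f) (hβ : 0 < β)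
    (hβ_one : β ≤ 1) (hR : 0 ≤ R) {s t : ℝ≥0} (hst : s < t) (ht : t ≤ T) :
    dist (f s) (f t) ≤ chainingConst β T * R * ((t : ℝ) - s) ^ β := by
  have hδ : (0 : ℝ) < t - s := sub_pos.2 (by exact_mod_cast hst)
  have hδT : (t : ℝ) - s ≤ T := (sub_le_self _ s.coe_nonneg).trans (by exact_mod_cast ht)
  have hgap := sub_pos.2 (two_rpow_neg_lt_one hβ)
  obtain ⟨n, hmesh, hn⟩ := exists_mesh_le hδ hδT
  have hmesh_rpow : (mesh n : ℝ) ^ β ≤ 2 * ((t : ℝ) - s) ^ β :=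
    calc (mesh n : ℝ) ^ β ≤ (2 * (t - s)) ^ β := Real.rpow_le_rpow (by positivity) hmesh hβ.le
      _ = 2 ^ β * ((t : ℝ) - s) ^ β := Real.mul_rpow (by norm_num) hδ.le
      _ ≤ 2 ^ (1 : ℝ) * ((t : ℝ) - s) ^ β := by gcongr; norm_num
      _ = 2 * ((t : ℝ) - s) ^ β := by rw [Real.rpow_one]
  calc dist (f s) (f t) ≤ (T + 2 + 2 / (1 - 2 ^ (-β))) * R * (mesh n : ℝ) ^ β :=
        hf.dist_le_of_two_pow_le hf_cont hβ hR hst.le ht hn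
    _ ≤ (T + 2 + 2 / (1 - 2 ^ (-β))) * R * (2 * ((t : ℝ) - s) ^ β) := by gcongr
    _ = chainingConst β T * R * ((t : ℝ) - s) ^ β := by rw [chainingConst]; ring

end HasDyadicIncrementsLE

section HolderNorm

variable {n : ℕ} {β C : ℝ} {s t : ℝ≥0} {ψ : ℝ≥0 → E n}

theorem holderNorm_le
    (h : ∀ u₁ u₂, s ≤ u₁ → u₁ < u₂ → u₂ ≤ t → ‖ψ u₂ - ψ u₁‖ ≤ C * ((u₂ : ℝ) - u₁) ^ β) :
    holderNorm β s t ψ ≤ ENNReal.ofReal C := by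
  refine iSup_le fun u₁ => iSup_le fun u₂ => iSup_le fun hu => ENNReal.ofReal_le_ofReal ?_
  have hpos : (0 : ℝ) < u₂ - u₁ := sub_pos.2 (by exact_mod_cast hu.2.1)
  rw [div_le_iff₀ (by positivity)]
  exact h u₁ u₂ hu.1 hu.2.1 hu.2.2

theorem norm_sub_le_of_holderNorm_le (hC : 0 ≤ C) (h : holderNorm β s t ψ ≤ ENNReal.ofReal C)
    {u₁ u₂ : ℝ≥0} (h₁ : s ≤ u₁) (h₁₂ : u₁ < u₂) (h₂ : u₂ ≤ t) :
    ‖ψ u₂ - ψ u₁‖ ≤ C * ((u₂ : ℝ) - u₁) ^ β := by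
  have hpos : (0 : ℝ) < u₂ - u₁ := sub_pos.2 (by exact_mod_cast h₁₂)
  rw [← div_le_iff₀ (by positivity), ← ENNReal.ofReal_le_ofReal_iff hC]
  refine le_trans ?_ h
  exact le_iSup_of_le u₁ (le_iSup_of_le u₂ (le_iSup_of_le ⟨h₁, h₁₂, h₂⟩ le_rfl))

theorem holderNorm_mono {t' : ℝ≥0} (ht : t ≤ t') (ψ : ℝ≥0 → E n) :
    holderNorm β s t ψ ≤ holderNorm β s t' ψ :=
  iSup_mono fun _ => iSup_mono fun _ => iSup_mono' fun h => ⟨⟨h.1, h.2.1, h.2.2.trans ht⟩, le_rfl⟩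

theorem HasDyadicIncrementsLE.holderNorm_le {R : ℝ} {T : ℕ} (hψ : HasDyadicIncrementsLE β R T ψ)
    (hψ_cont : Continuous ψ) (hβ : 0 < β) (hβ_one : β ≤ 1) (hR : 0 ≤ R) :
    holderNorm β 0 T ψ ≤ ENNReal.ofReal (chainingConst β T * R) := by
  refine ReflectedSDE.holderNorm_le fun u₁ u₂ _ hu hu₂ => ?_
  rw [← dist_eq_norm, dist_comm]
  exact hψ.dist_le hψ_cont hβ hβ_one hR hu hu₂

end HolderNorm

/-! ### Tails of Hölder norms -/

section HolderTail

variable {n : ℕ} {Ω : Type*} {mΩ : MeasurableSpace Ω} {P : Measure Ω} {Z : Ω → ℝ≥0 → E n}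
  {β γ K R : ℝ} {T q : ℕ}

theorem setOf_le_holderNorm_subset (hZ : ∀ ω, Continuous (Z ω)) (hβ : 0 < β) (hβ_one : β ≤ 1)
    (hR : 0 < R) :
    {ω | ENNReal.ofReal R ≤ holderNorm β 0 T (Z ω)}
      ⊆ ⋃ ℓ, ⋃ k ∈ Finset.range (T * 2 ^ ℓ),
        {ω | ENNReal.ofReal (R / (2 * chainingConst β T) * (mesh ℓ : ℝ) ^ β)
          ≤ ‖Z ω ((k + 1 : ℕ) * mesh ℓ) - Z ω (k * mesh ℓ)‖ₑ} := by
  have hC := chainingConst_pos hβ T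
  intro ω hω
  by_contra hsmall
  simp only [mem_iUnion, not_exists, Finset.mem_range] at hsmall
  have hincr : HasDyadicIncrementsLE β (R / (2 * chainingConst β T)) T (Z ω) := fun ℓ k hk => by
    have hlt := hsmall ℓ k hk
    rw [mem_ofPred_eq, not_le, ← ofReal_norm] at hlt
    rw [dist_comm, dist_eq_norm]
    exact (ENNReal.ofReal_lt_ofReal_iff'.1 hlt).1.le
  have hle := (mem_ofPred_eq ▸ hω).trans (hincr.holderNorm_le (hZ ω) hβ hβ_one (by positivity))
  rw [ENNReal.ofReal_le_ofReal_iff (by positivity)] at hle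
  field_simp at hle
  linarith

theorem measure_le_enorm_increment_le (hβ : 0 < β) (hR : 0 < R) (hq : q ≠ 0) {ℓ : ℕ} {u v : ℝ≥0}
    (hu : AEStronglyMeasurable (fun ω => Z ω u) P) (hv : AEStronglyMeasurable (fun ω => Z ω v) P)
    (hincr : eLpNorm (fun ω => Z ω v - Z ω u) q P ≤ ENNReal.ofReal (K * (mesh ℓ : ℝ) ^ γ)) :
    P {ω | ENNReal.ofReal (R / (2 * chainingConst β T) * (mesh ℓ : ℝ) ^ β) ≤ ‖Z ω v - Z ω u‖ₑ}
      ≤ ENNReal.ofReal (K * (2 * chainingConst β T) / R * (mesh ℓ : ℝ) ^ (γ - β)) ^ q := by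
  have hC := chainingConst_pos hβ T
  have hmesh : (0 : ℝ) < mesh ℓ := mesh_pos ℓ
  have hpos : 0 < R / (2 * chainingConst β T) * (mesh ℓ : ℝ) ^ β := by positivity
  have hmarkov := meas_ge_le_mul_pow_eLpNorm_enorm P (p := q) (by exact_mod_cast hq)
    (ENNReal.natCast_ne_top q) (hv.sub hu) (ENNReal.ofReal_pos.2 hpos).ne' (by simp)
  rw [ENNReal.toReal_natCast, ENNReal.rpow_natCast, ENNReal.rpow_natCast, ← mul_pow] at hmarkov
  refine hmarkov.trans (pow_le_pow_left' ((mul_le_mul_right hincr _).trans (le_of_eq ?_)) q)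
  rw [← ENNReal.ofReal_inv_of_pos hpos, ← ENNReal.ofReal_mul (by positivity),
    Real.rpow_sub hmesh]
  congr 1
  field_simp

theorem two_pow_mul_mesh_rpow_pow (ℓ q : ℕ) (δ : ℝ) :
    2 ^ ℓ * ((mesh ℓ : ℝ) ^ δ) ^ q = ((2 : ℝ) ^ (1 - q * δ)) ^ ℓ := by
  rw [← Real.rpow_mul_natCast (by positivity), coe_mesh_rpow, ← mul_pow,
    sub_eq_add_neg, Real.rpow_add (by norm_num), Real.rpow_one, mul_comm δ]

/-- The constant in the bound `P(R ≤ ‖Z‖_β) ≤ C (K / R)^q` for a process `Z` on `[0, T]` whose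
dyadic increments over time `h` are at most `K h^γ` in `L^q`. -/
noncomputable def holderTailConst (β γ : ℝ) (T q : ℕ) : ℝ :=
  T * (2 * chainingConst β T) ^ q * (1 - 2 ^ (1 - q * (γ - β)))⁻¹

theorem measure_holderNorm_ge_le (hβ : 0 < β) (hβ_one : β ≤ 1) (hq : 1 < q * (γ - β)) (hK : 0 ≤ K)
    (hR : 0 < R) (hZ : ∀ ω, Continuous (Z ω))
    (hZ_meas : ∀ t, AEStronglyMeasurable (fun ω => Z ω t) P)
    (hincr : ∀ ℓ k : ℕ, k < T * 2 ^ ℓ →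
      eLpNorm (fun ω => Z ω ((k + 1 : ℕ) * mesh ℓ) - Z ω (k * mesh ℓ)) q P
        ≤ ENNReal.ofReal (K * (mesh ℓ : ℝ) ^ γ)) :
    P {ω | ENNReal.ofReal R ≤ holderNorm β 0 T (Z ω)}
      ≤ ENNReal.ofReal (holderTailConst β γ T q * (K / R) ^ q) := by
  have hC := chainingConst_pos hβ T
  have hq_ne : q ≠ 0 := by rintro rfl; norm_num at hq
  set ρ : ℝ := 2 ^ (1 - q * (γ - β)) with hρ
  have hρ_lt : ρ < 1 := Real.rpow_lt_one_of_one_lt_of_neg one_lt_two (by linarith)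
  refine (measure_mono (setOf_le_holderNorm_subset hZ hβ hβ_one hR)).trans
    ((measure_iUnion_le _).trans ?_)
  set B : ℝ := K * (2 * chainingConst β T) / R with hB
  calc ∑' ℓ, P (⋃ k ∈ Finset.range (T * 2 ^ ℓ),
        {ω | ENNReal.ofReal (R / (2 * chainingConst β T) * (mesh ℓ : ℝ) ^ β)
          ≤ ‖Z ω ((k + 1 : ℕ) * mesh ℓ) - Z ω (k * mesh ℓ)‖ₑ})
      ≤ ∑' ℓ, ∑ _k ∈ Finset.range (T * 2 ^ ℓ),
          ENNReal.ofReal (B * (mesh ℓ : ℝ) ^ (γ - β)) ^ q :=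
        ENNReal.tsum_le_tsum fun ℓ => (measure_biUnion_finset_le _ _).trans <|
          Finset.sum_le_sum fun _ hk => measure_le_enorm_increment_le hβ hR hq_ne (hZ_meas _)
            (hZ_meas _) (hincr ℓ _ (Finset.mem_range.1 hk))
    _ = ∑' ℓ, ENNReal.ofReal (T * B ^ q * ρ ^ ℓ) := by
        congr with ℓ
        rw [Finset.sum_const, Finset.card_range, nsmul_eq_mul,
          ← ENNReal.ofReal_pow (by positivity), ← ENNReal.ofReal_natCast,
          ← ENNReal.ofReal_mul (by positivity), mul_pow, hρ, ← two_pow_mul_mesh_rpow_pow]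
        push_cast
        ring_nf
    _ = ENNReal.ofReal (holderTailConst β γ T q * (K / R) ^ q) := by
        rw [← ENNReal.ofReal_tsum_of_nonneg (fun ℓ => by positivity)
          ((summable_geometric_of_lt_one (by positivity) hρ_lt).mul_left _), tsum_mul_left,
          tsum_geometric_of_lt_one (by positivity) hρ_lt, holderTailConst, ← hρ, hB]
        ring_nf

end HolderTail

/-! ### Dyadic semimartingales -/

theorem mesh_le_one (N : ℕ) : mesh N ≤ 1 :=
  inv_le_one_of_one_le₀ (one_le_pow₀ one_le_two)

theorem mesh_eq_two_pow_mul_mesh_add (ℓ j : ℕ) : mesh ℓ = 2 ^ j * mesh (ℓ + j) := by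
  rw [mesh, mesh, pow_add]
  field_simp

theorem mesh_add_le (N j : ℕ) : mesh (N + j) ≤ mesh N := by
  rw [mesh_eq_two_pow_mul_mesh_add N j]
  exact le_mul_of_one_le_left zero_le (one_le_pow₀ one_le_two)

theorem coe_succ_mul_mesh_sub (N m : ℕ) :
    (((m + 1 : ℕ) * mesh N : ℝ≥0) : ℝ) - (m * mesh N : ℝ≥0) = mesh N := by
  push_cast
  ring

theorem mul_mesh_le_succ_mul_mesh (N m : ℕ) : (m : ℝ≥0) * mesh N ≤ (m + 1 : ℕ) * mesh N := by
  gcongr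
  exact m.le_succ

theorem dyadic_subinterval (N j k : ℕ) :
    ((k / 2 ^ j : ℕ) : ℝ≥0) * mesh N ≤ k * mesh (N + j) ∧
      ((k + 1 : ℕ) : ℝ≥0) * mesh (N + j) ≤ (k / 2 ^ j + 1 : ℕ) * mesh N := by
  rw [mesh_eq_two_pow_mul_mesh_add N j, ← mul_assoc, ← mul_assoc]
  constructor
  · gcongr
    exact_mod_cast Nat.div_mul_le_self k (2 ^ j)
  · gcongr
    exact_mod_cast (Nat.lt_div_mul_add (a := k) (b := 2 ^ j) (by positivity)).trans_eq (by ring)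

section Semimartingale

variable {r n : ℕ} {N : ℕ} {C : ℝ≥0} {Z : Path (E r) → ℝ≥0 → E n} {𝕎 : Measure (Path (E r))}

/-- A process which moves regularly inside each dyadic interval of length `2⁻ᴺ`, and whose
increments over these intervals are, up to second order terms, bounded predictable linear functions
of the increments of the path. -/
structure IsDyadicSemimartingale (N : ℕ) (C : ℝ≥0) (Z : Path (E r) → ℝ≥0 → E n) : Prop where
  continuous_path : ∀ w, Continuous (Z w)
  measurable : ∀ t, Measurable fun w => Z w t
  norm_sub_le : ∀ (w : Path (E r)) (m : ℕ) (s t : ℝ≥0), m * mesh N ≤ s → s ≤ t →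
    t ≤ (m + 1 : ℕ) * mesh N →
      ‖Z w t - Z w s‖ ≤ C * (((t : ℝ) - s) / mesh N) * (‖dyadicIncrement N w m‖ + mesh N)
  exists_integrand : ∃ U : ℕ → Path (E r) → E r →L[ℝ] E n,
    Adapted (dyadicPast r N) U ∧ (∀ m w, ‖U m w‖ ≤ C) ∧
      ∀ m w, ‖(Z w ((m + 1 : ℕ) * mesh N) - Z w (m * mesh N)) - U m w (dyadicIncrement N w m)‖
        ≤ C * (‖dyadicIncrement N w m‖ ^ 2 + mesh N)

/-- A constant `K` for which the increment of a dyadic semimartingale over any dyadic interval of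
length `h ≤ 1`, coarser or finer than its own level, is at most `K √h` in `L^q`. -/
noncomputable def incrementConst (C : ℝ≥0) (r n q : ℕ) : ℝ :=
  C * max (semimartingaleMoment r n q) (r * subgaussianMoment q + 1)

theorem incrementConst_nonneg (C : ℝ≥0) (r n q : ℕ) : 0 ≤ incrementConst C r n q :=
  mul_nonneg C.coe_nonneg <| le_max_of_le_right <|
    add_nonneg (mul_nonneg (Nat.cast_nonneg r) (subgaussianMoment_nonneg q)) zero_le_one

theorem IsWienerMeasure.eLpNorm_norm_dyadicIncrement_add_mesh_le (h𝕎 : IsWienerMeasure 𝕎)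
    (N m : ℕ) {q : ℕ} (hq : q ≠ 0) :
    eLpNorm (fun w => ‖dyadicIncrement N w m‖ + mesh N) q 𝕎
      ≤ ENNReal.ofReal ((r * subgaussianMoment q + 1) * √(mesh N)) := by
  have hprob := h𝕎.isProbabilityMeasure
  have hmeas := measurable_dyadicIncrement (r := r) N m
  have hmoment := subgaussianMoment_nonneg q
  have hmesh : (mesh N : ℝ) ≤ √(mesh N) := Real.le_sqrt_self_iff.2 (mesh_le_one N)
  calc eLpNorm (fun w => ‖dyadicIncrement N w m‖ + mesh N) q 𝕎
      ≤ eLpNorm (fun w => ‖dyadicIncrement N w m‖) q 𝕎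
          + eLpNorm (fun _ => (mesh N : ℝ)) q 𝕎 :=
        eLpNorm_add_le (by fun_prop) (by fun_prop)
          (by exact_mod_cast Nat.one_le_iff_ne_zero.2 hq)
    _ = eLpNorm (fun w => dyadicIncrement N w m) q 𝕎 + ENNReal.ofReal (mesh N) := by
        rw [eLpNorm_norm, eLpNorm_const _ (by exact_mod_cast hq) (NeZero.ne 𝕎), measure_univ,
          ENNReal.one_rpow, mul_one, Real.enorm_of_nonneg (mesh N).coe_nonneg]
    _ ≤ ENNReal.ofReal (r * (subgaussianMoment q * √(mesh N)))
          + ENNReal.ofReal √(mesh N) := by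
        gcongr
        exact (h𝕎.isSubgaussianWalk N).eLpNorm_le m hq
    _ = ENNReal.ofReal ((r * subgaussianMoment q + 1) * √(mesh N)) := by
        rw [← ENNReal.ofReal_add (by positivity) (by positivity)]
        ring_nf

namespace IsDyadicSemimartingale

theorem eLpNorm_sub_le_of_le (hZ : IsDyadicSemimartingale N C Z) (h𝕎 : IsWienerMeasure 𝕎) {ℓ : ℕ}
    (hℓ : ℓ ≤ N) (k : ℕ) {q : ℕ} (hq : q ≠ 0) :
    eLpNorm (fun w => Z w ((k + 1 : ℕ) * mesh ℓ) - Z w (k * mesh ℓ)) q 𝕎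
      ≤ ENNReal.ofReal (C * semimartingaleMoment r n q * √(mesh ℓ)) := by
  have hprob := h𝕎.isProbabilityMeasure
  obtain ⟨j, rfl⟩ := Nat.exists_eq_add_of_le hℓ
  obtain ⟨U, hU, hUC, hUZ⟩ := hZ.exists_integrand
  have hmesh : ((2 ^ j : ℕ) : ℝ≥0) * mesh (ℓ + j) = mesh ℓ := by
    rw [mesh_eq_two_pow_mul_mesh_add ℓ j]
    push_cast
    rfl
  have htelescope (w : Path (E r)) : Z w ((k + 1 : ℕ) * mesh ℓ) - Z w (k * mesh ℓ)
      = ∑ m ∈ Finset.range (2 ^ j), (Z w ((k * 2 ^ j + m + 1 : ℕ) * mesh (ℓ + j))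
        - Z w ((k * 2 ^ j + m : ℕ) * mesh (ℓ + j))) := by
    have hsum := Finset.sum_range_sub (fun m => Z w ((k * 2 ^ j + m : ℕ) * mesh (ℓ + j))) (2 ^ j)
    refine Eq.trans ?_ hsum.symm
    rw [← hmesh]
    push_cast
    ring_nf
  simp_rw [htelescope]
  have hle := (h𝕎.isSubgaussianWalk (ℓ + j)).eLpNorm_sum_le_of_norm_sub_le hU hUC hUZ (k * 2 ^ j)
    (k := 2 ^ j) (hmesh.trans_le (mesh_le_one ℓ)) hq
  have hcoe : ((2 ^ j : ℕ) : ℝ) * mesh (ℓ + j) = mesh ℓ := by exact_mod_cast hmesh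
  rwa [hcoe] at hle

theorem eLpNorm_sub_le_of_ge (hZ : IsDyadicSemimartingale N C Z) (h𝕎 : IsWienerMeasure 𝕎) {ℓ : ℕ}
    (hℓ : N ≤ ℓ) (k : ℕ) {q : ℕ} (hq : q ≠ 0) :
    eLpNorm (fun w => Z w ((k + 1 : ℕ) * mesh ℓ) - Z w (k * mesh ℓ)) q 𝕎
      ≤ ENNReal.ofReal (C * (r * subgaussianMoment q + 1) * √(mesh ℓ)) := by
  obtain ⟨j, rfl⟩ := Nat.exists_eq_add_of_le hℓ
  have hN : (0 : ℝ) < mesh N := mesh_pos N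
  have hmoment := subgaussianMoment_nonneg q
  set m := k / 2 ^ j
  set θ : ℝ := mesh (N + j) / mesh N with hθ
  have hθ_one : θ ≤ 1 := (div_le_one hN).2 (mesh_add_le N j)
  have hincr (w : Path (E r)) : ‖Z w ((k + 1 : ℕ) * mesh (N + j)) - Z w (k * mesh (N + j))‖
      ≤ C * θ * ‖‖dyadicIncrement N w m‖ + mesh N‖ := by
    have hle := hZ.norm_sub_le w m _ _ (dyadic_subinterval N j k).1
      (mul_mesh_le_succ_mul_mesh _ _) (dyadic_subinterval N j k).2
    rwa [coe_succ_mul_mesh_sub, ← hθ, ← Real.norm_of_nonneg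
      (show 0 ≤ ‖dyadicIncrement N w m‖ + mesh N by positivity)] at hle
  have hsqrt : θ * √(mesh N) ≤ √(mesh (N + j)) := by
    refine Real.le_sqrt_of_sq_le ?_
    rw [mul_pow, Real.sq_sqrt hN.le, sq, mul_assoc, hθ, div_mul_cancel₀ _ hN.ne', ← hθ]
    exact mul_le_of_le_one_left (NNReal.coe_nonneg _) hθ_one
  calc eLpNorm (fun w => Z w ((k + 1 : ℕ) * mesh (N + j)) - Z w (k * mesh (N + j))) q 𝕎
      ≤ ENNReal.ofReal (C * θ) * eLpNorm (fun w => ‖dyadicIncrement N w m‖ + mesh N) q 𝕎 :=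
        eLpNorm_le_mul_eLpNorm_of_ae_le_mul (ae_of_all _ hincr) _
    _ ≤ ENNReal.ofReal (C * θ)
          * ENNReal.ofReal ((r * subgaussianMoment q + 1) * √(mesh N)) := by
        gcongr
        exact h𝕎.eLpNorm_norm_dyadicIncrement_add_mesh_le N m hq
    _ = ENNReal.ofReal (C * (r * subgaussianMoment q + 1) * (θ * √(mesh N))) := by
        rw [← ENNReal.ofReal_mul (by positivity)]
        ring_nf
    _ ≤ ENNReal.ofReal (C * (r * subgaussianMoment q + 1) * √(mesh (N + j))) := by gcongr

theorem eLpNorm_sub_le (hZ : IsDyadicSemimartingale N C Z) (h𝕎 : IsWienerMeasure 𝕎) (ℓ k : ℕ)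
    {q : ℕ} (hq : q ≠ 0) :
    eLpNorm (fun w => Z w ((k + 1 : ℕ) * mesh ℓ) - Z w (k * mesh ℓ)) q 𝕎
      ≤ ENNReal.ofReal (incrementConst C r n q * √(mesh ℓ)) := by
  unfold incrementConst
  rcases le_total ℓ N with hℓ | hℓ
  · refine (hZ.eLpNorm_sub_le_of_le h𝕎 hℓ k hq).trans ?_
    gcongr
    exact le_max_left _ _
  · refine (hZ.eLpNorm_sub_le_of_ge h𝕎 hℓ k hq).trans ?_
    gcongr
    exact le_max_right _ _

theorem exists_measure_holderNorm_ge_le (C : ℝ≥0) (r n : ℕ) {β : ℝ} (hβ : 0 < β)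
    (hβ_half : β < 1 / 2) {p : ℝ} (hp : 0 ≤ p) (T : ℝ≥0) :
    ∃ K : ℝ, 0 ≤ K ∧ ∀ {𝕎 : Measure (Path (E r))} (_ : IsWienerMeasure 𝕎) (N : ℕ)
      {Z : Path (E r) → ℝ≥0 → E n} (_ : IsDyadicSemimartingale N C Z) (R : ℝ) (_ : 0 < R),
      𝕎 {w | ENNReal.ofReal R ≤ holderNorm β 0 T (Z w)} ≤ ENNReal.ofReal (K * R ^ (-p)) := by
  obtain ⟨q, hq⟩ := exists_nat_gt (max p (1 / (1 / 2 - β)))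
  have hpq : p < q := (le_max_left _ _).trans_lt hq
  have hqβ : 1 < q * (1 / 2 - β) :=
    (div_lt_iff₀ (by linarith)).1 ((le_max_right _ _).trans_lt hq)
  have hq_ne : q ≠ 0 := by rintro rfl; norm_num at hqβ
  set K := holderTailConst β (1 / 2) ⌈T⌉₊ q * incrementConst C r n q ^ q
  refine ⟨max 1 K, zero_le_one.trans (le_max_left _ _), fun {𝕎} h𝕎 N {Z} hZ R hR => ?_⟩
  have hprob := h𝕎.isProbabilityMeasure
  rcases le_total R 1 with hR_one | hR_one
  · exact prob_le_one.trans <| ENNReal.one_le_ofReal.2 <| one_le_mul_of_one_le_of_one_le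
      (le_max_left _ _) (Real.one_le_rpow_of_pos_of_le_one_of_nonpos hR hR_one (by linarith))
  · have hpow : (R ^ q)⁻¹ ≤ R ^ (-p) := by
      rw [← Real.rpow_natCast, ← Real.rpow_neg hR.le]
      exact Real.rpow_le_rpow_of_exponent_le hR_one (by linarith)
    have hmono : {w | ENNReal.ofReal R ≤ holderNorm β 0 T (Z w)}
        ⊆ {w | ENNReal.ofReal R ≤ holderNorm β 0 (⌈T⌉₊ : ℕ) (Z w)} :=
      fun w hw => le_trans hw (holderNorm_mono (Nat.le_ceil T) _)
    have htail := measure_holderNorm_ge_le (T := ⌈T⌉₊) hβ (by linarith) hqβ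
      (incrementConst_nonneg C r n q) hR hZ.continuous_path
      (fun t => (hZ.measurable t).aestronglyMeasurable) fun ℓ k _ => by
        rw [← Real.sqrt_eq_rpow]
        exact hZ.eLpNorm_sub_le h𝕎 ℓ k hq_ne
    refine ((measure_mono hmono).trans htail).trans (ENNReal.ofReal_le_ofReal ?_)
    rw [div_pow, mul_div_assoc', div_eq_mul_inv (_ * _)]
    gcongr
    exact le_max_right _ _

end IsDyadicSemimartingale

end Semimartingale

theorem norm_velocity_add_one {r : ℕ} (N : ℕ) (w : Path (E r)) (m : ℕ) :
    ‖velocity N w m‖ + 1 = (‖dyadicIncrement N w m‖ + mesh N) / mesh N := by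
  rw [velocity, norm_smul, coe_mesh, Real.norm_of_nonneg (by positivity)]
  field_simp

theorem mesh_smul_velocity {r : ℕ} (N : ℕ) (w : Path (E r)) (m : ℕ) :
    (mesh N : ℝ) • velocity N w m = dyadicIncrement N w m := by
  rw [velocity, smul_smul, coe_mesh, inv_mul_cancel₀ (by positivity), one_smul]

theorem dyadicInterp_sub {r : ℕ} (N : ℕ) (w : Path (E r)) {m : ℕ} {s t : ℝ≥0}
    (hms : m * mesh N ≤ s) (hst : s ≤ t) (htm : t ≤ (m + 1 : ℕ) * mesh N) :
    dyadicInterp N w t - dyadicInterp N w s = ((t : ℝ) - s) • velocity N w m := by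
  rw [dyadicInterp_eq N w m (hms.trans hst) htm, dyadicInterp_eq N w m hms (hst.trans htm),
    add_sub_add_left_eq_sub, ← sub_smul, sub_sub_sub_cancel_right]

theorem isDyadicSemimartingale_dyadicInterp (r N : ℕ) :
    IsDyadicSemimartingale N 1 fun w : Path (E r) => dyadicInterp N w where
  continuous_path w := (dyadicInterp N w).continuous
  measurable t := ((continuous_eval_const t).comp (continuous_dyadicInterp N)).measurable
  norm_sub_le w m s t hms hst htm := by
    have hst' : (0 : ℝ) ≤ t - s := sub_nonneg.2 (by exact_mod_cast hst)
    rw [dyadicInterp_sub N w hms hst htm, norm_smul, Real.norm_of_nonneg hst', NNReal.coe_one,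
      one_mul, div_mul_eq_mul_div, mul_div_assoc, ← norm_velocity_add_one]
    gcongr
    exact le_add_of_nonneg_right zero_le_one
  exists_integrand := by
    refine ⟨fun _ _ => ContinuousLinearMap.id ℝ (E r), fun _ => measurable_const,
      fun _ _ => ContinuousLinearMap.norm_id_le, fun m w => ?_⟩
    rw [dyadicInterp_sub N w le_rfl (mul_mesh_le_succ_mul_mesh N m) le_rfl, coe_succ_mul_mesh_sub,
      mesh_smul_velocity, ContinuousLinearMap.id_apply, sub_self, norm_zero]
    positivity

section Driver

variable {d r : ℕ} {O : Set (E d)} {σ : closure O → E r →L[ℝ] E d} {b : closure O → E d}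
  {A C : ℝ≥0}

theorem measurable_solX_node (h : IsControlled O σ b A) (N : ℕ) (x₀ : closure O) (m : ℕ) :
    Measurable[dyadicPast r N m] fun w => solX h N x₀ w (m * mesh N) := by
  induction m with
  | zero =>
    simp only [Nat.cast_zero, zero_mul, solX_zero]
    exact measurable_const
  | succ m ih =>
    have hstep (w : Path (E r)) : solX h N x₀ w ((m + 1 : ℕ) * mesh N)
        = flow h ((2 ^ N : ℝ) • dyadicIncrement N w m) (solX h N x₀ w (m * mesh N))
          ((m + 1 : ℕ) * mesh N - m * mesh N) :=
      solX_eq h N x₀ w m (mul_mesh_le_succ_mul_mesh N m) le_rfl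
    simp_rw [hstep]
    have hflow : Continuous fun p : E r × closure O =>
        flow h ((2 ^ N : ℝ) • p.1) p.2 ((m + 1 : ℕ) * mesh N - m * mesh N) :=
      (continuous_flow h).comp (g := fun p : E r × closure O × ℝ≥0 => flow h p.1 p.2.1 p.2.2)
        (f := fun p : E r × closure O =>
          ((2 ^ N : ℝ) • p.1, p.2, (m + 1 : ℕ) * mesh N - m * mesh N)) (by fun_prop)
    exact hflow.measurable.comp ((measurable_dyadicIncrement_of_lt N m.lt_succ_self).prodMk
      (ih.mono ((dyadicPast r N).mono m.le_succ) le_rfl))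

/-- The driver `X^N - L^N = x₀ + ∫ σ(X^N) dW^N + ∫ b(X^N) ds` of the reflected path. -/
noncomputable def solDriver (h : IsControlled O σ b A) (N : ℕ) (x₀ : closure O) (w : Path (E r))
    (t : ℝ≥0) : E d :=
  (solX h N x₀ w t : E d) - solL h N x₀ w t

variable {N m : ℕ} {x₀ : closure O} {w : Path (E r)} {s t u : ℝ≥0}

theorem norm_solDriver_sub_le (h : IsControlled O σ b A) (hms : m * mesh N ≤ s) (hst : s ≤ t)
    (htm : t ≤ (m + 1 : ℕ) * mesh N) :
    ‖solDriver h N x₀ w t - solDriver h N x₀ w s‖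
      ≤ A * (((t : ℝ) - s) / mesh N) * (‖dyadicIncrement N w m‖ + mesh N) := by
  rw [solDriver, solDriver, (isReflectedSolution_sol h N x₀ w).driver_sub_eq h hms hst htm]
  refine (intervalIntegral.norm_integral_le_of_norm_le_const fun u _ =>
    h.norm_drift_le (velocity N w m) _).trans (le_of_eq ?_)
  rw [abs_of_nonneg (sub_nonneg.2 (by exact_mod_cast hst)), norm_velocity_add_one]
  ring

theorem norm_solX_sub_node_le (h : IsControlled O σ b A) (hC : IsOscillationConst O C)
    (hmu : m * mesh N ≤ u) (hum : u ≤ (m + 1 : ℕ) * mesh N) :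
    ‖(solX h N x₀ w u : E d) - solX h N x₀ w (m * mesh N)‖
      ≤ C * (A * (‖dyadicIncrement N w m‖ + mesh N)) := by
  obtain ⟨μ, n, hrefl⟩ := (isReflectedSolution_sol h N x₀ w).exists_isReflection
  refine hC _ _ μ n hrefl _ _ _ hmu fun v hv =>
    (norm_solDriver_sub_le h le_rfl hv.1 (hv.2.trans hum)).trans ?_
  gcongr
  refine mul_le_of_le_one_right A.coe_nonneg ((div_le_one (by exact_mod_cast mesh_pos N)).2 ?_)
  rw [← coe_succ_mul_mesh_sub N m]
  gcongr
  exact hv.2.trans hum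

theorem norm_solDriver_sub_mesh_smul_drift_le (h : IsControlled O σ b A)
    (hC : IsOscillationConst O C) (N : ℕ) (x₀ : closure O) (w : Path (E r)) (m : ℕ) :
    ‖solDriver h N x₀ w ((m + 1 : ℕ) * mesh N) - solDriver h N x₀ w (m * mesh N)
        - (mesh N : ℝ) • drift σ b (velocity N w m) (solX h N x₀ w (m * mesh N))‖
      ≤ A ^ 2 * C * (‖dyadicIncrement N w m‖ + mesh N) ^ 2 := by
  have hN : (0 : ℝ) < mesh N := mesh_pos N
  have hm := mul_mesh_le_succ_mul_mesh N m
  rw [solDriver, solDriver, (isReflectedSolution_sol h N x₀ w).driver_sub_eq h le_rfl hm le_rfl,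
    ← coe_succ_mul_mesh_sub N m, ← intervalIntegral.integral_const,
    ← intervalIntegral.integral_sub (h.intervalIntegrable_drift _ _ _ _) intervalIntegrable_const]
  refine (intervalIntegral.norm_integral_le_of_norm_le_const
    (C := A * (‖velocity N w m‖ + 1) * (C * (A * (‖dyadicIncrement N w m‖ + mesh N))))
    fun u hu => ?_).trans (le_of_eq ?_)
  · rw [uIoc_of_le (by exact_mod_cast hm)] at hu
    refine (norm_sub_le_of_lipschitzWith (h.lipschitzWith_drift _) _ _).trans ?_
    push_cast
    gcongr
    exact norm_solX_sub_node_le h hC (NNReal.le_toNNReal_of_coe_le hu.1.le)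
      (Real.toNNReal_le_iff_le_coe.2 hu.2)
  · rw [coe_succ_mul_mesh_sub, abs_of_pos hN, norm_velocity_add_one]
    field_simp

theorem norm_solDriver_sub_σ_le (h : IsControlled O σ b A) (hC : IsOscillationConst O C)
    (N : ℕ) (x₀ : closure O) (w : Path (E r)) (m : ℕ) :
    ‖solDriver h N x₀ w ((m + 1 : ℕ) * mesh N) - solDriver h N x₀ w (m * mesh N)
        - σ (solX h N x₀ w (m * mesh N)) (dyadicIncrement N w m)‖
      ≤ (A + 2 * A ^ 2 * C) * (‖dyadicIncrement N w m‖ ^ 2 + mesh N) := by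
  set x := solX h N x₀ w (m * mesh N)
  set ξ := dyadicIncrement N w m
  have hdrift : (mesh N : ℝ) • drift σ b (velocity N w m) x = σ x ξ + (mesh N : ℝ) • b x := by
    rw [drift, smul_add, ← map_smul, mesh_smul_velocity]
  have hmain := norm_solDriver_sub_mesh_smul_drift_le h hC N x₀ w m
  rw [hdrift, ← sub_sub] at hmain
  have hb : ‖(mesh N : ℝ) • b x‖ ≤ mesh N * A := by
    rw [norm_smul, Real.norm_of_nonneg (mesh N).coe_nonneg]
    exact mul_le_mul_of_nonneg_left (h.norm_b_le x) (mesh N).coe_nonneg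
  have hsq : (‖ξ‖ + mesh N) ^ 2 ≤ 2 * (‖ξ‖ ^ 2 + mesh N) := by
    have hmesh : (mesh N : ℝ) ≤ 1 := mesh_le_one N
    nlinarith [sq_nonneg (‖ξ‖ - mesh N), (mesh N).coe_nonneg]
  refine (norm_le_norm_sub_add _ ((mesh N : ℝ) • b x)).trans ((add_le_add hmain hb).trans ?_)
  calc (A : ℝ) ^ 2 * C * (‖ξ‖ + mesh N) ^ 2 + mesh N * A
      ≤ A ^ 2 * C * (2 * (‖ξ‖ ^ 2 + mesh N)) + (‖ξ‖ ^ 2 + mesh N) * A := by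
        gcongr
        exact le_add_of_nonneg_left (by positivity)
    _ = (A + 2 * A ^ 2 * C) * (‖ξ‖ ^ 2 + mesh N) := by ring

theorem isDyadicSemimartingale_solDriver (h : IsControlled O σ b A) (hC : IsOscillationConst O C)
    (N : ℕ) (x₀ : closure O) :
    IsDyadicSemimartingale N (A + 2 * A ^ 2 * C) (solDriver h N x₀) where
  continuous_path w :=
    (continuous_subtype_val.comp (solX h N x₀ w).continuous).sub (solL h N x₀ w).continuous
  measurable t :=
    ((continuous_subtype_val.comp ((continuous_eval_const t).comp (continuous_solX h N x₀))).sub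
      ((continuous_eval_const t).comp (continuous_solL h N x₀))).measurable
  norm_sub_le w m s t hms hst htm := by
    refine (norm_solDriver_sub_le h hms hst htm).trans ?_
    have hst' : (0 : ℝ) ≤ t - s := sub_nonneg.2 (by exact_mod_cast hst)
    gcongr
    exact le_self_add
  exists_integrand := by
    refine ⟨fun m w => σ (solX h N x₀ w (m * mesh N)),
      fun m => h.lipschitz_σ.continuous.measurable.comp (measurable_solX_node h N x₀ m),
      fun m w => (h.norm_σ_le _).trans (by exact_mod_cast le_self_add), fun m w => ?_⟩
    exact_mod_cast norm_solDriver_sub_σ_le h hC N x₀ w m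

end Driver

/-! ### Tail bounds and tightness -/

section Tail

variable {d r : ℕ} {O : Set (E d)} {σ : closure O → E r →L[ℝ] E d} {b : closure O → E d}
  {A C : ℝ≥0}

section Oscillation

variable {x : Path (closure O)} {ℓ : Path (E d)} {μ : Measure ℝ≥0} {n : ℝ≥0 → E d} {β : ℝ}
  {T : ℝ≥0}

theorem IsOscillationConst.norm_sub_le_of_holderNorm_sub_le (hC : IsOscillationConst O C)
    (hℓ : IsReflection O x ℓ μ n) (hβ : 0 ≤ β) {H : ℝ} (hH : 0 ≤ H)
    (hy : holderNorm β 0 T (fun t => (x t : E d) - ℓ t) ≤ ENNReal.ofReal H) {u₁ u₂ : ℝ≥0}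
    (h₁₂ : u₁ ≤ u₂) (h₂ : u₂ ≤ T) :
    ‖(x u₂ : E d) - x u₁‖ ≤ C * (H * ((u₂ : ℝ) - u₁) ^ β) := by
  refine hC x ℓ μ n hℓ u₁ u₂ _ h₁₂ fun u hu => ?_
  have hpos : (0 : ℝ) ≤ u₂ - u₁ := sub_nonneg.2 (by exact_mod_cast h₁₂)
  rcases hu.1.eq_or_lt with rfl | h₁
  · rw [sub_self, norm_zero]
    exact mul_nonneg hH (Real.rpow_nonneg hpos β)
  · have hnonneg : (0 : ℝ) ≤ u - u₁ := sub_nonneg.2 (by exact_mod_cast hu.1)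
    refine (norm_sub_le_of_holderNorm_le hH hy zero_le h₁ (hu.2.trans h₂)).trans ?_
    exact mul_le_mul_of_nonneg_left
      (Real.rpow_le_rpow hnonneg (sub_le_sub_right (by exact_mod_cast hu.2) _) hβ) hH

theorem IsOscillationConst.max_holderNorm_le (hC : IsOscillationConst O C)
    (hℓ : IsReflection O x ℓ μ n) (hβ : 0 ≤ β) (T : ℝ≥0) :
    max (holderNorm β 0 T fun t => (x t : E d)) (holderNorm β 0 T ℓ)
      ≤ (C + 1 : ℝ≥0) * holderNorm β 0 T fun t => (x t : E d) - ℓ t := by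
  rcases eq_or_ne (holderNorm β 0 T fun t => (x t : E d) - ℓ t) ⊤ with htop | hfin
  · rw [htop, ENNReal.mul_top (by positivity)]
    exact le_top
  set H := (holderNorm β 0 T fun t => (x t : E d) - ℓ t).toReal
  have hH : 0 ≤ H := ENNReal.toReal_nonneg
  have hy := (ENNReal.ofReal_toReal hfin).ge
  rw [← ENNReal.ofReal_toReal hfin, ← ENNReal.ofReal_coe_nnreal,
    ← ENNReal.ofReal_mul (NNReal.coe_nonneg _), NNReal.coe_add, NNReal.coe_one]
  refine max_le (holderNorm_le fun u₁ u₂ _ h₁₂ h₂ => ?_) (holderNorm_le fun u₁ u₂ _ h₁₂ h₂ => ?_)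
  · have hpos : (0 : ℝ) ≤ u₂ - u₁ := sub_nonneg.2 (by exact_mod_cast h₁₂.le)
    refine (hC.norm_sub_le_of_holderNorm_sub_le hℓ hβ hH hy h₁₂.le h₂).trans ?_
    rw [← mul_assoc]
    gcongr
    exact le_add_of_nonneg_right zero_le_one
  · calc ‖ℓ u₂ - ℓ u₁‖
        = ‖((x u₂ : E d) - x u₁) - (((x u₂ : E d) - ℓ u₂) - (x u₁ - ℓ u₁))‖ := by
          congr 1
          abel
      _ ≤ C * (H * ((u₂ : ℝ) - u₁) ^ β) + H * ((u₂ : ℝ) - u₁) ^ β :=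
          (norm_sub_le _ _).trans (add_le_add
            (hC.norm_sub_le_of_holderNorm_sub_le hℓ hβ hH hy h₁₂.le h₂)
            (norm_sub_le_of_holderNorm_le hH hy zero_le h₁₂ h₂))
      _ = (C + 1) * H * ((u₂ : ℝ) - u₁) ^ β := by ring

end Oscillation

theorem setOf_le_max_holderNorm_subset (h : IsControlled O σ b A) (hC : IsOscillationConst O C)
    (N : ℕ) (x₀ : closure O) {β : ℝ} (hβ : 0 ≤ β) (T : ℝ≥0) (R : ℝ) :
    {w | ENNReal.ofReal R ≤ max (holderNorm β 0 T (dyadicInterp N w))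
        (max (holderNorm β 0 T (fun t => (solX h N x₀ w t : E d)))
          (holderNorm β 0 T (solL h N x₀ w)))}
      ⊆ {w | ENNReal.ofReal R ≤ holderNorm β 0 T (dyadicInterp N w)}
        ∪ {w | ENNReal.ofReal (R / (C + 1)) ≤ holderNorm β 0 T (solDriver h N x₀ w)} := by
  intro w hw
  refine (le_max_iff.1 (mem_ofPred_eq ▸ hw)).imp id fun hXL => ?_
  obtain ⟨μ, n, hℓ⟩ := (isReflectedSolution_sol h N x₀ w).exists_isReflection
  have hcoe : ENNReal.ofReal (C + 1) = (C + 1 : ℝ≥0) := ENNReal.ofReal_coe_nnreal (p := C + 1)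
  rw [mem_ofPred_eq, ENNReal.ofReal_div_of_pos (by positivity), hcoe]
  exact ENNReal.div_le_of_le_mul' (hXL.trans (hC.max_holderNorm_le hℓ hβ T))

theorem exists_measure_max_holderNorm_ge_le (h : IsControlled O σ b A)
    (hC : IsOscillationConst O C) (x₀ : closure O) {𝕎 : Measure (Path (E r))}
    (h𝕎 : IsWienerMeasure 𝕎) {β : ℝ} (hβ : 0 < β) (hβ_half : β < 1 / 2) {p : ℝ} (hp : 0 ≤ p)
    (T : ℝ≥0) :
    ∃ K : ℝ, ∀ (N : ℕ) (R : ℝ), 0 < R →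
      𝕎 {w | ENNReal.ofReal R ≤ max (holderNorm β 0 T (dyadicInterp N w))
        (max (holderNorm β 0 T (fun t => (solX h N x₀ w t : E d)))
          (holderNorm β 0 T (solL h N x₀ w)))} ≤ ENNReal.ofReal (K * R ^ (-p)) := by
  obtain ⟨K₁, hK₁, hW⟩ :=
    IsDyadicSemimartingale.exists_measure_holderNorm_ge_le 1 r r hβ hβ_half hp T
  obtain ⟨K₂, hK₂, hY⟩ := IsDyadicSemimartingale.exists_measure_holderNorm_ge_le
    (A + 2 * A ^ 2 * C) r d hβ hβ_half hp T
  refine ⟨K₁ + K₂ / (C + 1 : ℝ) ^ (-p), fun N R hR => ?_⟩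
  refine (measure_mono (setOf_le_max_holderNorm_subset h hC N x₀ hβ.le T R)).trans
    ((measure_union_le _ _).trans ?_)
  refine (add_le_add (hW h𝕎 N (isDyadicSemimartingale_dyadicInterp r N) R hR)
    (hY h𝕎 N (isDyadicSemimartingale_solDriver h hC N x₀) (R / (C + 1)) (by positivity))).trans
    (le_of_eq ?_)
  rw [← ENNReal.ofReal_add (by positivity) (by positivity),
    Real.div_rpow hR.le (by positivity)]
  ring_nf

end Tail

section Tightness

variable {Y : Type} [MetricSpace Y] {β : ℝ≥0}

theorem holderOnWith_of_holderNorm_le {n : ℕ} {e : Y → E n} (he : Isometry e) {f : ℝ≥0 → Y}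
    {T C : ℝ≥0} (h : holderNorm β 0 T (fun t => e (f t)) ≤ C) :
    HolderOnWith C β f (Iic T) := by
  rw [← ENNReal.ofReal_coe_nnreal] at h
  have hlt {s t : ℝ≥0} (hst : s < t) (ht : t ≤ T) :
      edist (f s) (f t) ≤ C * edist s t ^ (β : ℝ) := by
    have hle := norm_sub_le_of_holderNorm_le C.coe_nonneg h zero_le hst ht
    rw [← dist_eq_norm, he.dist_eq, dist_comm] at hle
    rw [edist_dist, edist_dist, dist_comm s, NNReal.dist_eq,
      abs_of_pos (sub_pos.2 (by exact_mod_cast hst)),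
      ENNReal.ofReal_rpow_of_nonneg (sub_nonneg.2 (by exact_mod_cast hst.le)) β.coe_nonneg,
      ← ENNReal.ofReal_coe_nnreal, ← ENNReal.ofReal_mul C.coe_nonneg]
    exact ENNReal.ofReal_le_ofReal hle
  intro s hs t ht
  rcases lt_trichotomy s t with hst | rfl | hts
  · exact hlt hst ht
  · simp only [edist_self, zero_le]
  · rw [edist_comm, edist_comm s]
    exact hlt hts hs

variable [ProperSpace Y] {Ω ι : Type*} [MeasurableSpace Ω] {P : Measure Ω}

theorem isCompact_setOf_holderOnWith (hβ : 0 < β) (y₀ : Y) (R : ℕ → ℝ≥0) :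
    IsCompact {f : Path Y | f 0 = y₀ ∧ ∀ j : ℕ, HolderOnWith (R j) β f (Iic (j : ℝ≥0))} := by
  set S : Set (Path Y) := {f | f 0 = y₀ ∧ ∀ j : ℕ, HolderOnWith (R j) β f (Iic (j : ℝ≥0))}
  have hequi : Equicontinuous
      fun f : {g : ℝ≥0 → Y | ∀ j : ℕ, HolderOnWith (R j) β g (Iic (j : ℝ≥0))} =>
        (f : ℝ≥0 → Y) := by
    intro t
    obtain ⟨j, hj⟩ := exists_nat_gt t
    refine Metric.equicontinuousAt_of_continuity_modulus
      (fun s => R j * dist t s ^ (β : ℝ)) ?_ _ ?_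
    · have hcont : Continuous fun s => R j * dist t s ^ (β : ℝ) :=
        continuous_const.mul ((continuous_const.dist continuous_id).rpow_const fun _ =>
          Or.inr β.coe_nonneg)
      simpa [hβ.ne'] using hcont.tendsto t
    · filter_upwards [Iio_mem_nhds hj] with s hs f
      exact (f.2 j).dist_le (mem_Iic.2 hj.le) (mem_Iic.2 (le_of_lt hs))
  refine ArzelaAscoli.isCompact_of_equicontinuous S ?_ (hequi.comp fun f : S => ⟨f, f.2.2⟩)
  have himage : ContinuousMap.toFun '' S
      = {g | g 0 = y₀ ∧ ∀ j : ℕ, HolderOnWith (R j) β g (Iic (j : ℝ≥0))} := by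
    ext g
    refine ⟨?_, fun hg => ⟨⟨g, hequi.continuous ⟨g, hg.2⟩⟩, hg, rfl⟩⟩
    rintro ⟨f, hf, rfl⟩
    exact hf
  rw [himage]
  refine (isCompact_univ_pi fun t : ℝ≥0 =>
    isCompact_closedBall y₀ (R ⌈t⌉₊ * dist t 0 ^ (β : ℝ))).of_isClosed_subset ?_ fun g hg t _ => ?_
  · simp only [HolderOnWith, ofPred_and, ofPred_forall]
    exact (isClosed_eq (continuous_apply 0) continuous_const).inter <| isClosed_iInter fun j =>
      isClosed_iInter fun s => isClosed_iInter fun _ => isClosed_iInter fun t =>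
      isClosed_iInter fun _ =>
        isClosed_le ((continuous_apply s).edist (continuous_apply t)) continuous_const
  · have hdist := (hg.2 ⌈t⌉₊).dist_le (mem_Iic.2 (Nat.le_ceil t)) (mem_Iic.2 zero_le)
    rwa [hg.1] at hdist

theorem isTightMeasureSet_map_of_holderOnWith {f : ι → Ω → Path Y} (hf : ∀ i, Measurable (f i))
    (y₀ : Y) (h₀ : ∀ i, ∀ᵐ ω ∂P, f i ω 0 = y₀) (hβ : 0 < β)
    (htail : ∀ (T : ℕ) (ε : ℝ≥0∞), 0 < ε →
      ∃ C : ℝ≥0, ∀ i, P {ω | ¬ HolderOnWith C β (f i ω) (Iic (T : ℝ≥0))} ≤ ε) :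
    IsTightMeasureSet (range fun i => P.map (f i)) := by
  rw [isTightMeasureSet_iff_exists_isCompact_measure_compl_le]
  intro ε hε
  obtain ⟨δ, hδ, hδε⟩ := ENNReal.exists_pos_sum_of_countable' hε.ne' ℕ
  choose C hC using fun j => htail j (δ j) (hδ j)
  have hK := isCompact_setOf_holderOnWith hβ y₀ C
  refine ⟨_, hK, ?_⟩
  rintro _ ⟨i, rfl⟩
  rw [Measure.map_apply (hf i) hK.isClosed.measurableSet.compl]
  have hsub : f i ⁻¹' {f | f 0 = y₀ ∧ ∀ j : ℕ, HolderOnWith (C j) β f (Iic (j : ℝ≥0))}ᶜ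
      ⊆ {ω | ¬ f i ω 0 = y₀}
        ∪ ⋃ j : ℕ, {ω | ¬ HolderOnWith (C j) β (f i ω) (Iic (j : ℝ≥0))} := by
    intro ω hω
    simpa only [mem_preimage, mem_compl_iff, mem_ofPred_eq, not_and_or, not_forall, mem_union,
      mem_iUnion] using hω
  refine (measure_mono hsub).trans ((measure_union_le _ _).trans ?_)
  rw [show P {ω | ¬ f i ω 0 = y₀} = 0 from h₀ i, zero_add]
  exact (measure_iUnion_le _).trans ((ENNReal.tsum_le_tsum fun j => hC j i).trans hδε.le)

theorem isTightMeasureSet_map_of_measure_holderNorm_ge_le {n : ℕ} {e : Y → E n} (he : Isometry e)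
    {f : ι → Ω → Path Y} (hf : ∀ i, Measurable (f i)) (y₀ : Y) (h₀ : ∀ i, ∀ᵐ ω ∂P, f i ω 0 = y₀)
    (hβ : 0 < β) {p : ℝ} (hp : 0 < p)
    (htail : ∀ T : ℕ, ∃ K : ℝ, ∀ (i : ι) (R : ℝ), 0 < R →
      P {ω | ENNReal.ofReal R ≤ holderNorm β 0 T fun t => e (f i ω t)}
        ≤ ENNReal.ofReal (K * R ^ (-p))) :
    IsTightMeasureSet (range fun i => P.map (f i)) := by
  refine isTightMeasureSet_map_of_holderOnWith hf y₀ h₀ hβ fun T ε hε => ?_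
  obtain ⟨K, hK⟩ := htail T
  have htendsto : Tendsto (fun R : ℝ => ENNReal.ofReal (K * R ^ (-p))) atTop (𝓝 0) := by
    rw [← ENNReal.ofReal_zero, ← mul_zero K]
    exact ENNReal.tendsto_ofReal ((tendsto_rpow_neg_atTop hp).const_mul K)
  obtain ⟨R, hR, hR_pos⟩ :=
    ((htendsto.eventually (ge_mem_nhds hε)).and (eventually_gt_atTop 0)).exists
  refine ⟨R.toNNReal, fun i => (measure_mono fun ω hω => ?_).trans ((hK i R hR_pos).trans hR)⟩
  by_contra hlt
  exact hω (holderOnWith_of_holderNorm_le he (not_le.1 hlt).le)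

theorem isTightMeasureSet_map_prodMk {𝓧 𝓨 : Type*} [TopologicalSpace 𝓧] [MeasurableSpace 𝓧]
    [TopologicalSpace 𝓨] [MeasurableSpace 𝓨] {f : ι → Ω → 𝓧} {g : ι → Ω → 𝓨}
    (hf : ∀ i, Measurable (f i)) (hg : ∀ i, Measurable (g i))
    (hf_tight : IsTightMeasureSet (range fun i => P.map (f i)))
    (hg_tight : IsTightMeasureSet (range fun i => P.map (g i))) :
    IsTightMeasureSet (range fun i => P.map fun ω => (f i ω, g i ω)) := by
  refine .prodMk ?_ ?_
  · rw [← range_comp]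
    convert hf_tight using 3 with i
    exact Measure.fst_map_prodMk (hg i)
  · rw [← range_comp]
    convert hg_tight using 3 with i
    exact Measure.snd_map_prodMk (hf i)

end Tightness

section Laws

variable {d r : ℕ} {O : Set (E d)} {σ : closure O → E r →L[ℝ] E d} {b : closure O → E d}
  {A C : ℝ≥0}

theorem IsWienerMeasure.ae_dyadicInterp_zero {𝕎 : Measure (Path (E r))} (h𝕎 : IsWienerMeasure 𝕎)
    (N : ℕ) : ∀ᵐ w ∂𝕎, dyadicInterp N w 0 = 0 := by
  have hzero (i : Fin r) : ∀ᵐ w : Path (E r) ∂𝕎, w 0 i = 0 :=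
    (h𝕎.isBrownian i).toIsPreBrownianReal.eval_zero_ae_eq_zero
  filter_upwards [ae_all_iff.2 hzero] with w hw
  rw [dyadicInterp_eq N w 0 (by simp) zero_le]
  ext i
  simp [hw i]

theorem measurable_pathTriple_sol (h : IsControlled O σ b A) (x₀ : closure O) (N : ℕ) :
    Measurable (pathTriple (fun N => solX h N x₀) (fun N => solL h N x₀) N) :=
  (continuous_solX h N x₀).measurable.prodMk
    ((continuous_solL h N x₀).measurable.prodMk (continuous_dyadicInterp N).measurable)

theorem isTightMeasureSet_approxLaw_sol (h : IsControlled O σ b A) (hC : IsOscillationConst O C)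
    (x₀ : closure O) {𝕎 : Measure (Path (E r))} (h𝕎 : IsWienerMeasure 𝕎) :
    IsTightMeasureSet (range fun N : ℕ =>
      approxLaw 𝕎 (fun N => solX h N x₀) (fun N => solL h N x₀) N) := by
  have : CompactSpace (closure O) := isCompact_iff_compactSpace.1 h.isCompact
  have hβ : (0 : ℝ≥0) < 1 / 4 := by norm_num
  have hβ_half : ((1 / 4 : ℝ≥0) : ℝ) < 1 / 2 := by norm_num
  have htail (T : ℝ≥0) :=
    exists_measure_max_holderNorm_ge_le h hC x₀ h𝕎 hβ hβ_half zero_le_one T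
  have hX_meas (N : ℕ) : Measurable (solX h N x₀) := (continuous_solX h N x₀).measurable
  have hL_meas (N : ℕ) : Measurable (solL h N x₀) := (continuous_solL h N x₀).measurable
  have hW_meas (N : ℕ) : Measurable (dyadicInterp (r := r) N) :=
    (continuous_dyadicInterp N).measurable
  have hX := isTightMeasureSet_map_of_measure_holderNorm_ge_le (P := 𝕎) isometry_subtype_coe
    hX_meas x₀ (fun N => ae_of_all _ (solX_zero h N x₀)) hβ one_pos fun T =>
      (htail T).imp fun K hK N R hR => (hK N R hR).trans' <| measure_mono <|
        ofPred_subset_ofPred_of_imp fun _ hw => le_max_of_le_right (le_max_of_le_left hw)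
  have hL := isTightMeasureSet_map_of_measure_holderNorm_ge_le (P := 𝕎) isometry_id
    hL_meas 0 (fun N => ae_of_all _ (solL_zero h N x₀)) hβ one_pos fun T =>
      (htail T).imp fun K hK N R hR => (hK N R hR).trans' <| measure_mono <|
        ofPred_subset_ofPred_of_imp fun _ hw => le_max_of_le_right (le_max_of_le_right hw)
  have hW := isTightMeasureSet_map_of_measure_holderNorm_ge_le (P := 𝕎) isometry_id
    hW_meas 0 h𝕎.ae_dyadicInterp_zero hβ one_pos fun T =>
      (htail T).imp fun K hK N R hR => (hK N R hR).trans' <| measure_mono <|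
        ofPred_subset_ofPred_of_imp fun _ hw => le_max_of_le_left hw
  exact isTightMeasureSet_map_prodMk hX_meas (fun N => (hL_meas N).prodMk (hW_meas N)) hX
    (isTightMeasureSet_map_prodMk hL_meas hW_meas hL hW)

end Laws

end ReflectedSDE

open ReflectedSDE in
theorem mainTheorem5_general {d r : ℕ} (O : Set (E d)) (hO_open : IsOpen O)
    (hO_bdd : Bornology.IsBounded O) {C₀ : ℝ≥0} (hball : HasUniformExteriorBall O C₀) {δ ρ : ℝ}
    (hδ : 0 < δ) (hρ : 0 < ρ) (hcone : HasUniformNormalCones O δ ρ)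
    (σ : closure O → E r →L[ℝ] E d) (hσ : ∃ K : ℝ≥0, LipschitzWith K σ)
    (b : closure O → E d) (hb : ∃ K : ℝ≥0, LipschitzWith K b) (x₀ : closure O)
    (𝕎 : Measure (Path (E r))) (h𝕎 : IsWienerMeasure 𝕎) :
    (∀ (N : ℕ) (w : Path (E r)), ∃! xl : Path (closure O) × Path (E d),
      IsReflectedSolution O σ b x₀ (dyadicInterp N w) xl.1 xl.2) ∧
    ∀ (X : ℕ → Path (E r) → Path (closure O)) (L : ℕ → Path (E r) → Path (E d)),
      (∀ N w, IsReflectedSolution O σ b x₀ (dyadicInterp N w) (X N w) (L N w)) →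
      (∀ β : ℝ, 0 < β → β < 1 / 2 → ∀ p : ℝ, 0 ≤ p → ∀ T : ℝ≥0,
        ∃ K : ℝ, ∀ (N : ℕ) (R : ℝ), 0 < R →
          𝕎 {w | ENNReal.ofReal R ≤ max (holderNorm β 0 T (dyadicInterp N w))
              (max (holderNorm β 0 T fun t => (X N w t : E d)) (holderNorm β 0 T (L N w)))}
            ≤ ENNReal.ofReal (K * R ^ (-p))) ∧
      (∀ N : ℕ, Measurable (pathTriple X L N)) ∧
      IsTightMeasureSet (range fun N : ℕ => approxLaw 𝕎 X L N) := by
  obtain ⟨κ, hσ⟩ := hσ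
  obtain ⟨κ', hb⟩ := hb
  obtain ⟨A, hA⟩ := exists_isControlled hO_open hO_bdd hball hσ hb
  obtain ⟨C, hC⟩ := exists_isOscillationConst hA.exteriorBall hA.norm_sub_le hδ hρ hcone
  have hsol := isReflectedSolution_sol hA
  refine ⟨fun N w => ⟨(solX hA N x₀ w, solL hA N x₀ w), hsol N x₀ w,
    fun xl hxl => Prod.ext_iff.2 (hxl.unique hA (hsol N x₀ w))⟩, fun X L hXL => ?_⟩
  obtain rfl : X = fun N => solX hA N x₀ :=
    funext fun N => funext fun w => ((hXL N w).unique hA (hsol N x₀ w)).1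
  obtain rfl : L = fun N => solL hA N x₀ :=
    funext fun N => funext fun w => ((hXL N w).unique hA (hsol N x₀ w)).2
  exact ⟨fun β hβ hβ_half p hp T =>
      exists_measure_max_holderNorm_ge_le hA hC x₀ h𝕎 hβ hβ_half hp T,
    measurable_pathTriple_sol hA x₀, isTightMeasureSet_approxLaw_sol hA hC x₀ h𝕎⟩

theorem mainTheorem5 {d r : ℕ} (O : Set (ReflectedSDE.E d))
    (hO_open : IsOpen O) (hO_conn : IsConnected O) (hO_bdd : Bornology.IsBounded O)
    (hO_adm : ReflectedSDE.IsAdmissible O)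
    (σ : closure O → ReflectedSDE.E r →L[ℝ] ReflectedSDE.E d) (hσ : ∃ K : ℝ≥0, LipschitzWith K σ)
    (b : closure O → ReflectedSDE.E d) (hb : ∃ K : ℝ≥0, LipschitzWith K b)
    (x₀ : closure O)
    (𝕎 : Measure (ReflectedSDE.Path (ReflectedSDE.E r)))
    (h𝕎 : ReflectedSDE.IsWienerMeasure 𝕎) :
    -- for every path the reflected equation driven by its polygonalization is uniquely solvable
    (∀ (N : ℕ) (w : ReflectedSDE.Path (ReflectedSDE.E r)),
      ∃! xl : ReflectedSDE.Path (closure O) × ReflectedSDE.Path (ReflectedSDE.E d),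
        ReflectedSDE.IsReflectedSolution O σ b x₀ (ReflectedSDE.dyadicInterp N w) xl.1 xl.2) ∧
    -- and the solutions `(X^N, L^N)` have the following properties
    ∀ (X : ℕ → ReflectedSDE.Path (ReflectedSDE.E r) → ReflectedSDE.Path (closure O))
      (L : ℕ → ReflectedSDE.Path (ReflectedSDE.E r) → ReflectedSDE.Path (ReflectedSDE.E d)),
      (∀ N w, ReflectedSDE.IsReflectedSolution O σ b x₀ (ReflectedSDE.dyadicInterp N w)
        (X N w) (L N w)) →
      -- the tail bound, with a constant which does not depend on `N`
      (∀ β : ℝ, 0 < β → β < 1 / 2 → ∀ p : ℝ, 1 < p → ∀ T : ℝ≥0, 0 < T →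
        ∃ K : ℝ, ∀ (N : ℕ) (R : ℝ), 0 < R →
          𝕎 {w | ENNReal.ofReal R ≤
              max (ReflectedSDE.holderNorm β 0 T (ReflectedSDE.dyadicInterp N w))
                (max (ReflectedSDE.holderNorm β 0 T (fun t => (X N w t : ReflectedSDE.E d)))
                  (ReflectedSDE.holderNorm β 0 T (L N w)))}
            ≤ ENNReal.ofReal (K * R ^ (-p))) ∧
      -- the laws `ℙ^N` are well defined and form a tight family
      (∀ N : ℕ, Measurable (ReflectedSDE.pathTriple X L N)) ∧
      IsTightMeasureSet (range fun N : ℕ => ReflectedSDE.approxLaw 𝕎 X L N) := by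
  obtain ⟨C₀, hball⟩ := hO_adm.exists_hasUniformExteriorBall
  obtain ⟨δ, hδ, ρ, hρ, hcone⟩ := hO_adm.exists_hasUniformNormalCones
  refine (mainTheorem5_general O hO_open hO_bdd hball hδ hρ hcone σ hσ b hb x₀ 𝕎 h𝕎).imp_right
    fun hgeneral X L hXL => (hgeneral X L hXL).imp_left
      fun htail β hβ hβ_half p hp T _ => htail β hβ hβ_half p (zero_le_one.trans hp.le) T
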